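/- Let $(\Omega,\mathcal E,P)$ be a probability space and $\mathcal F\subset\mathcal E$ a $\sigma$-subalgebra. $L^0(\mathcal F)$, $L^0(\mathcal E)$ are the spaces of classes (mod $P$-a.s. equality) of real random variables, and $\bar L^0(\mathcal F)$ is the complete lattice (a.s. order) of classes of $\mathcal F$-measurable random variables with values in $[-\infty,+\infty]$; $\bigvee,\bigwedge$ are taken in it. For $x\in L^0(\mathcal E)$ put $|||x|||_\infty=\bigwedge\{\xi\in\bar L^0(\mathcal F): \xi\ge 0,\ |x|\le\xi\}$, and let $$L^\infty_{\mathcal F}(\mathcal E)=\{x\in L^0(\mathcal E): |||x|||_\infty\in L^0(\mathcal F)\},\qquad L^1_{\mathcal F}(\mathcal E)=\{y\in L^0(\mathcal E): E(|y|\,|\mathcal F)<\infty \text{ a.s.}\},$$ with $E(z|\mathcal F)=E(z^+|\mathcal F)-E(z^-|\mathcal F)\in L^0(\mathcal F)$ for $z\in L^1_{\mathcal F}(\mathcal E)$. Let $f:L^\infty(\mathcal E)\to L^\infty(\mathcal F)$ be an $L^\infty$-conditional risk measure, i.e. $f(x)\le f(y)$ whenever $x\ge y$, and $f(x+y)=f(x)-y$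 for all $x\in L^\infty(\mathcal E)$, $y\in L^\infty(\mathcal F)$. Assume that $f$ is $L^0(\mathcal F)$-convex: $f(\xi x+(1-\xi)y)\le \xi f(x)+(1-\xi)f(y)$ for all $x,y\in L^\infty(\mathcal E)$ and $\xi\in L^0(\mathcal F)$ with $0\le\xi\le1$. Then there is a unique $\bar f:L^\infty_{\mathcal F}(\mathcal E)\to L^0(\mathcal F)$ that is monotone ($\bar f(x)\le\bar f(y)$ if $x\ge y$), cash invariant ($\bar f(x+y)=\bar f(x)-y$ for $x\in L^\infty_{\mathcal F}(\mathcal E)$, $y\in L^0(\mathcal F)$), satisfies $|\bar f(x)-\bar f(y)|\le|||x-y|||_\infty$ for all $x,y$, and coincides with $f$ on $L^\infty(\mathcal E)$. For $y\in L^1_{\mathcal F}(\mathcal E)$ put $$f^*(y)=\bigvee\{E(xy|\mathcal F)-f(x): x\in L^\infty(\mathcal E)\},\qquad \bar f^*(y)=\bigvee\{E(xy|\mathcal F)-\bar f(x): x\in L^\infty_{\mathcal F}(\mathcal E)\}.$$ The following statements are equivalent. 1. $f$ is continuous from above: if $x_n\searrow x$ a.s. with $x_n,x\in L^\infty(\mathcal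 E)$, then $f(x_n)\nearrow f(x)$ a.s. 2. $f$ has the Fatou property: if $(x_n)$ is a bounded sequence in $L^\infty(\mathcal E)$ converging a.s. to $x\in L^\infty(\mathcal E)$, then $f(x)\le\liminf_n f(x_n)$ a.s. 3. $f(x)=\bigvee\{E(xy|\mathcal F)-f^*(y): y\in L^1(\mathcal E),\ y\le 0,\ E(y|\mathcal F)=-1\}$ for all $x\in L^\infty(\mathcal E)$. 4. $f(x)=\bigvee\{E(xy|\mathcal F)-f^*(y): y\in L^1_{\mathcal F}(\mathcal E),\ y\le 0,\ E(y|\mathcal F)=-1\}$ for all $x\in L^\infty(\mathcal E)$. 5. $\bar f(x)=\bigvee\{E(xy|\mathcal F)-\bar f^*(y): y\in L^1_{\mathcal F}(\mathcal E),\ y\le 0,\ E(y|\mathcal F)=-1\}$ for all $x\in L^\infty_{\mathcal F}(\mathcal E)$. 6. $\bar f$ is $\sigma_{\varepsilon,\lambda}(L^\infty_{\mathcal F}(\mathcal E),L^1_{\mathcal F}(\mathcal E))$-lower semicontinuous: its epigraph $\{(x,r)\in L^\infty_{\mathcal F}(\mathcal E)\times L^0(\mathcal F): \bar f(x)\le r\}$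 is closed, where $L^\infty_{\mathcal F}(\mathcal E)$ carries the translation-invariant topology with the neighbourhood base at $0$ consisting of the sets $\{x: P(\max_{y\in Q}|E(xy|\mathcal F)|<\varepsilon)>1-\lambda\}$, $Q\subset L^1_{\mathcal F}(\mathcal E)$ finite, $\varepsilon>0$, $0<\lambda<1$, and $L^0(\mathcal F)$ the topology of convergence in probability. 7. $\bar f$ is $\sigma_{c}(L^\infty_{\mathcal F}(\mathcal E),L^1_{\mathcal F}(\mathcal E))$-lower semicontinuous: for every $r\in L^0(\mathcal F)$ the set $\{x\in L^\infty_{\mathcal F}(\mathcal E): \bar f(x)\le r\}$ is closed in the translation-invariant topology with the neighbourhood base at $0$ consisting of the sets $\{x: |E(xy|\mathcal F)|\le\varepsilon \text{ for all } y\in Q\}$, $Q\subset L^1_{\mathcal F}(\mathcal E)$ finite, $\varepsilon\in L^0(\mathcal F)$, $\varepsilon>0$ a.s. -/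

import Mathlib

open MeasureTheory Filter Topology

open scoped ENNReal

namespace CondRisk

/-! ### Random variables over a base `(Ω, 𝓕, P)` inside `(Ω, 𝓔, P)`

`Ω →ₘ[P] ℝ` is `L⁰(𝓔)`.  The spaces of (classes of) `𝓕`-measurable random variables are realised
as the classes that have an `𝓕`-measurable representative, so that `L⁰(𝓕) ⊆ L⁰(𝓔)`. -/

/-- `L⁰(𝓕)`, as a subgroup of `L⁰(𝓔) = (Ω →ₘ[P] ℝ)`. -/
def L0F {Ω : Type*} (mF : MeasurableSpace Ω) {mE : MeasurableSpace Ω} (P : Measure Ω) :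
    AddSubgroup (Ω →ₘ[P] ℝ) where
  carrier := {x | AEStronglyMeasurable[mF] x P}
  zero_mem' := ⟨(0 : Ω → ℝ), @stronglyMeasurable_zero _ _ mF _ _, AEEqFun.coeFn_zero⟩
  add_mem' {x y} hx hy := (hx.add hy).congr (AEEqFun.coeFn_add x y).symm
  neg_mem' {x} hx := AEStronglyMeasurable.congr hx.neg (AEEqFun.coeFn_neg x).symm

/-- `L̄⁰(𝓕)`: classes of `𝓕`-measurable extended real random variables, with the a.s. order. -/
@[ext]
structure ExtL0 {Ω : Type*} (mF : MeasurableSpace Ω) {mE : MeasurableSpace Ω} (P : Measure Ω) where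
  val : Ω →ₘ[P] EReal
  property : AEStronglyMeasurable[mF] val P

section ExtL0

variable {Ω : Type*} {mF mE : MeasurableSpace Ω} {P : Measure Ω}

noncomputable instance : PartialOrder (ExtL0 mF P) :=
  PartialOrder.lift ExtL0.val fun _ _ h => ExtL0.ext h

theorem ExtL0.le_iff (ζ η : ExtL0 mF P) : ζ ≤ η ↔ ∀ᵐ ω ∂P, ζ.1 ω ≤ η.1 ω :=
  AEEqFun.coeFn_le.symm

/-- The constant `+∞`. -/
noncomputable def extTop : ExtL0 mF P :=
  ⟨AEEqFun.const Ω ⊤, AEStronglyMeasurable.congr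
    ⟨fun _ => ⊤, @stronglyMeasurable_const _ _ mF _ _, ae_eq_refl _⟩
    (AEEqFun.coeFn_const Ω ⊤).symm⟩

theorem coeFn_extTop : ∀ᵐ ω ∂P, (extTop : ExtL0 mF P).1 ω = ⊤ :=
  AEEqFun.coeFn_const Ω ⊤

/-- The constant `c ∈ L⁰(𝓕)`. -/
noncomputable def constL0 (c : ℝ) : L0F mF P :=
  ⟨AEEqFun.const Ω c, AEStronglyMeasurable.congr
    ⟨fun _ => c, @stronglyMeasurable_const _ _ mF _ _, ae_eq_refl _⟩
    (AEEqFun.coeFn_const Ω c).symm⟩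

theorem coeFn_constL0 (c : ℝ) : ∀ᵐ ω ∂P, (constL0 c : L0F mF P).1 ω = c :=
  AEEqFun.coeFn_const Ω c

/-- The inclusion `L⁰(𝓕) ⊆ L̄⁰(𝓕)`. -/
noncomputable def toExt (ξ : L0F mF P) : ExtL0 mF P :=
  ⟨AEEqFun.comp Real.toEReal continuous_coe_real_ereal (ξ : Ω →ₘ[P] ℝ),
    (continuous_coe_real_ereal.comp_aestronglyMeasurable ξ.2).congr
      (AEEqFun.coeFn_comp _ continuous_coe_real_ereal _).symm⟩

theorem coeFn_toExt (ξ : L0F mF P) :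
    ∀ᵐ ω ∂P, (toExt ξ).1 ω = (((ξ : Ω →ₘ[P] ℝ) ω : ℝ) : EReal) :=
  AEEqFun.coeFn_comp _ continuous_coe_real_ereal _

theorem measurable_ereal_sub :
    Measurable (Function.uncurry fun a b : EReal => a - b) := by
  have h : (Function.uncurry fun a b : EReal => a - b) = fun p => p.1 + -p.2 := by
    funext p
    exact sub_eq_add_neg _ _
  rw [h]
  exact measurable_fst.add measurable_snd.neg

/-- Pointwise difference.  It is only applied to differences `ξ - η` with `ξ ∈ L⁰(𝓕)`
(finite), so no `∞ - ∞` ever occurs. -/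
noncomputable instance : Sub (ExtL0 mF P) where
  sub ζ η := ⟨AEEqFun.comp₂Measurable (fun a b => a - b) measurable_ereal_sub ζ.1 η.1, by
    refine AEStronglyMeasurable.congr ?_
      (AEEqFun.coeFn_comp₂Measurable _ measurable_ereal_sub _ _).symm
    obtain ⟨u, hu, hu'⟩ := ζ.2
    obtain ⟨v, hv, hv'⟩ := η.2
    refine ⟨fun ω => u ω - v ω, ?_, ?_⟩
    · exact (measurable_ereal_sub.comp (hu.measurable.prodMk hv.measurable)).stronglyMeasurable
    · filter_upwards [hu', hv'] with ω h1 h2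
      rw [h1, h2]⟩

theorem ExtL0.coeFn_sub (ζ η : ExtL0 mF P) : ∀ᵐ ω ∂P, (ζ - η).1 ω = ζ.1 ω - η.1 ω :=
  AEEqFun.coeFn_comp₂Measurable _ measurable_ereal_sub _ _

/-! ### `L̄⁰(𝓕)` is a complete lattice -/

/-- The pointwise infimum of a sequence. -/
noncomputable def seqInf (s : ℕ → ExtL0 mF P) : ExtL0 mF P :=
  ⟨AEEqFun.mk (fun ω => ⨅ n, (s n).1 ω)
      (Measurable.iInf fun n => (s n).1.measurable).aestronglyMeasurable, by
    refine AEStronglyMeasurable.congr ?_ (AEEqFun.coeFn_mk _ _).symm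
    choose u hu hu' using fun n => (s n).2
    refine ⟨fun ω => ⨅ n, u n ω, ?_, ?_⟩
    · exact (Measurable.iInf fun n => (hu n).measurable).stronglyMeasurable
    · filter_upwards [ae_all_iff.2 hu'] with ω h
      simp only [h]⟩

theorem coeFn_seqInf (s : ℕ → ExtL0 mF P) :
    ∀ᵐ ω ∂P, (seqInf s).1 ω = ⨅ n, (s n).1 ω :=
  AEEqFun.coeFn_mk _ _

/-- A strictly increasing measurable map of the extended reals into `[0, 1]`. -/
noncomputable def squash (x : EReal) : ℝ≥0∞ :=
  (ENNReal.orderIsoIicOneBirational (EReal.expOrderIso x)).1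

theorem squash_strictMono : StrictMono squash := fun _ _ h =>
  ENNReal.orderIsoIicOneBirational.strictMono (EReal.expOrderIso.strictMono h)

theorem squash_le_one (x : EReal) : squash x ≤ 1 :=
  (ENNReal.orderIsoIicOneBirational (EReal.expOrderIso x)).2

/-- Every nonempty family in `L̄⁰(𝓕)` has a greatest lower bound, and it is the pointwise
infimum of a sequence from the family. -/
theorem exists_seq_isGLB [IsFiniteMeasure P] (S : Set (ExtL0 mF P)) (hS : S.Nonempty) :
    ∃ s : ℕ → ExtL0 mF P, (∀ n, s n ∈ S) ∧ IsGLB S (seqInf s) := by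
  classical
  have hmeas : Measurable squash := squash_strictMono.monotone.measurable
  let J : (ℕ → ExtL0 mF P) → ℝ≥0∞ := fun s => ∫⁻ ω, squash ((seqInf s).1 ω) ∂P
  let V : Set ℝ≥0∞ := {c | ∃ s : ℕ → ExtL0 mF P, (∀ n, s n ∈ S) ∧ J s = c}
  have hV : V.Nonempty := by
    obtain ⟨a, ha⟩ := hS
    exact ⟨_, fun _ => a, fun _ => ha, rfl⟩
  have hJ : ∀ s t : ℕ → ExtL0 mF P, (∀ n, ∃ k, t k = s n) → J t ≤ J s := by
    intro s t hst
    refine lintegral_mono_ae ?_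
    filter_upwards [coeFn_seqInf s, coeFn_seqInf t] with ω h1 h2
    rw [h1, h2]
    refine squash_strictMono.monotone (le_iInf fun n => ?_)
    obtain ⟨k, hk⟩ := hst n
    rw [← hk]
    exact iInf_le (fun n => (t n).1 ω) k
  obtain ⟨c, -, hc, hcV⟩ := exists_seq_tendsto_sInf hV (OrderBot.bddBelow V)
  choose r hrS hr using hcV
  let s : ℕ → ExtL0 mF P := fun n => r n.unpair.1 n.unpair.2
  have hsS : ∀ n, s n ∈ S := fun n => hrS _ _
  have hmin : J s ≤ sInf V := by
    refine ge_of_tendsto' hc fun n => ?_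
    rw [← hr n]
    refine hJ _ _ fun k => ⟨Nat.pair n k, ?_⟩
    simp [s]
  refine ⟨s, hsS, ?_, ?_⟩
  · intro a ha
    let t : ℕ → ExtL0 mF P := fun n => Nat.casesOn n a s
    have htS : ∀ n, t n ∈ S := by
      intro n
      cases n with
      | zero => exact ha
      | succ n => exact hsS n
    have hts : J s ≤ J t := hmin.trans (sInf_le ⟨t, htS, rfl⟩)
    have hle : ∀ᵐ ω ∂P, (seqInf t).1 ω ≤ (seqInf s).1 ω := by
      filter_upwards [coeFn_seqInf s, coeFn_seqInf t] with ω h1 h2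
      rw [h1, h2]
      exact le_iInf fun n => iInf_le (fun n => (t n).1 ω) (n + 1)
    have hfin : J t ≠ ∞ := by
      refine ne_top_of_le_ne_top (measure_ne_top P Set.univ) ?_
      calc J t ≤ ∫⁻ _, 1 ∂P := lintegral_mono fun ω => squash_le_one _
        _ = P Set.univ := by simp
    have heq : ∀ᵐ ω ∂P, squash ((seqInf t).1 ω) = squash ((seqInf s).1 ω) := by
      refine ae_eq_of_ae_le_of_lintegral_le ?_ hfin ?_ hts
      · filter_upwards [hle] with ω h using squash_strictMono.monotone h
      · exact (hmeas.comp (seqInf s).1.measurable).aemeasurable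
    rw [ExtL0.le_iff]
    filter_upwards [heq, coeFn_seqInf t] with ω h1 h2
    rw [← squash_strictMono.injective h1, h2]
    exact iInf_le (fun n => (t n).1 ω) 0
  · intro b hb
    have hb' : ∀ n, ∀ᵐ ω ∂P, b.1 ω ≤ (s n).1 ω := fun n => (ExtL0.le_iff _ _).1 (hb (hsS n))
    rw [ExtL0.le_iff]
    filter_upwards [ae_all_iff.2 hb', coeFn_seqInf s] with ω h1 h2
    rw [h2]
    exact le_iInf h1

theorem exists_isGLB [IsFiniteMeasure P] (S : Set (ExtL0 mF P)) : ∃ g, IsGLB S g := by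
  rcases S.eq_empty_or_nonempty with rfl | hS
  · refine ⟨extTop, by simp, fun b _ => ?_⟩
    rw [ExtL0.le_iff]
    filter_upwards [coeFn_extTop (mF := mF) (P := P)] with ω h
    rw [h]
    exact le_top
  · obtain ⟨s, -, hs⟩ := exists_seq_isGLB S hS
    exact ⟨_, hs⟩

noncomputable instance [IsFiniteMeasure P] : InfSet (ExtL0 mF P) where
  sInf S := (exists_isGLB S).choose

/-- The complete lattice `L̄⁰(𝓕)`; `⨆` and `⨅` are the essential supremum and infimum of a family
of random variables. -/
noncomputable instance [IsFiniteMeasure P] : CompleteLattice (ExtL0 mF P) :=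
  completeLatticeOfInf _ fun S => (exists_isGLB S).choose_spec

end ExtL0

/-! ### The modules `L^∞_𝓕(𝓔)` and `L¹_𝓕(𝓔)` -/

/-- `|||x|||_∞ = ⋀ {ξ ∈ L̄⁰₊(𝓕) | |x| ≤ ξ}`. -/
noncomputable def normInf {Ω : Type*} (mF : MeasurableSpace Ω) {mE : MeasurableSpace Ω}
    {P : Measure Ω} [IsFiniteMeasure P] (x : Ω →ₘ[P] ℝ) : ExtL0 mF P :=
  sInf {ξ | (∀ᵐ ω ∂P, 0 ≤ ξ.1 ω) ∧ ∀ᵐ ω ∂P, ((|x ω| : ℝ) : EReal) ≤ ξ.1 ω}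

section normInf

variable {Ω : Type*} {mF mE : MeasurableSpace Ω} {P : Measure Ω} [IsFiniteMeasure P]

theorem abs_le_normInf (x : Ω →ₘ[P] ℝ) :
    ∀ᵐ ω ∂P, ((|x ω| : ℝ) : EReal) ≤ (normInf mF x).1 ω := by
  set T : Set (ExtL0 mF P) :=
    {ξ | (∀ᵐ ω ∂P, 0 ≤ ξ.1 ω) ∧ ∀ᵐ ω ∂P, ((|x ω| : ℝ) : EReal) ≤ ξ.1 ω} with hT
  have hne : T.Nonempty := by
    refine ⟨extTop, ?_, ?_⟩ <;> filter_upwards [coeFn_extTop (mF := mF) (P := P)] with ω h <;>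
      rw [h] <;> exact le_top
  obtain ⟨s, hs, hglb⟩ := exists_seq_isGLB T hne
  have heq : normInf mF x = seqInf s := (isGLB_sInf T).unique hglb
  rw [heq]
  filter_upwards [coeFn_seqInf s, ae_all_iff.2 fun n => (hs n).2] with ω h1 h2
  rw [h1]
  exact le_iInf h2

/-- `|||x|||_∞` is finite, that is, belongs to `L⁰(𝓕)`, as soon as `|x|` is dominated by an element
of `L⁰(𝓕)`, and conversely. -/
theorem exists_normInf_iff (x : Ω →ₘ[P] ℝ) :
    (∃ ξ : L0F mF P, toExt ξ = normInf mF x) ↔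
      ∃ ξ : L0F mF P, ∀ᵐ ω ∂P, |x ω| ≤ (ξ : Ω →ₘ[P] ℝ) ω := by
  constructor
  · rintro ⟨ξ, hξ⟩
    refine ⟨ξ, ?_⟩
    have h := abs_le_normInf (mF := mF) x
    rw [← hξ] at h
    filter_upwards [h, coeFn_toExt ξ] with ω h1 h2
    rw [h2] at h1
    exact EReal.coe_le_coe_iff.1 h1
  · rintro ⟨ξ, hξ⟩
    have h1 : normInf mF x ≤ toExt ξ := by
      refine sInf_le ⟨?_, ?_⟩
      · filter_upwards [hξ, coeFn_toExt ξ] with ω h1 h2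
        rw [h2]
        exact EReal.coe_nonneg.2 ((abs_nonneg _).trans h1)
      · filter_upwards [hξ, coeFn_toExt ξ] with ω h1 h2
        rw [h2]
        exact EReal.coe_le_coe_iff.2 h1
    rw [ExtL0.le_iff] at h1
    let u : Ω →ₘ[P] ℝ := AEEqFun.compMeasurable EReal.toReal measurable_ereal_toReal
      (normInf mF x).1
    have hu : u =ᵐ[P] EReal.toReal ∘ (normInf mF x).1 := AEEqFun.coeFn_compMeasurable _ _ _
    have humem : u ∈ L0F mF P := by
      obtain ⟨v, hv, hv'⟩ := (normInf mF x).2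
      refine ⟨fun ω => (v ω).toReal, hv.measurable.ereal_toReal.stronglyMeasurable, ?_⟩
      filter_upwards [hu, hv'] with ω h1 h2
      rw [h1, Function.comp_apply, h2]
    refine ⟨⟨u, humem⟩, ExtL0.ext (AEEqFun.ext ?_)⟩
    filter_upwards [coeFn_toExt (⟨u, humem⟩ : L0F mF P), hu, h1, coeFn_toExt ξ,
      abs_le_normInf (mF := mF) x] with ω k1 k2 k3 k4 k5
    rw [k1]
    rw [k2, Function.comp_apply]
    refine EReal.coe_toReal ?_ ?_
    · rw [k4] at k3
      exact ne_top_of_le_ne_top (EReal.coe_ne_top _) k3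
    · exact ne_bot_of_le_ne_bot (EReal.coe_ne_bot _) k5

end normInf

/-- `L^∞_𝓕(𝓔) = {x ∈ L⁰(𝓔) | |||x|||_∞ ∈ L⁰(𝓕)}`. -/
def LinfF {Ω : Type*} (mF : MeasurableSpace Ω) {mE : MeasurableSpace Ω} (P : Measure Ω)
    [IsFiniteMeasure P] : AddSubgroup (Ω →ₘ[P] ℝ) where
  carrier := {x | ∃ ξ : L0F mF P, toExt ξ = normInf mF x}
  zero_mem' := (exists_normInf_iff _).2 ⟨0, by
    filter_upwards [AEEqFun.coeFn_zero (μ := P) (β := ℝ)] with ω h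
    simp [h]⟩
  add_mem' {x y} hx hy := by
    obtain ⟨ξ, hξ⟩ := (exists_normInf_iff _).1 hx
    obtain ⟨η, hη⟩ := (exists_normInf_iff _).1 hy
    refine (exists_normInf_iff _).2 ⟨ξ + η, ?_⟩
    filter_upwards [hξ, hη, AEEqFun.coeFn_add x y,
      AEEqFun.coeFn_add (ξ : Ω →ₘ[P] ℝ) (η : Ω →ₘ[P] ℝ)] with ω h1 h2 h3 h4
    rw [AddSubgroup.coe_add, h3, h4]
    exact (abs_add_le _ _).trans (add_le_add h1 h2)
  neg_mem' {x} hx := by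
    obtain ⟨ξ, hξ⟩ := (exists_normInf_iff _).1 hx
    refine (exists_normInf_iff _).2 ⟨ξ, ?_⟩
    filter_upwards [hξ, AEEqFun.coeFn_neg x] with ω h1 h2
    rw [h2, Pi.neg_apply, abs_neg]
    exact h1

/-- `L¹_𝓕(𝓔) = {y ∈ L⁰(𝓔) | E(|y| | 𝓕) < ∞ a.s.}`.  Here `condLExp` is the conditional expectation
of nonnegative random variables with values in `[0, ∞]`. -/
def L1F {Ω : Type*} (mF : MeasurableSpace Ω) {mE : MeasurableSpace Ω} (P : Measure Ω) :
    Set (Ω →ₘ[P] ℝ) :=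
  {y | ∀ᵐ ω ∂P, condLExp mF P (fun ω => ‖y ω‖ₑ) ω < ∞}

/-- The conditional expectation `E(z | 𝓕) = E(z⁺ | 𝓕) - E(z⁻ | 𝓕) ∈ L⁰(𝓕)` of an element
`z ∈ L¹_𝓕(𝓔)`. -/
noncomputable def condE {Ω : Type*} (mF : MeasurableSpace Ω) {mE : MeasurableSpace Ω}
    {P : Measure Ω} (z : Ω →ₘ[P] ℝ) : L0F mF P :=
  ⟨AEEqFun.mk (fun ω => (condLExp mF P (fun ω => ENNReal.ofReal (z ω)) ω).toReal -
      (condLExp mF P (fun ω => ENNReal.ofReal (-z ω)) ω).toReal)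
      (((measurable_condLExp' mF P _).ennreal_toReal).sub
        ((measurable_condLExp' mF P _).ennreal_toReal)).aestronglyMeasurable,
    AEStronglyMeasurable.congr
      ⟨_, (((measurable_condLExp mF P _).ennreal_toReal).sub
        ((measurable_condLExp mF P _).ennreal_toReal)).stronglyMeasurable, ae_eq_refl _⟩
      (AEEqFun.coeFn_mk _ _).symm⟩

section inclusions

variable {Ω : Type*} {mF mE : MeasurableSpace Ω} {P : Measure Ω}

/-- The inclusion `L^∞(𝓔) ⊆ L^∞_𝓕(𝓔)`. -/
noncomputable def inclLinf [IsFiniteMeasure P] (x : Lp ℝ ∞ P) : LinfF mF P :=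
  ⟨(x : Ω →ₘ[P] ℝ), (exists_normInf_iff _).2
    ⟨constL0 ‖x‖, by
      filter_upwards [coeFn_constL0 (mF := mF) (P := P) ‖x‖,
        enorm_ae_le_eLpNormEssSup (x : Ω →ₘ[P] ℝ) P] with ω h1 h2
      rw [h1, Lp.norm_def, eLpNorm_exponent_top, ← Real.norm_eq_abs,
        ← toReal_enorm]
      refine ENNReal.toReal_mono ?_ h2
      rw [← eLpNorm_exponent_top]
      exact Lp.eLpNorm_ne_top x⟩⟩

/-- The inclusion `L⁰(𝓕) ⊆ L^∞_𝓕(𝓔)`. -/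
noncomputable def inclL0F [IsFiniteMeasure P] (y : L0F mF P) : LinfF mF P :=
  ⟨(y : Ω →ₘ[P] ℝ), (exists_normInf_iff _).2 ⟨⟨|(y : Ω →ₘ[P] ℝ)|, by
      obtain ⟨v, hv, hv'⟩ := y.2
      refine ⟨fun ω => |v ω|, continuous_abs.comp_stronglyMeasurable hv, ?_⟩
      filter_upwards [hv', AEEqFun.coeFn_abs (y : Ω →ₘ[P] ℝ)] with ω h1 h2
      rw [h2, h1]⟩, by
      filter_upwards [AEEqFun.coeFn_abs (y : Ω →ₘ[P] ℝ)] with ω h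
      rw [← h]⟩⟩

/-- The inclusion `L^∞(𝓕) ⊆ L⁰(𝓕)`; `L^∞(𝓕)` is Mathlib's `lpMeas`, the space of those elements of
`L^∞(𝓔)` that have an `𝓕`-measurable representative. -/
def inclLinfMeas (y : lpMeas ℝ ℝ mF ∞ P) : L0F mF P :=
  ⟨((y : Lp ℝ ∞ P) : Ω →ₘ[P] ℝ), y.2⟩

end inclusions

/-! ### Conditional risk measures on `L^∞(𝓔)` and on `L^∞_𝓕(𝓔)` -/

section riskMeasures

variable {Ω : Type*} {mF mE : MeasurableSpace Ω} {P : Measure Ω}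

/-- `f : L^∞(𝓔) → L^∞(𝓕)` is an `L^∞`-conditional risk measure. -/
structure IsLinfRiskMeasure (f : Lp ℝ ∞ P → lpMeas ℝ ℝ mF ∞ P) : Prop where
  monotone : ∀ x y : Lp ℝ ∞ P, y ≤ x → (f x : Lp ℝ ∞ P) ≤ f y
  cash_invariant : ∀ (x : Lp ℝ ∞ P) (y : lpMeas ℝ ℝ mF ∞ P), f (x + y) = f x - y

/-- `L⁰(𝓕)`-convexity: `f (ξ x + (1 - ξ) y) ≤ ξ f(x) + (1 - ξ) f(y)` for all `ξ ∈ L⁰(𝓕)` with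
`0 ≤ ξ ≤ 1`; `z` is the element `ξ x + (1 - ξ) y` of `L^∞(𝓔)`. -/
def IsL0Convex (f : Lp ℝ ∞ P → lpMeas ℝ ℝ mF ∞ P) : Prop :=
  ∀ (x y z : Lp ℝ ∞ P) (ξ : L0F mF P), 0 ≤ (ξ : Ω →ₘ[P] ℝ) → (ξ : Ω →ₘ[P] ℝ) ≤ 1 →
    (z : Ω →ₘ[P] ℝ) = ξ * (x : Ω →ₘ[P] ℝ) + (1 - (ξ : Ω →ₘ[P] ℝ)) * (y : Ω →ₘ[P] ℝ) →
    ((f z : Lp ℝ ∞ P) : Ω →ₘ[P] ℝ) ≤ ξ * ((f x : Lp ℝ ∞ P) : Ω →ₘ[P] ℝ) +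
      (1 - (ξ : Ω →ₘ[P] ℝ)) * ((f y : Lp ℝ ∞ P) : Ω →ₘ[P] ℝ)

/-- `fbar : L^∞_𝓕(𝓔) → L⁰(𝓕)` is an `L^∞_𝓕(𝓔)`-conditional risk measure.  Properness is automatic
for a function with values in `L⁰(𝓕)`. -/
structure IsLinfFRiskMeasure [IsFiniteMeasure P] (fbar : LinfF mF P → L0F mF P) : Prop where
  monotone : ∀ x y : LinfF mF P, (y : Ω →ₘ[P] ℝ) ≤ x → (fbar x : Ω →ₘ[P] ℝ) ≤ fbar y
  cash_invariant : ∀ (x : LinfF mF P) (y : L0F mF P), fbar (x + inclL0F y) = fbar x - y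

/-- `fbar` is an `L^∞_𝓕(𝓔)`-conditional risk measure that extends `f` and satisfies
`|fbar x - fbar y| ≤ |||x - y|||_∞`. -/
structure IsExtension [IsFiniteMeasure P] (f : Lp ℝ ∞ P → lpMeas ℝ ℝ mF ∞ P)
    (fbar : LinfF mF P → L0F mF P) : Prop where
  riskMeasure : IsLinfFRiskMeasure fbar
  lipschitz : ∀ x y : LinfF mF P, ∀ᵐ ω ∂P,
    ((|(fbar x : Ω →ₘ[P] ℝ) ω - (fbar y : Ω →ₘ[P] ℝ) ω| : ℝ) : EReal) ≤
      (normInf mF ((x - y : LinfF mF P) : Ω →ₘ[P] ℝ)).1 ω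
  extends_f : ∀ x : Lp ℝ ∞ P, fbar (inclLinf x) = inclLinfMeas (f x)

/-- Continuity from above: `xₙ ↘ x` a.s. implies `f(xₙ) ↗ f(x)` a.s. -/
def ContinuousFromAbove (f : Lp ℝ ∞ P → lpMeas ℝ ℝ mF ∞ P) : Prop :=
  ∀ (u : ℕ → Lp ℝ ∞ P) (x : Lp ℝ ∞ P),
    (∀ᵐ ω ∂P, Antitone (fun n => u n ω) ∧ Tendsto (fun n => u n ω) atTop (𝓝 (x ω))) →
    ∀ᵐ ω ∂P, Monotone (fun n => (f (u n) : Lp ℝ ∞ P) ω) ∧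
      Tendsto (fun n => (f (u n) : Lp ℝ ∞ P) ω) atTop (𝓝 ((f x : Lp ℝ ∞ P) ω))

/-- The Fatou property: if `(xₙ)` is bounded in `L^∞(𝓔)` and converges a.s. to `x`, then
`f(x) ≤ liminf f(xₙ)` a.s. -/
def FatouProperty (f : Lp ℝ ∞ P → lpMeas ℝ ℝ mF ∞ P) : Prop :=
  ∀ (u : ℕ → Lp ℝ ∞ P) (x : Lp ℝ ∞ P), (∃ C : ℝ, ∀ n, ‖u n‖ ≤ C) →
    (∀ᵐ ω ∂P, Tendsto (fun n => u n ω) atTop (𝓝 (x ω))) →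
    ∀ᵐ ω ∂P, (((f x : Lp ℝ ∞ P) ω : ℝ) : EReal) ≤
      liminf (fun n => (((f (u n) : Lp ℝ ∞ P) ω : ℝ) : EReal)) atTop

/-- The random conjugate `f*(y) = ⋁ {E(xy | 𝓕) - f(x) | x ∈ L^∞(𝓔)}`, for `y ∈ L¹_𝓕(𝓔)`. -/
noncomputable def randomConj [IsFiniteMeasure P] (f : Lp ℝ ∞ P → lpMeas ℝ ℝ mF ∞ P) (y : Ω →ₘ[P] ℝ) :
    ExtL0 mF P :=
  ⨆ x : Lp ℝ ∞ P, toExt (condE mF ((x : Ω →ₘ[P] ℝ) * y) - inclLinfMeas (f x))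

/-- The random conjugate `fbar*(y) = ⋁ {E(xy | 𝓕) - fbar(x) | x ∈ L^∞_𝓕(𝓔)}`, for
`y ∈ L¹_𝓕(𝓔)`. -/
noncomputable def randomConjExt [IsFiniteMeasure P] (fbar : LinfF mF P → L0F mF P) (y : Ω →ₘ[P] ℝ) :
    ExtL0 mF P :=
  ⨆ x : LinfF mF P, toExt (condE mF ((x : Ω →ₘ[P] ℝ) * y) - fbar x)

end riskMeasures

/-! ### Topologies induced by families of `L⁰`-seminorms -/

/-- The `(ε, λ)`-topology on `E` induced by a family `p` of random seminorms: the sets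
`{x | P(‖x‖_Q < ε) > 1 - λ}`, with `Q` finite, `ε > 0` and `0 < λ < 1`, form a neighbourhood base
at `0`. -/
@[reducible]
def epsLamTopology {Ω : Type*} {mE : MeasurableSpace Ω} (P : Measure Ω) [IsFiniteMeasure P]
    {E ι : Type*} [AddCommGroup E] (p : ι → E → Ω →ₘ[P] ℝ) : TopologicalSpace E where
  IsOpen G := ∀ x ∈ G, ∃ (Q : Finset ι) (ε lam : ℝ), 0 < ε ∧ 0 < lam ∧ lam < 1 ∧
    ∀ z, 1 - lam < P.real {ω | ∀ i ∈ Q, p i (z - x) ω < ε} → z ∈ G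
  isOpen_univ := fun _ _ => ⟨∅, 1, 1 / 2, by norm_num, by norm_num, by norm_num,
    fun _ _ => Set.mem_univ _⟩
  isOpen_inter := by
    classical
    rintro G H hG hH x ⟨hxG, hxH⟩
    obtain ⟨Q, ε, l, hε, hl, hl1, h⟩ := hG x hxG
    obtain ⟨Q', ε', l', hε', hl', hl1', h'⟩ := hH x hxH
    refine ⟨Q ∪ Q', min ε ε', min l l', lt_min hε hε', lt_min hl hl',
      (min_le_left _ _).trans_lt hl1, fun z hz => ⟨h z ?_, h' z ?_⟩⟩
    · refine lt_of_le_of_lt (by linarith [min_le_left l l']) (hz.trans_le (measureReal_mono ?_))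
      intro ω hω i hi
      exact (hω i (Finset.mem_union_left _ hi)).trans_le (min_le_left _ _)
    · refine lt_of_le_of_lt (by linarith [min_le_right l l']) (hz.trans_le (measureReal_mono ?_))
      intro ω hω i hi
      exact (hω i (Finset.mem_union_right _ hi)).trans_le (min_le_right _ _)
  isOpen_sUnion := by
    rintro s hs x ⟨G, hG, hxG⟩
    obtain ⟨Q, ε, l, hε, hl, hl1, h⟩ := hs G hG x hxG
    exact ⟨Q, ε, l, hε, hl, hl1, fun z hz => ⟨G, hG, h z hz⟩⟩

/-- The locally `L⁰`-convex topology on `E` induced by a family `p` of `L⁰(𝓕)`-seminorms: the sets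
`{x | ‖x‖_Q ≤ ε}`, with `Q` finite and `ε ∈ L⁰(𝓕)`, `ε > 0` a.s., form a neighbourhood base
at `0`. -/
@[reducible]
def locConvTopology {Ω : Type*} (mF : MeasurableSpace Ω) {mE : MeasurableSpace Ω} (P : Measure Ω)
    {E ι : Type*} [AddCommGroup E] (p : ι → E → Ω →ₘ[P] ℝ) : TopologicalSpace E where
  IsOpen G := ∀ x ∈ G, ∃ (Q : Finset ι) (ε : L0F mF P), (∀ᵐ ω ∂P, 0 < (ε : Ω →ₘ[P] ℝ) ω) ∧
    ∀ z, (∀ i ∈ Q, p i (z - x) ≤ ε) → z ∈ G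
  isOpen_univ := fun _ _ => ⟨∅, constL0 1, by
      filter_upwards [coeFn_constL0 (mF := mF) (P := P) 1] with ω h
      rw [h]
      exact one_pos, fun _ _ => Set.mem_univ _⟩
  isOpen_inter := by
    classical
    rintro G H hG hH x ⟨hxG, hxH⟩
    obtain ⟨Q, ε, hε, h⟩ := hG x hxG
    obtain ⟨Q', ε', hε', h'⟩ := hH x hxH
    refine ⟨Q ∪ Q', ⟨(ε : Ω →ₘ[P] ℝ) ⊓ ε', ?_⟩, ?_, fun z hz => ⟨h z ?_, h' z ?_⟩⟩
    · obtain ⟨u, hu, hu'⟩ := ε.2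
      obtain ⟨v, hv, hv'⟩ := ε'.2
      refine ⟨fun ω => u ω ⊓ v ω, (hu.measurable.inf hv.measurable).stronglyMeasurable, ?_⟩
      filter_upwards [hu', hv', AEEqFun.coeFn_inf (ε : Ω →ₘ[P] ℝ) ε'] with ω h1 h2 h3
      rw [h3, h1, h2]
    · filter_upwards [hε, hε', AEEqFun.coeFn_inf (ε : Ω →ₘ[P] ℝ) ε'] with ω h1 h2 h3
      rw [h3]
      exact lt_min h1 h2
    · exact fun i hi => (hz i (Finset.mem_union_left _ hi)).trans inf_le_left
    · exact fun i hi => (hz i (Finset.mem_union_right _ hi)).trans inf_le_right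
  isOpen_sUnion := by
    rintro s hs x ⟨G, hG, hxG⟩
    obtain ⟨Q, ε, hε, h⟩ := hs G hG x hxG
    exact ⟨Q, ε, hε, fun z hz => ⟨G, hG, h z hz⟩⟩

section lsc

variable {Ω : Type*} {mF mE : MeasurableSpace Ω} {P : Measure Ω} [IsFiniteMeasure P]

/-- The family `σ(L^∞_𝓕(𝓔), L¹_𝓕(𝓔))` of `L⁰`-seminorms `x ↦ |E(xy | 𝓕)|`, `y ∈ L¹_𝓕(𝓔)`. -/
noncomputable def weakSeminorm (y : L1F mF P) (x : LinfF mF P) : Ω →ₘ[P] ℝ :=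
  |(condE mF ((x : Ω →ₘ[P] ℝ) * (y : Ω →ₘ[P] ℝ)) : Ω →ₘ[P] ℝ)|

/-- The `L⁰`-norm `|·|` of `L⁰(𝓕)`, as a family with one member. -/
noncomputable def absNorm (_ : Unit) (r : L0F mF P) : Ω →ₘ[P] ℝ :=
  |(r : Ω →ₘ[P] ℝ)|

/-- `σ_{ε,λ}(L^∞_𝓕(𝓔), L¹_𝓕(𝓔))`-lower semicontinuity: the epigraph
`{(x, r) ∈ L^∞_𝓕(𝓔) × L⁰(𝓕) | fbar(x) ≤ r}` is closed for the product of the `(ε, λ)`-topologies. -/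
def IsLscEpsLam (fbar : LinfF mF P → L0F mF P) : Prop :=
  @IsClosed (LinfF mF P × L0F mF P)
    (@instTopologicalSpaceProd _ _ (epsLamTopology P (weakSeminorm (mF := mF) (P := P)))
      (epsLamTopology P (absNorm (mF := mF) (P := P))))
    {q | (fbar q.1 : Ω →ₘ[P] ℝ) ≤ q.2}

/-- `σ_c(L^∞_𝓕(𝓔), L¹_𝓕(𝓔))`-lower semicontinuity: all the sublevel sets
`{x ∈ L^∞_𝓕(𝓔) | fbar(x) ≤ r}`, `r ∈ L⁰(𝓕)`, are closed for the locally `L⁰`-convex topology. -/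
def IsLscLocConv (fbar : LinfF mF P → L0F mF P) : Prop :=
  ∀ r : L0F mF P, @IsClosed (LinfF mF P)
    (locConvTopology mF P (weakSeminorm (mF := mF) (P := P)))
    {x | (fbar x : Ω →ₘ[P] ℝ) ≤ r}

end lsc

end CondRisk

/-!
The equivalences rest on the cycle: continuity from above, Fatou property, dual representation of
`f`, dual representation of `fbar`, lower semicontinuity, continuity from above; the last two steps
are carried out for each of the two topologies.

*Locality.* Monotonicity and cash invariance force `f(x) = f(x')` on every `A ∈ 𝓕` on which `x = x'`
(`IsLinfRiskMeasure.congr_on`).  Hence the extension can only be the pointwise limit of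
`f((-n) ∨ x ∧ n)`, a sequence that is a.s. eventually constant because `|x|` is dominated by an
element of `L⁰(𝓕)`; this gives existence and uniqueness of `fbar`, and it carries the random
conjugate and the dual representation from `L^∞(𝓔)` to `L^∞_𝓕(𝓔)` (`dual_representation_ext`).

*The dual representation* (`dual_representation_of_fatou`).  The function `x ↦ ∫ f(x) dP` is a static
convex risk measure on `L^∞(𝓔)` with the Fatou property.  Such a function has almost-subgradients in
`L¹` (`exists_integrable_subgradient`).  This is the Krein–Šmulian argument, carried out in the
Hilbert space `L²`: the intersections of a sublevel set with the balls of `L^∞` are closed in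
`L²` by the Fatou property; they are separated from `0` by functionals in `L²` with summable
`L¹`-norms, and a separation theorem in `ℓ²` combines these to one integrable function
(`exists_integrable_separation`).  Monotonicity and cash invariance make the subgradient `y`
nonpositive with `E(y | 𝓕) = -1`.  The spaces `L¹(𝓔)` and `L¹_𝓕(𝓔)` give the same
set of such `y` (`mem_Lp_iff_mem_L1F`).  By locality, the family
`{E(xy | 𝓕) - f(x) | x}` is upwards directed, so that `f*(y)` is approached along a sequence and
`∫ f*(y) dP` is the static conjugate; the static duality gap bounds the integral of the conditional
one, which is therefore zero a.s.

*Semicontinuity.* A supremum of the affine functions `x ↦ E(xy | 𝓕) - fbar*(y)` is lower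
semicontinuous for both topologies: a point off the epigraph is separated from it by one `y` and a
gap `η > 0` on an event of positive probability (`exists_gap`).  Conversely, let `uₙ ↘ x` and
`f(uₙ) ≤ s` for all `n`.  Then `E((uₙ - x)y | 𝓕) → 0` a.s. by monotone convergence.  Thus `uₙ → x` in
the `(ε, λ)`-topology.  For the locally `L⁰`-convex topology, a neighbourhood of `x` need not contain
any `uₙ`, but it contains the gluing `u_N` along the `𝓕`-measurable first time `N` at which `uₙ`
satisfies the defining inequalities, and `f(u_N) ≤ s` by locality.  In both cases closedness
yields `f(x) ≤ s`.
-/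

namespace CondRisk

/-! ### Separation in Hilbert spaces -/

section Hilbert

variable {H : Type*} [NormedAddCommGroup H] [InnerProductSpace ℝ H] [CompleteSpace H]

/-- A decreasing sequence of nonempty bounded closed convex sets in a Hilbert space has a common
point: the elements of minimal norm form a Cauchy sequence. -/
theorem exists_mem_forall_of_antitone_convex {K : ℕ → Set H} (hne : ∀ n, (K n).Nonempty)
    (hcl : ∀ n, IsClosed (K n)) (hconv : ∀ n, Convex ℝ (K n)) (hanti : Antitone K)
    {R : ℝ} (hR : ∀ n, ∀ x ∈ K n, ‖x‖ ≤ R) : ∃ x, ∀ n, x ∈ K n := by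
  have hmin : ∀ n, ∃ p ∈ K n, ∀ x ∈ K n, ‖p‖ ≤ ‖x‖ := by
    intro n
    obtain ⟨p, hp, hp'⟩ :=
      exists_norm_eq_iInf_of_complete_convex (hne n) (hcl n).isComplete (hconv n) 0
    refine ⟨p, hp, fun x hx => ?_⟩
    simp only [zero_sub, norm_neg] at hp'
    rw [hp']
    exact ciInf_le (f := fun w : K n => ‖(w : H)‖)
      ⟨0, Set.forall_mem_range.2 fun _ => norm_nonneg _⟩ ⟨x, hx⟩
  choose p hp hpmin using hmin
  have hmono : Monotone fun n => ‖p n‖ := fun n m hnm => hpmin n _ (hanti hnm (hp m))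
  have hbdd : BddAbove (Set.range fun n => ‖p n‖) :=
    ⟨R, Set.forall_mem_range.2 fun n => hR n _ (hp n)⟩
  have hlim : Tendsto (fun n => ‖p n‖ ^ 2) atTop (𝓝 ((⨆ n, ‖p n‖) ^ 2)) :=
    (tendsto_atTop_ciSup hmono hbdd).pow 2
  have hkey : ∀ n m, n ≤ m → ‖p n - p m‖ ^ 2 ≤ 2 * (‖p m‖ ^ 2 - ‖p n‖ ^ 2) := by
    intro n m hnm
    have hmid : (1 / 2 : ℝ) • p n + (1 / 2 : ℝ) • p m ∈ K n :=
      hconv n (hp n) (hanti hnm (hp m)) (by norm_num) (by norm_num) (by norm_num)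
    have h1 := hpmin n _ hmid
    rw [← smul_add, norm_smul] at h1
    have h2 := parallelogram_law_with_norm ℝ (p n) (p m)
    have h3 : 2 * ‖p n‖ ≤ ‖p n + p m‖ := by
      norm_num at h1
      linarith
    nlinarith [norm_nonneg (p n), norm_nonneg (p n + p m)]
  have hcauchy : CauchySeq p := by
    refine Metric.cauchySeq_iff'.2 fun ε hε => ?_
    obtain ⟨N, hN⟩ := Metric.cauchySeq_iff'.1 hlim.cauchySeq (ε ^ 2 / 2) (by positivity)
    refine ⟨N, fun n hn => ?_⟩
    have h1 := hkey N n hn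
    have h2 := hN n hn
    rw [Real.dist_eq] at h2
    have h3 := (abs_lt.1 h2).2
    rw [dist_comm, dist_eq_norm]
    exact lt_of_pow_lt_pow_left₀ 2 hε.le (by linarith)
  obtain ⟨x, hx⟩ := cauchySeq_tendsto_of_complete hcauchy
  refine ⟨x, fun n => (hcl n).mem_of_tendsto hx ?_⟩
  filter_upwards [eventually_ge_atTop n] with m hm using hanti hm (hp m)

/-- Disjoint closed convex sets in a Hilbert space, one of which is bounded, can be strictly
separated. -/
theorem exists_inner_separation {K D : Set H} (hK : IsClosed K) (hKc : Convex ℝ K) {R : ℝ}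
    (hR : ∀ x ∈ K, ‖x‖ ≤ R) (hD : IsClosed D) (hDc : Convex ℝ D)
    (hdisj : Disjoint K D) :
    ∃ (v : H) (u : ℝ), (∀ d ∈ D, inner ℝ v d < u) ∧ ∀ x ∈ K, u ≤ inner ℝ v x := by
  -- boundedness makes the distance between the two sets positive
  obtain ⟨n, hn⟩ : ∃ n : ℕ, K ∩ Metric.cthickening (1 / (n + 1 : ℝ)) D = ∅ := by
    by_contra! hcon
    obtain ⟨x, hx⟩ := exists_mem_forall_of_antitone_convex
      (K := fun n : ℕ => K ∩ Metric.cthickening (1 / (n + 1 : ℝ)) D) hcon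
      (fun n => hK.inter Metric.isClosed_cthickening) (fun n => hKc.inter (hDc.cthickening _))
      (fun n m hnm => Set.inter_subset_inter_right _
        (Metric.cthickening_mono (one_div_le_one_div_of_le (by positivity) (by gcongr)) _))
      (fun n x hx => hR x hx.1)
    have hxD : x ∈ D := by
      rw [← hD.closure_eq, Metric.closure_eq_iInter_cthickening]
      refine Set.mem_iInter₂.2 fun ε hε => ?_
      obtain ⟨n, hn⟩ := exists_nat_one_div_lt hε
      exact Metric.cthickening_mono hn.le _ (hx n).2
    exact Set.disjoint_left.1 hdisj (hx 0).1 hxD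
  have hdisj' : Disjoint (Metric.thickening (1 / (n + 1 : ℝ)) D) K := by
    rw [Set.disjoint_left]
    intro x hx hxK
    have : x ∈ K ∩ Metric.cthickening (1 / (n + 1 : ℝ)) D :=
      ⟨hxK, Metric.thickening_subset_cthickening _ _ hx⟩
    rw [hn] at this
    exact this
  obtain ⟨g, u, h1, h2⟩ := geometric_hahn_banach_open (hDc.thickening _)
    Metric.isOpen_thickening hKc hdisj'
  refine ⟨(InnerProductSpace.toDual ℝ H).symm g, u, fun d hd => ?_, fun x hx => ?_⟩
  · rw [InnerProductSpace.toDual_symm_apply]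
    exact h1 d (Metric.self_subset_thickening (by positivity) _ hd)
  · rw [InnerProductSpace.toDual_symm_apply]
    exact h2 x hx

end Hilbert

/-! ### A Krein–Šmulian argument -/

section KreinSmulian

variable {Ω : Type*} {mE : MeasurableSpace Ω} {P : Measure Ω}

theorem integrable_tsum_of_summable {F : ℕ → Ω → ℝ} (hF : ∀ i, Integrable (F i) P)
    (hs : Summable fun i => ∫ ω, ‖F i ω‖ ∂P) : Integrable (fun ω => ∑' i, F i ω) P := by
  have hfin : ∑' i, ∫⁻ ω, ‖F i ω‖ₑ ∂P ≠ ∞ := by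
    have h1 : ∀ i, ∫⁻ ω, ‖F i ω‖ₑ ∂P = ENNReal.ofReal (∫ ω, ‖F i ω‖ ∂P) := fun i =>
      (ofReal_integral_norm_eq_lintegral_enorm (hF i)).symm
    simp_rw [h1]
    exact hs.tsum_ofReal_ne_top
  rw [← lintegral_tsum fun i => (hF i).1.enorm] at hfin
  have hsum : ∀ᵐ ω ∂P, Summable fun i => F i ω := by
    filter_upwards [ae_lt_top' (AEMeasurable.tsum fun i => (hF i).1.enorm) hfin] with ω hω
    refine Summable.of_norm ?_
    have : Summable fun i => ‖F i ω‖ₑ.toReal := ENNReal.summable_toReal hω.ne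
    simpa using this
  refine ⟨?_, ?_⟩
  · refine aestronglyMeasurable_of_tendsto_ae atTop
      (f := fun n ω => ∑ i ∈ Finset.range n, F i ω)
      (fun n => Finset.aestronglyMeasurable_fun_sum _ fun i _ => (hF i).1) ?_
    filter_upwards [hsum] with ω hω using hω.hasSum.tendsto_sum_nat
  · refine lt_of_le_of_lt (lintegral_mono fun ω => ?_) (lt_top_iff_ne_top.2 hfin)
    exact enorm_tsum_le_tsum_enorm

/-- The set of those elements of `L²` that are bounded by `r`. -/
def boundedBall (P : Measure Ω) (r : ℝ) : Set (Lp ℝ 2 P) := {x | ∀ᵐ ω ∂P, |x ω| ≤ r}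

theorem mem_boundedBall {r : ℝ} {x : Lp ℝ 2 P} :
    x ∈ boundedBall P r ↔ ∀ᵐ ω ∂P, |x ω| ≤ r := Iff.rfl

theorem isClosed_boundedBall (r : ℝ) : IsClosed (boundedBall P r) := by
  refine IsSeqClosed.isClosed fun z x hz hx => ?_
  obtain ⟨ns, -, hns⟩ := (tendstoInMeasure_of_tendsto_Lp hx).exists_seq_tendsto_ae
  filter_upwards [hns, ae_all_iff.2 fun n => hz n] with ω h1 h2
  exact le_of_tendsto' h1.abs fun n => h2 _

theorem convex_boundedBall (r : ℝ) : Convex ℝ (boundedBall P r) := by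
  intro x hx y hy a b ha hb hab
  filter_upwards [hx, hy, Lp.coeFn_add (a • x) (b • y), Lp.coeFn_smul a x, Lp.coeFn_smul b y]
    with ω h1 h2 h3 h4 h5
  rw [h3, Pi.add_apply, h4, h5]
  simp only [Pi.smul_apply, smul_eq_mul]
  calc |a * x ω + b * y ω| ≤ |a * x ω| + |b * y ω| := abs_add_le _ _
    _ = a * |x ω| + b * |y ω| := by rw [abs_mul, abs_mul, abs_of_nonneg ha, abs_of_nonneg hb]
    _ ≤ a * r + b * r := by gcongr
    _ = r := by rw [← add_mul, hab, one_mul]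

theorem boundedBall_mono {r s : ℝ} (h : r ≤ s) : boundedBall P r ⊆ boundedBall P s := by
  intro x hx
  rw [mem_boundedBall] at hx ⊢
  filter_upwards [hx] with ω h1 using h1.trans h

theorem norm_le_of_mem_boundedBall [IsProbabilityMeasure P] {r : ℝ} (hr : 0 ≤ r) {x : Lp ℝ 2 P}
    (hx : x ∈ boundedBall P r) : ‖x‖ ≤ r := by
  have := Lp.norm_le_of_ae_bound (f := x) hr (mem_boundedBall.1 hx)
  simpa [measureUnivNNReal] using this

theorem inner_L2_eq (v x : Lp ℝ 2 P) : inner ℝ v x = ∫ ω, v ω * x ω ∂P := by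
  rw [L2.inner_def]
  simp [mul_comm]

/-- The support function of `boundedBall P r` at `v` is `r * ‖v‖₁`, and it is attained. -/
theorem exists_inner_eq_integral_abs [IsProbabilityMeasure P] (v : Lp ℝ 2 P) {r : ℝ}
    (hr : 0 ≤ r) : ∃ d ∈ boundedBall P r, inner ℝ v d = r * ∫ ω, |v ω| ∂P := by
  have hm : AEStronglyMeasurable (fun ω => r * SignType.sign (v ω) : Ω → ℝ) P := by
    refine (aestronglyMeasurable_const.mul ?_)
    have h1 : Measurable fun t : ℝ => ((SignType.sign t : SignType) : ℝ) := by
      have : (fun t : ℝ => ((SignType.sign t : SignType) : ℝ)) =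
          fun t => if 0 < t then 1 else if t < 0 then -1 else 0 := by
        funext t
        rw [sign_apply]
        split_ifs <;> simp
      rw [this]
      exact Measurable.ite measurableSet_Ioi measurable_const
        (Measurable.ite measurableSet_Iio measurable_const measurable_const)
    exact (h1.comp_aemeasurable (Lp.aestronglyMeasurable v).aemeasurable).aestronglyMeasurable
  have hb : ∀ ω, |r * ((SignType.sign (v ω) : SignType) : ℝ)| ≤ r := by
    intro ω
    rw [abs_mul, abs_of_nonneg hr]
    refine mul_le_of_le_one_right hr ?_
    cases SignType.sign (v ω) <;> simp
  have hL : MemLp (fun ω => r * ((SignType.sign (v ω) : SignType) : ℝ)) 2 P :=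
    MemLp.of_bound hm r (Eventually.of_forall fun ω => by simpa using hb ω)
  refine ⟨hL.toLp _, ?_, ?_⟩
  · filter_upwards [hL.coeFn_toLp] with ω h
    rw [h]
    exact hb ω
  · rw [inner_L2_eq, ← integral_const_mul]
    refine integral_congr_ae ?_
    filter_upwards [hL.coeFn_toLp] with ω h
    rw [h, mul_left_comm, self_mul_sign]

theorem integrable_of_L2 [IsFiniteMeasure P] (v : Lp ℝ 2 P) : Integrable v P :=
  (Lp.memLp v).integrable (by norm_num)

theorem abs_inner_le_of_mem_boundedBall [IsFiniteMeasure P] {r : ℝ} (v : Lp ℝ 2 P)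
    {x : Lp ℝ 2 P} (hx : x ∈ boundedBall P r) : |inner ℝ v x| ≤ r * ∫ ω, |v ω| ∂P := by
  rw [inner_L2_eq, ← integral_const_mul]
  refine (abs_integral_le_integral_abs).trans (integral_mono_of_nonneg
    (Eventually.of_forall fun _ => abs_nonneg _) ((integrable_of_L2 v).abs.const_mul r) ?_)
  filter_upwards [hx] with ω h
  rw [abs_mul, mul_comm]
  exact mul_le_mul_of_nonneg_right h (abs_nonneg _)

/-- One step of the construction: finitely many functionals that separate `C ∩ {|x| ≤ r}` from `0`
are completed by a functional of `L¹`-norm at most `2 / r` to a family that separates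
`C ∩ {|x| ≤ 2 r}` from `0`. -/
theorem exists_separating_functional [IsProbabilityMeasure P] {C : Set (Lp ℝ 2 P)}
    (hC : Convex ℝ C) (hcl : ∀ r, IsClosed (C ∩ boundedBall P r)) {r : ℝ} (hr : 0 < r)
    (S : Finset (Lp ℝ 2 P)) (hS : ∀ x ∈ C ∩ boundedBall P r, ∃ v ∈ S, 1 < inner ℝ v x) :
    ∃ v : Lp ℝ 2 P, ∫ ω, |v ω| ∂P ≤ 2 / r ∧
      ∀ x ∈ C ∩ boundedBall P (2 * r), (∃ w ∈ S, 1 < inner ℝ w x) ∨ 1 < inner ℝ v x := by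
  set K : Set (Lp ℝ 2 P) :=
    (C ∩ boundedBall P (2 * r)) ∩ ⋂ w ∈ S, {x | inner ℝ w x ≤ 1} with hK
  have hKcl : IsClosed K := by
    refine (hcl _).inter (isClosed_biInter fun w _ => ?_)
    exact isClosed_le (continuous_const.inner continuous_id) continuous_const
  have hKc : Convex ℝ K := by
    refine (hC.inter (convex_boundedBall _)).inter (convex_iInter₂ fun w _ => ?_)
    exact convex_halfSpace_le (f := fun x => inner ℝ w x)
      ⟨fun x y => inner_add_right _ _ _, fun c x => inner_smul_right _ _ _⟩ 1
  have hdisj : Disjoint K (boundedBall P r) := by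
    rw [Set.disjoint_left]
    intro x hx hxr
    obtain ⟨w, hw, hw'⟩ := hS x ⟨hx.1.1, hxr⟩
    have := Set.mem_iInter₂.1 hx.2 w hw
    simp only [Set.mem_ofPred_eq] at this
    linarith
  obtain ⟨v, u, h1, h2⟩ := exists_inner_separation hKcl hKc
    (fun x hx => norm_le_of_mem_boundedBall (by positivity) hx.1.2) (isClosed_boundedBall r)
    (convex_boundedBall r) hdisj
  obtain ⟨d, hd, hd'⟩ := exists_inner_eq_integral_abs v hr.le
  have hu : r * ∫ ω, |v ω| ∂P < u := hd' ▸ h1 d hd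
  have hI : 0 ≤ ∫ ω, |v ω| ∂P := integral_nonneg fun _ => abs_nonneg _
  have hu0 : 0 < u := lt_of_le_of_lt (by positivity) hu
  refine ⟨(2 / u) • v, ?_, fun x hx => ?_⟩
  · have : ∫ ω, |((2 / u) • v : Lp ℝ 2 P) ω| ∂P = 2 / u * ∫ ω, |v ω| ∂P := by
      rw [← integral_const_mul]
      refine integral_congr_ae ?_
      filter_upwards [Lp.coeFn_smul (2 / u) v] with ω h
      rw [h, Pi.smul_apply, smul_eq_mul, abs_mul, abs_of_pos (by positivity : 0 < 2 / u)]
    rw [this, div_mul_eq_mul_div, div_le_div_iff₀ hu0 hr]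
    nlinarith
  · by_cases hxK : x ∈ K
    · right
      rw [real_inner_smul_left]
      have := h2 x hxK
      rw [div_mul_eq_mul_div, lt_div_iff₀ hu0]
      linarith
    · left
      by_contra! hcon
      exact hxK ⟨hx, Set.mem_iInter₂.2 fun w hw => hcon w hw⟩

/-- The sequence of functionals produced by iterating `exists_separating_functional`. -/
theorem exists_separating_seq [IsProbabilityMeasure P] {C : Set (Lp ℝ 2 P)}
    (hC : Convex ℝ C) (hcl : ∀ r, IsClosed (C ∩ boundedBall P r)) {ρ : ℝ} (hρ : 0 < ρ)
    (hdisj : C ∩ boundedBall P ρ = ∅) (hbdd : ∀ x ∈ C, ∃ r, x ∈ boundedBall P r) :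
    ∃ v : ℕ → Lp ℝ 2 P, (∀ n, ∫ ω, |v n ω| ∂P ≤ 2 / ρ * (1 / 2) ^ n) ∧
      ∀ x ∈ C, ∃ n, 1 < inner ℝ (v n) x := by
  classical
  have hr : ∀ n : ℕ, 0 < 2 ^ n * ρ := fun n => by positivity
  have step : ∀ (n : ℕ) (S : {S : Finset (Lp ℝ 2 P) //
      ∀ x ∈ C ∩ boundedBall P (2 ^ n * ρ), ∃ v ∈ S, 1 < inner ℝ v x}),
      ∃ v : Lp ℝ 2 P, ∫ ω, |v ω| ∂P ≤ 2 / (2 ^ n * ρ) ∧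
        ∀ x ∈ C ∩ boundedBall P (2 ^ (n + 1) * ρ),
          ∃ w ∈ insert v S.1, 1 < inner ℝ w x := by
    rintro n ⟨S, hS⟩
    obtain ⟨v, hv, hv'⟩ := exists_separating_functional hC hcl (hr n) S hS
    refine ⟨v, hv, fun x hx => ?_⟩
    rcases hv' x (by rwa [← mul_assoc, ← pow_succ']) with ⟨w, hw, hw'⟩ | h
    · exact ⟨w, Finset.mem_insert_of_mem hw, hw'⟩
    · exact ⟨v, Finset.mem_insert_self _ _, h⟩
  choose g hg hg' using step
  let S : (n : ℕ) → {S : Finset (Lp ℝ 2 P) //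
      ∀ x ∈ C ∩ boundedBall P (2 ^ n * ρ), ∃ v ∈ S, 1 < inner ℝ v x} := fun n =>
    Nat.rec ⟨∅, by simp [hdisj]⟩ (fun n S => ⟨insert (g n S) S.1, hg' n S⟩) n
  have hSmem : ∀ n, ∀ w ∈ (S n).1, ∃ k, w = g k (S k) := by
    intro n
    induction n with
    | zero =>
      intro w hw
      exact absurd hw (Finset.notMem_empty w)
    | succ n ih =>
      intro w hw
      rcases Finset.mem_insert.1 (show w ∈ insert (g n (S n)) (S n).1 from hw) with h | h
      · exact ⟨n, h⟩
      · exact ih w h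
  refine ⟨fun n => g n (S n), fun n => (hg n (S n)).trans (le_of_eq ?_), fun x hx => ?_⟩
  · rw [one_div, inv_pow]
    field_simp
  · obtain ⟨r, hxr⟩ := hbdd x hx
    obtain ⟨n, hn⟩ := pow_unbounded_of_one_lt (r / ρ) (one_lt_two : (1 : ℝ) < 2)
    obtain ⟨w, hw, hw'⟩ := (S n).2 x ⟨hx, boundedBall_mono ((div_lt_iff₀ hρ).1 hn).le hxr⟩
    obtain ⟨k, rfl⟩ := hSmem n w hw
    exact ⟨k, hw'⟩

/-- A convex set of bounded random variables all of whose bounded parts are closed in `L²`, and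
which has positive `L^∞`-distance from `0`, is separated from `0` by an element of `L¹`. -/
theorem exists_integrable_separation [IsProbabilityMeasure P] {C : Set (Lp ℝ 2 P)}
    (hC : Convex ℝ C) (hcl : ∀ r, IsClosed (C ∩ boundedBall P r)) {ρ : ℝ} (hρ : 0 < ρ)
    (hdisj : C ∩ boundedBall P ρ = ∅) (hbdd : ∀ x ∈ C, ∃ r, x ∈ boundedBall P r) :
    ∃ (w : Ω → ℝ) (u : ℝ), Integrable w P ∧ 0 < u ∧ ∀ x ∈ C, u ≤ ∫ ω, w ω * x ω ∂P := by
  obtain ⟨v, hv, hvC⟩ := exists_separating_seq hC hcl hρ hdisj hbdd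
  have hgeom : Summable fun n : ℕ => 2 / ρ * (1 / 2 : ℝ) ^ n :=
    summable_geometric_two.mul_left _
  have hvs : Summable fun n => ∫ ω, |v n ω| ∂P :=
    Summable.of_nonneg_of_le (fun n => integral_nonneg fun _ => abs_nonneg _) hv hgeom
  -- evaluating the functionals maps the bounded random variables into `ℓ²`
  have hmem : ∀ x ∈ C, Memℓp (fun n => inner ℝ (v n) x : ℕ → ℝ) 2 := by
    intro x hx
    obtain ⟨r, hxr⟩ := hbdd x hx
    have h1 : Memℓp (fun n => inner ℝ (v n) x : ℕ → ℝ) 1 := by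
      refine memℓp_gen ?_
      simp only [ENNReal.toReal_one, Real.rpow_one]
      exact Summable.of_nonneg_of_le (fun n => norm_nonneg _)
        (fun n => abs_inner_le_of_mem_boundedBall (v n) hxr) (hvs.mul_left r)
    exact h1.of_exponent_ge (by norm_num)
  let B : Set (lp (fun _ : ℕ => ℝ) 2) := {b | ∃ x ∈ C, ∀ n, b n = inner ℝ (v n) x}
  have hBc : Convex ℝ B := by
    rintro b ⟨x, hx, hb⟩ b' ⟨x', hx', hb'⟩ s t hs ht hst
    refine ⟨s • x + t • x', hC hx hx' hs ht hst, fun n => ?_⟩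
    rw [inner_add_right, inner_smul_right, inner_smul_right, ← hb, ← hb']
    rfl
  -- some coordinate of each element of `B` exceeds `1`, so `B` avoids the open unit ball of `ℓ²`
  have hBd : Disjoint (Metric.ball (0 : lp (fun _ : ℕ => ℝ) 2) 1) B := by
    rw [Set.disjoint_left]
    rintro b hb ⟨x, hx, hb'⟩
    obtain ⟨n, hn⟩ := hvC x hx
    rw [mem_ball_zero_iff] at hb
    have h1 := lp.norm_apply_le_norm (p := 2) (by norm_num) b n
    rw [hb' n, Real.norm_eq_abs] at h1
    linarith [le_abs_self (inner ℝ (v n) x)]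
  obtain ⟨G, u, h1, h2⟩ := geometric_hahn_banach_open (convex_ball _ _) Metric.isOpen_ball hBc hBd
  have hu : 0 < u := by simpa using h1 0 (Metric.mem_ball_self one_pos)
  set a : lp (fun _ : ℕ => ℝ) 2 := (InnerProductSpace.toDual ℝ _).symm G with ha
  have hGa : ∀ b, G b = ∑' n, a n * b n := by
    intro b
    rw [← InnerProductSpace.toDual_symm_apply (𝕜 := ℝ), ← ha, lp.inner_eq_tsum]
    simp [mul_comm]
  have han : ∀ n, |a n| ≤ ‖a‖ := fun n => lp.norm_apply_le_norm (p := 2) (by norm_num) a n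
  have hint : ∀ n, Integrable (fun ω => a n * v n ω) P := fun n =>
    (integrable_of_L2 (v n)).const_mul _
  have hnorm : ∀ n, ∫ ω, ‖a n * v n ω‖ ∂P ≤ ‖a‖ * ∫ ω, |v n ω| ∂P := by
    intro n
    simp_rw [norm_mul, integral_const_mul, Real.norm_eq_abs]
    exact mul_le_mul_of_nonneg_right (han n) (integral_nonneg fun _ => abs_nonneg _)
  have hsum : Summable fun n => ∫ ω, ‖a n * v n ω‖ ∂P :=
    Summable.of_nonneg_of_le (fun n => integral_nonneg fun _ => norm_nonneg _) hnorm
      (hvs.mul_left _)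
  refine ⟨fun ω => ∑' n, a n * v n ω, u, integrable_tsum_of_summable hint hsum, hu,
    fun x hx => ?_⟩
  obtain ⟨r, hxr⟩ := hbdd x hx
  have hxn : ∀ᵐ ω ∂P, ‖x ω‖ ≤ r := hxr
  have hint' : ∀ n, Integrable (fun ω => a n * v n ω * x ω) P := fun n =>
    (hint n).mul_bdd (c := r) (Lp.aestronglyMeasurable x) hxn
  have hsum' : Summable fun n => ∫ ω, ‖a n * v n ω * x ω‖ ∂P := by
    refine Summable.of_nonneg_of_le (fun n => integral_nonneg fun _ => norm_nonneg _)
      (fun n => ?_) (hsum.mul_left r)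
    rw [← integral_const_mul]
    refine integral_mono_ae (hint' n).norm ((hint n).norm.const_mul r) ?_
    filter_upwards [hxn] with ω h
    rw [norm_mul, mul_comm]
    exact mul_le_mul_of_nonneg_right h (norm_nonneg _)
  have hfinal : ∫ ω, (∑' n, a n * v n ω) * x ω ∂P = G ⟨_, hmem x hx⟩ := by
    simp_rw [← tsum_mul_right]
    rw [← integral_tsum_of_summable_integral_norm hint' hsum', hGa]
    refine tsum_congr fun n => ?_
    simp_rw [mul_assoc]
    rw [integral_const_mul, ← inner_L2_eq]
  rw [hfinal]
  exact h2 _ ⟨x, hx, fun n => rfl⟩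

end KreinSmulian

/-! ### Static risk measures with the Fatou property -/

section Static

variable {Ω : Type*} {mE : MeasurableSpace Ω} {P : Measure Ω}

theorem ae_abs_le_norm (x : Lp ℝ ∞ P) : ∀ᵐ ω ∂P, |x ω| ≤ ‖x‖ := by
  filter_upwards [enorm_ae_le_eLpNormEssSup (x : Ω →ₘ[P] ℝ) P] with ω h
  rw [Lp.norm_def, eLpNorm_exponent_top, ← Real.norm_eq_abs, ← toReal_enorm]
  refine ENNReal.toReal_mono ?_ h
  rw [← eLpNorm_exponent_top]
  exact Lp.eLpNorm_ne_top x

theorem norm_le_of_ae_abs_le [IsFiniteMeasure P] {x : Lp ℝ ∞ P} {C : ℝ} (hC : 0 ≤ C)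
    (h : ∀ᵐ ω ∂P, |x ω| ≤ C) : ‖x‖ ≤ C := by
  simpa using Lp.norm_le_of_ae_bound (f := x) hC h

theorem exists_Linf_ae_eq {g : Ω → ℝ} (hg : AEStronglyMeasurable g P) {C : ℝ}
    (h : ∀ᵐ ω ∂P, |g ω| ≤ C) : ∃ x : Lp ℝ ∞ P, ∀ᵐ ω ∂P, x ω = g ω :=
  ⟨(memLp_top_of_bound hg C h).toLp g, (memLp_top_of_bound hg C h).coeFn_toLp⟩

theorem exists_L2_ae_eq [IsFiniteMeasure P] (x : Lp ℝ ∞ P) :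
    ∃ z : Lp ℝ 2 P, ∀ᵐ ω ∂P, z ω = x ω :=
  ⟨_, ((Lp.memLp x).mono_exponent le_top).coeFn_toLp⟩

theorem integrable_mul_Linf {w : Ω → ℝ} (hw : Integrable w P) (x : Lp ℝ ∞ P) :
    Integrable (fun ω => w ω * x ω) P :=
  hw.mul_bdd (c := ‖x‖) (Lp.aestronglyMeasurable x) (ae_abs_le_norm x)

/-- An almost-subgradient in `L¹`: the `L¹`-dual representation of a convex risk measure with the
Fatou property. -/
theorem exists_integrable_subgradient [IsProbabilityMeasure P] {φ : Lp ℝ ∞ P → ℝ}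
    (hmono : ∀ x y, y ≤ x → φ x ≤ φ y)
    (hcash : ∀ (x : Lp ℝ ∞ P) (c : ℝ), φ (x + Lp.const ∞ P c) = φ x - c)
    (hconv : ConvexOn ℝ Set.univ φ)
    (hfatou : ∀ (s : ℕ → Lp ℝ ∞ P) (x : Lp ℝ ∞ P) (c : ℝ), (∃ C : ℝ, ∀ n, ‖s n‖ ≤ C) →
      (∀ᵐ ω ∂P, Tendsto (fun n => s n ω) atTop (𝓝 (x ω))) → (∀ n, φ (s n) ≤ c) → φ x ≤ c)
    (x₀ : Lp ℝ ∞ P) {δ : ℝ} (hδ : 0 < δ) :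
    ∃ y : Ω → ℝ, Integrable y P ∧ (∀ᵐ ω ∂P, y ω ≤ 0) ∧
      ∀ x : Lp ℝ ∞ P, φ x₀ - δ + ∫ ω, y ω * (x ω - x₀ ω) ∂P ≤ φ x := by
  -- the translate by `x₀` of a sublevel set that does not contain `x₀`, regarded in `L²`
  let C : Set (Lp ℝ 2 P) :=
    {z | ∃ x : Lp ℝ ∞ P, (∀ᵐ ω ∂P, z ω = x ω) ∧ φ (x₀ + x) ≤ φ x₀ - δ}
  have hC : Convex ℝ C := by
    rintro z ⟨x, hx, hφ⟩ z' ⟨x', hx', hφ'⟩ a b ha hb hab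
    refine ⟨a • x + b • x', ?_, ?_⟩
    · filter_upwards [hx, hx', Lp.coeFn_add (a • z) (b • z'), Lp.coeFn_smul a z, Lp.coeFn_smul b z',
        Lp.coeFn_add (a • x) (b • x'), Lp.coeFn_smul a x, Lp.coeFn_smul b x']
        with ω h1 h2 h3 h4 h5 h6 h7 h8
      rw [h3, h6, Pi.add_apply, Pi.add_apply, h4, h5, h7, h8, Pi.smul_apply, Pi.smul_apply,
        Pi.smul_apply, Pi.smul_apply, h1, h2]
    · have h1 := hconv.2 (Set.mem_univ (x₀ + x)) (Set.mem_univ (x₀ + x')) ha hb hab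
      have h2 : a • (x₀ + x) + b • (x₀ + x') = x₀ + (a • x + b • x') := by
        rw [smul_add, smul_add, add_add_add_comm, ← add_smul, hab, one_smul]
      rw [h2, smul_eq_mul, smul_eq_mul] at h1
      calc _ ≤ a * φ (x₀ + x) + b * φ (x₀ + x') := h1
        _ ≤ a * (φ x₀ - δ) + b * (φ x₀ - δ) := by gcongr
        _ = φ x₀ - δ := by rw [← add_mul, hab, one_mul]
  have hbdd : ∀ z ∈ C, ∃ r, z ∈ boundedBall P r := by
    rintro z ⟨x, hx, -⟩
    refine ⟨‖x‖, mem_boundedBall.2 ?_⟩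
    filter_upwards [hx, ae_abs_le_norm x] with ω h1 h2
    rwa [h1]
  have hcl : ∀ r, IsClosed (C ∩ boundedBall P r) := by
    intro r
    refine IsSeqClosed.isClosed fun z z' hz hz' => ?_
    have hz'r : z' ∈ boundedBall P r :=
      (isClosed_boundedBall r).mem_of_tendsto hz' (Eventually.of_forall fun n => (hz n).2)
    refine ⟨?_, hz'r⟩
    obtain ⟨ns, -, hns⟩ := (tendstoInMeasure_of_tendsto_Lp hz').exists_seq_tendsto_ae
    choose s hs hsφ using fun n => (hz n).1
    obtain ⟨x, hx⟩ := exists_Linf_ae_eq (Lp.aestronglyMeasurable z') (mem_boundedBall.1 hz'r)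
    refine ⟨x, hx.mono fun ω h => h.symm, ?_⟩
    refine hfatou (fun n => x₀ + s (ns n)) (x₀ + x) _ ⟨‖x₀‖ + |r|, fun n => ?_⟩ ?_
      fun n => hsφ _
    · refine (norm_add_le _ _).trans (add_le_add_right
        (norm_le_of_ae_abs_le (abs_nonneg r) ?_) _)
      filter_upwards [hs (ns n), mem_boundedBall.1 (hz (ns n)).2] with ω h1 h2
      rw [← h1]
      exact h2.trans (le_abs_self r)
    · filter_upwards [hns, hx, ae_all_iff.2 hs, Lp.coeFn_add x₀ x,
        ae_all_iff.2 fun n => Lp.coeFn_add x₀ (s n)] with ω h1 h2 h3 h4 h5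
      simp only [h4, h5, Pi.add_apply, h2, ← h3]
      exact h1.const_add _
  have hdisj : C ∩ boundedBall P (δ / 2) = ∅ := by
    rw [Set.eq_empty_iff_forall_notMem]
    rintro z ⟨⟨x, hx, hφ⟩, hz⟩
    have h1 : x₀ + x ≤ x₀ + Lp.const ∞ P (δ / 2) := by
      refine add_le_add_right ((Lp.coeFn_le _ _).1 ?_) _
      filter_upwards [hx, mem_boundedBall.1 hz, Lp.coeFn_const (p := ∞) (μ := P) (δ / 2)]
        with ω h1 h2 h3
      rw [h3, ← h1]
      exact (le_abs_self _).trans h2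
    have h2 := hmono _ _ h1
    rw [hcash] at h2
    linarith
  obtain ⟨w, u, hw, hu, hwC⟩ := exists_integrable_separation hC hcl (half_pos hδ) hdisj hbdd
  have hwC' : ∀ x : Lp ℝ ∞ P, φ (x₀ + x) ≤ φ x₀ - δ → u ≤ ∫ ω, w ω * x ω ∂P := by
    intro x hx
    obtain ⟨z, hz⟩ := exists_L2_ae_eq x
    refine (hwC z ⟨x, hz, hx⟩).trans (le_of_eq (integral_congr_ae ?_))
    filter_upwards [hz] with ω h
    rw [h]
  have hconst : ∀ c : ℝ, ∀ᵐ ω ∂P, (Lp.const ∞ P c : Lp ℝ ∞ P) ω = c := fun c =>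
    Lp.coeFn_const (p := ∞) (μ := P) c
  have hI : ∀ c : ℝ, ∫ ω, w ω * (Lp.const ∞ P c : Lp ℝ ∞ P) ω ∂P = c * ∫ ω, w ω ∂P := by
    intro c
    rw [← integral_const_mul]
    refine integral_congr_ae ?_
    filter_upwards [hconst c] with ω h
    rw [h, mul_comm]
  have hadd : ∀ x y : Lp ℝ ∞ P, ∫ ω, w ω * (x + y : Lp ℝ ∞ P) ω ∂P =
      ∫ ω, w ω * x ω ∂P + ∫ ω, w ω * y ω ∂P := by
    intro x y
    rw [← integral_add (integrable_mul_Linf hw x) (integrable_mul_Linf hw y)]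
    refine integral_congr_ae ?_
    filter_upwards [Lp.coeFn_add x y] with ω h
    rw [h, Pi.add_apply, mul_add]
  have hpos : 0 < ∫ ω, w ω ∂P := by
    have h1 := hwC' (Lp.const ∞ P δ) (hcash x₀ δ).le
    rw [hI] at h1
    exact pos_of_mul_pos_right (hu.trans_le h1) hδ.le
  have hwpos : ∀ᵐ ω ∂P, 0 ≤ w ω := by
    refine ae_nonneg_of_forall_setIntegral_nonneg hw fun A hA _ => ?_
    by_contra! hneg
    have hmem : MemLp (A.indicator fun _ => (1 : ℝ)) ∞ P :=
      memLp_top_of_bound (aestronglyMeasurable_const.indicator hA) 1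
        (Eventually.of_forall fun ω => by
          by_cases h : ω ∈ A <;> simp [h])
    set x : Lp ℝ ∞ P := hmem.toLp _ with hx
    have hxA : ∫ ω, w ω * x ω ∂P = ∫ ω in A, w ω ∂P := by
      rw [← integral_indicator hA]
      refine integral_congr_ae ?_
      filter_upwards [hmem.coeFn_toLp] with ω h
      rw [h]
      by_cases h' : ω ∈ A <;> simp [h']
    -- by monotonicity `t • x + δ` lies in `C` for all `t ≥ 0`, and for this `t` the functional
    -- vanishes there
    set t : ℝ := δ * (∫ ω, w ω ∂P) / -(∫ ω in A, w ω ∂P) with ht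
    have ht0 : 0 ≤ t := by
      have : 0 < -(∫ ω in A, w ω ∂P) := by linarith
      positivity
    have h1 := hwC' (t • x + Lp.const ∞ P δ) (by
      rw [← add_assoc, hcash]
      have : φ (x₀ + t • x) ≤ φ x₀ := by
        refine hmono _ _ (le_add_of_nonneg_right ((Lp.coeFn_nonneg _).1 ?_))
        filter_upwards [Lp.coeFn_smul t x, hmem.coeFn_toLp] with ω h2 h3
        rw [h2, Pi.smul_apply, hx, h3]
        by_cases h' : ω ∈ A <;> simp [h', ht0]
      linarith)
    have h2 : ∫ ω, w ω * (t • x : Lp ℝ ∞ P) ω ∂P = t * ∫ ω, w ω * x ω ∂P := by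
      rw [← integral_const_mul]
      refine integral_congr_ae ?_
      filter_upwards [Lp.coeFn_smul t x] with ω h
      rw [h, Pi.smul_apply, smul_eq_mul, mul_left_comm]
    rw [hadd, hI, h2, hxA, ht] at h1
    have h3 : δ * (∫ ω, w ω ∂P) / -(∫ ω in A, w ω ∂P) * ∫ ω in A, w ω ∂P =
        -(δ * ∫ ω, w ω ∂P) := by
      rw [div_neg, neg_mul, div_mul_cancel₀ _ hneg.ne]
    rw [h3] at h1
    linarith
  -- normalized so that cash invariance turns the lower bound into the subgradient inequality
  refine ⟨fun ω => -(w ω / ∫ ω, w ω ∂P), (hw.div_const _).neg, ?_, fun x => ?_⟩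
  · filter_upwards [hwpos] with ω h
    exact neg_nonpos.2 (div_nonneg h hpos.le)
  · have h1 := hwC' (x - x₀ + Lp.const ∞ P (φ x - φ x₀ + δ)) (by
      rw [← add_assoc, add_sub_cancel, hcash]
      linarith)
    rw [hadd, hI] at h1
    have h2 : ∫ ω, -(w ω / ∫ ω, w ω ∂P) * (x ω - x₀ ω) ∂P =
        -((∫ ω, w ω * (x - x₀ : Lp ℝ ∞ P) ω ∂P) / ∫ ω, w ω ∂P) := by
      rw [← integral_div, ← integral_neg]
      refine integral_congr_ae ?_
      filter_upwards [Lp.coeFn_sub x x₀] with ω h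
      rw [h, Pi.sub_apply]
      ring
    rw [h2]
    have h3 : -(φ x - φ x₀ + δ) ≤ (∫ ω, w ω * (x - x₀ : Lp ℝ ∞ P) ω ∂P) / ∫ ω, w ω ∂P := by
      rw [le_div_iff₀ hpos]
      linarith
    linarith

end Static

/-! ### Conditional expectation of nonnegative random variables -/

section CondLExp

variable {Ω : Type*} {mF mE : MeasurableSpace Ω} {P : Measure Ω} [IsFiniteMeasure P]

/-- Conditional expectations are local: on an `𝓕`-measurable event they depend only on the values
on that event. -/
theorem condLExp_congr_on (hF : mF ≤ mE) {X Y : Ω → ℝ≥0∞} {A : Set Ω} (hA : MeasurableSet[mF] A)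
    (h : ∀ᵐ ω ∂P, ω ∈ A → X ω = Y ω) :
    ∀ᵐ ω ∂P, ω ∈ A → condLExp mF P X ω = condLExp mF P Y ω := by
  have key : ∀ Z : Ω → ℝ≥0∞, A.indicator (condLExp mF P Z) =ᵐ[P] condLExp mF P (A.indicator Z) := by
    intro Z
    refine ae_eq_condLExp hF P _ ((measurable_condLExp mF P Z).indicator hA) fun s hs => ?_
    rw [setLIntegral_indicator (hF _ hA), setLIntegral_indicator (hF _ hA),
      setLIntegral_condLExp hF P Z (hA.inter hs)]
  have h1 : A.indicator X =ᵐ[P] A.indicator Y := by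
    filter_upwards [h] with ω hω
    by_cases hωA : ω ∈ A <;> simp [hωA, hω]
  filter_upwards [key X, key Y, condLExp_congr_ae (mΩ := mF) h1] with ω h2 h3 h4 hωA
  rw [← h2, ← h3, Set.indicator_of_mem hωA, Set.indicator_of_mem hωA] at h4
  exact h4

/-- Conditional dominated convergence for antitone sequences with limit `0`. -/
theorem tendsto_condLExp_zero (hF : mF ≤ mE) {X : ℕ → Ω → ℝ≥0∞}
    (hX : ∀ n, AEMeasurable (X n) P) (hanti : ∀ᵐ ω ∂P, Antitone fun n => X n ω)
    (hlim : ∀ᵐ ω ∂P, Tendsto (fun n => X n ω) atTop (𝓝 0))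
    (hfin : ∀ᵐ ω ∂P, condLExp mF P (X 0) ω < ∞) :
    ∀ᵐ ω ∂P, Tendsto (fun n => condLExp mF P (X n) ω) atTop (𝓝 0) := by
  have hmono : ∀ᵐ ω ∂P, Antitone fun n => condLExp mF P (X n) ω := by
    have h1 : ∀ n, condLExp mF P (X (n + 1)) ≤ᵐ[P] condLExp mF P (X n) := fun n =>
      condLExp_mono (hanti.mono fun ω h => h (Nat.le_succ n))
    filter_upwards [ae_all_iff.2 h1] with ω h using antitone_nat_of_succ_le h
  -- on `{E(X₀ | 𝓕) ≤ m}` the variable `X₀` is integrable and dominates the sequence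
  have hzero : ∀ m : ℕ, ∀ᵐ ω ∂P, condLExp mF P (X 0) ω ≤ m →
      (⨅ n, condLExp mF P (X n) ω) = 0 := by
    intro m
    set A : Set Ω := {ω | condLExp mF P (X 0) ω ≤ m} with hA
    have hAm : MeasurableSet[mF] A := measurable_condLExp mF P (X 0) measurableSet_Iic
    have h0 : ∫⁻ ω in A, X 0 ω ∂P ≠ ∞ := by
      rw [← setLIntegral_condLExp hF P (X 0) hAm]
      refine ne_top_of_le_ne_top ?_ (setLIntegral_mono measurable_const
        (fun ω (hω : condLExp mF P (X 0) ω ≤ m) => hω))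
      rw [setLIntegral_const]
      exact ENNReal.mul_ne_top (ENNReal.natCast_ne_top m) (measure_ne_top _ _)
    have hI : Tendsto (fun n => ∫⁻ ω in A, X n ω ∂P) atTop (𝓝 (∫⁻ _ in A, 0 ∂P)) := by
      refine tendsto_lintegral_of_dominated_convergence' (X 0) (fun n => (hX n).restrict)
        (fun n => ?_) h0 (ae_restrict_of_ae hlim)
      exact ae_restrict_of_ae (hanti.mono fun ω h => h (Nat.zero_le n))
    rw [lintegral_zero] at hI
    have hz : ∫⁻ ω in A, ⨅ n, condLExp mF P (X n) ω ∂P = 0 := by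
      refine le_antisymm (ge_of_tendsto' hI fun n => ?_) (by simp)
      rw [← setLIntegral_condLExp hF P (X n) hAm]
      exact lintegral_mono fun ω => iInf_le _ n
    rw [lintegral_eq_zero_iff (Measurable.iInf fun n => measurable_condLExp' mF P (X n))] at hz
    exact (ae_restrict_iff' (hF _ hAm)).1 hz
  filter_upwards [hmono, ae_all_iff.2 hzero, hfin] with ω h1 h2 h3
  obtain ⟨m, hm⟩ := ENNReal.exists_nat_gt h3.ne
  rw [← h2 m hm.le]
  exact tendsto_atTop_iInf h1

end CondLExp

/-! ### Conditional expectation on `L¹_𝓕(𝓔)` -/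

section CondE

variable {Ω : Type*} {mF mE : MeasurableSpace Ω} {P : Measure Ω}

theorem coeFn_condE (z : Ω →ₘ[P] ℝ) : ∀ᵐ ω ∂P, (condE mF z : Ω →ₘ[P] ℝ) ω =
    (condLExp mF P (fun ω => ENNReal.ofReal (z ω)) ω).toReal -
      (condLExp mF P (fun ω => ENNReal.ofReal (-z ω)) ω).toReal :=
  AEEqFun.coeFn_mk _ _

theorem condE_congr_on [IsFiniteMeasure P] (hF : mF ≤ mE) {z z' : Ω →ₘ[P] ℝ} {A : Set Ω}
    (hA : MeasurableSet[mF] A) (h : ∀ᵐ ω ∂P, ω ∈ A → z ω = z' ω) :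
    ∀ᵐ ω ∂P, ω ∈ A → (condE mF z : Ω →ₘ[P] ℝ) ω = (condE mF z' : Ω →ₘ[P] ℝ) ω := by
  have h1 := condLExp_congr_on hF (X := fun ω => ENNReal.ofReal (z ω))
    (Y := fun ω => ENNReal.ofReal (z' ω)) hA (h.mono fun ω h hA => by rw [h hA])
  have h2 := condLExp_congr_on hF (X := fun ω => ENNReal.ofReal (-z ω))
    (Y := fun ω => ENNReal.ofReal (-z' ω)) hA (h.mono fun ω h hA => by rw [h hA])
  filter_upwards [h1, h2, coeFn_condE (mF := mF) z, coeFn_condE (mF := mF) z']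
    with ω k1 k2 k3 k4 hωA
  rw [k3, k4, k1 hωA, k2 hωA]

theorem condLExp_ofReal_le (z : Ω →ₘ[P] ℝ) : ∀ᵐ ω ∂P,
    condLExp mF P (fun ω => ENNReal.ofReal (z ω)) ω ≤ condLExp mF P (fun ω => ‖z ω‖ₑ) ω ∧
    condLExp mF P (fun ω => ENNReal.ofReal (-z ω)) ω ≤ condLExp mF P (fun ω => ‖z ω‖ₑ) ω := by
  have h1 := condLExp_mono (P := P) (mΩ := mF) (X := fun ω => ENNReal.ofReal (z ω))
    (Y := fun ω => ‖z ω‖ₑ) (Eventually.of_forall fun ω => Real.ofReal_le_enorm _)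
  have h2 := condLExp_mono (P := P) (mΩ := mF) (X := fun ω => ENNReal.ofReal (-z ω))
    (Y := fun ω => ‖z ω‖ₑ) (Eventually.of_forall fun ω => by
      simpa using Real.ofReal_le_enorm (-z ω))
  filter_upwards [h1, h2] with ω h1 h2 using ⟨h1, h2⟩

theorem abs_condE_le {z : Ω →ₘ[P] ℝ} (hz : z ∈ L1F mF P) : ∀ᵐ ω ∂P,
    |(condE mF z : Ω →ₘ[P] ℝ) ω| ≤ (condLExp mF P (fun ω => ‖z ω‖ₑ) ω).toReal := by
  have hz' : ∀ᵐ ω ∂P, condLExp mF P (fun ω => ‖z ω‖ₑ) ω < ∞ := hz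
  filter_upwards [hz', condLExp_ofReal_le (mF := mF) z, coeFn_condE (mF := mF) z] with ω h1 h2 h3
  have k1 := ENNReal.toReal_mono h1.ne h2.1
  have k2 := ENNReal.toReal_mono h1.ne h2.2
  rw [h3, abs_le]
  constructor <;> linarith [ENNReal.toReal_nonneg
      (a := condLExp mF P (fun ω => ENNReal.ofReal (z ω)) ω),
    ENNReal.toReal_nonneg (a := condLExp mF P (fun ω => ENNReal.ofReal (-z ω)) ω)]

theorem sub_mem_L1F {z z' : Ω →ₘ[P] ℝ} (hz : z ∈ L1F mF P) (hz' : z' ∈ L1F mF P) :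
    z - z' ∈ L1F mF P := by
  have h1 : ∀ᵐ ω ∂P, condLExp mF P (fun ω => ‖z ω‖ₑ) ω < ∞ := hz
  have h2 : ∀ᵐ ω ∂P, condLExp mF P (fun ω => ‖z' ω‖ₑ) ω < ∞ := hz'
  have h3 := condLExp_add_left (P := P) (mΩ := mF) (X := fun ω => ‖z ω‖ₑ) (fun ω => ‖z' ω‖ₑ)
    z.aestronglyMeasurable.enorm
  have h4 : condLExp mF P (fun ω => ‖(z - z' : Ω →ₘ[P] ℝ) ω‖ₑ) ≤ᵐ[P]
      condLExp mF P ((fun ω => ‖z ω‖ₑ) + fun ω => ‖z' ω‖ₑ) := by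
    refine condLExp_mono ?_
    filter_upwards [AEEqFun.coeFn_sub z z'] with ω h
    rw [h]
    exact enorm_sub_le
  change ∀ᵐ ω ∂P, _ < _
  filter_upwards [h1, h2, h3, h4] with ω k1 k2 k3 k4
  refine k4.trans_lt ?_
  rw [k3]
  exact ENNReal.add_lt_top.2 ⟨k1, k2⟩

theorem condE_sub {z z' : Ω →ₘ[P] ℝ} (hz : z ∈ L1F mF P) (hz' : z' ∈ L1F mF P) :
    ∀ᵐ ω ∂P, (condE mF (z - z') : Ω →ₘ[P] ℝ) ω =
      (condE mF z : Ω →ₘ[P] ℝ) ω - (condE mF z' : Ω →ₘ[P] ℝ) ω := by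
  have h1 : ∀ᵐ ω ∂P, condLExp mF P (fun ω => ‖z ω‖ₑ) ω < ∞ := hz
  have h2 : ∀ᵐ ω ∂P, condLExp mF P (fun ω => ‖z' ω‖ₑ) ω < ∞ := hz'
  have h3 : ∀ᵐ ω ∂P, condLExp mF P (fun ω => ‖(z - z' : Ω →ₘ[P] ℝ) ω‖ₑ) ω < ∞ :=
    sub_mem_L1F hz hz'
  set p : (Ω →ₘ[P] ℝ) → Ω → ℝ≥0∞ := fun z ω => ENNReal.ofReal (z ω) with hp
  set q : (Ω →ₘ[P] ℝ) → Ω → ℝ≥0∞ := fun z ω => ENNReal.ofReal (-z ω) with hq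
  have hpm : ∀ z, AEMeasurable (p z) P := fun z => z.measurable.ennreal_ofReal.aemeasurable
  have hqm : ∀ z, AEMeasurable (q z) P := fun z => z.measurable.neg.ennreal_ofReal.aemeasurable
  -- positive and negative parts of the three random variables balance
  have hbal : (p (z - z') + (q z + p z')) =ᵐ[P] (q (z - z') + (p z + q z')) := by
    filter_upwards [AEEqFun.coeFn_sub z z'] with ω h
    simp only [Pi.add_apply, hp, hq, h, Pi.sub_apply]
    rw [← ENNReal.toReal_eq_toReal_iff' (by simp) (by simp)]
    rw [ENNReal.toReal_add (by simp) (by simp), ENNReal.toReal_add (by simp) (by simp),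
      ENNReal.toReal_add (by simp) (by simp), ENNReal.toReal_add (by simp) (by simp)]
    simp only [ENNReal.toReal_ofReal']
    linarith [max_zero_sub_eq_self (z ω), max_zero_sub_eq_self (z' ω),
      max_zero_sub_eq_self (z ω - z' ω)]
  filter_upwards [condLExp_congr_ae (mΩ := mF) hbal,
    condLExp_add_left (P := P) (mΩ := mF) (q z + p z') (hpm (z - z')),
    condLExp_add_left (P := P) (mΩ := mF) (p z + q z') (hqm (z - z')),
    condLExp_add_left (P := P) (mΩ := mF) (p z') (hqm z),
    condLExp_add_left (P := P) (mΩ := mF) (q z') (hpm z),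
    h1, h2, h3, condLExp_ofReal_le (mF := mF) z, condLExp_ofReal_le (mF := mF) z',
    condLExp_ofReal_le (mF := mF) (z - z'), coeFn_condE (mF := mF) z, coeFn_condE (mF := mF) z',
    coeFn_condE (mF := mF) (z - z')] with ω k1 k2 k3 k4 k5 k6 k7 k8 k9 k10 k11 k12 k13 k14
  rw [k12, k13, k14]
  rw [k2, k3, Pi.add_apply, Pi.add_apply, k4, k5, Pi.add_apply, Pi.add_apply] at k1
  have a1 := (k9.1.trans_lt k6).ne
  have a2 := (k9.2.trans_lt k6).ne
  have a3 := (k10.1.trans_lt k7).ne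
  have a4 := (k10.2.trans_lt k7).ne
  have a5 := (k11.1.trans_lt k8).ne
  have a6 := (k11.2.trans_lt k8).ne
  have k15 := congrArg ENNReal.toReal k1
  rw [ENNReal.toReal_add a5 (ENNReal.add_ne_top.2 ⟨a2, a3⟩), ENNReal.toReal_add a2 a3,
    ENNReal.toReal_add a6 (ENNReal.add_ne_top.2 ⟨a1, a4⟩), ENNReal.toReal_add a1 a4] at k15
  linarith

theorem L1F_of_integrable [IsFiniteMeasure P] {z : Ω →ₘ[P] ℝ} (hz : Integrable z P) :
    z ∈ L1F mF P :=
  condLExp_lt_top hz.2.ne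

theorem condE_ae_eq_condExp [IsFiniteMeasure P] {z : Ω →ₘ[P] ℝ}
    (hz : Integrable z P) : (condE mF z : Ω →ₘ[P] ℝ) =ᵐ[P] P[z | mF] := by
  have h1 := toReal_condLExp mF (μ := P) (f := fun ω => ENNReal.ofReal (z ω))
    z.measurable.ennreal_ofReal.aemeasurable
    (ne_top_of_le_ne_top hz.2.ne (lintegral_mono fun ω => Real.ofReal_le_enorm _))
  have h2 := toReal_condLExp mF (μ := P) (f := fun ω => ENNReal.ofReal (-z ω))
    z.measurable.neg.ennreal_ofReal.aemeasurable
    (ne_top_of_le_ne_top hz.2.ne (lintegral_mono fun ω => by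
      simpa using Real.ofReal_le_enorm (-z ω)))
  have h3 := condExp_sub (μ := P) (f := fun ω => (ENNReal.ofReal (z ω)).toReal)
    (g := fun ω => (ENNReal.ofReal (-z ω)).toReal)
    (by simpa only [ENNReal.toReal_ofReal'] using hz.pos_part)
    (by simpa only [ENNReal.toReal_ofReal'] using hz.neg_part) mF
  have h4 : ((fun ω => (ENNReal.ofReal (z ω)).toReal) - fun ω => (ENNReal.ofReal (-z ω)).toReal) =
      (z : Ω → ℝ) := by
    funext ω
    simp only [Pi.sub_apply, ENNReal.toReal_ofReal']
    exact max_zero_sub_eq_self _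
  rw [h4] at h3
  filter_upwards [h1, h2, h3, coeFn_condE (mF := mF) z] with ω k1 k2 k3 k4
  rw [k4, k1, k2, k3, Pi.sub_apply]

theorem exists_bound_of_LinfF [IsFiniteMeasure P] (x : LinfF mF P) :
    ∃ ξ : Ω → ℝ, Measurable[mF] ξ ∧ ∀ᵐ ω ∂P, |(x : Ω →ₘ[P] ℝ) ω| ≤ ξ ω := by
  obtain ⟨ξ, hξ⟩ := (exists_normInf_iff _).1 x.2
  obtain ⟨g, hg, hg'⟩ := ξ.2
  refine ⟨g, hg.measurable, ?_⟩
  filter_upwards [hξ, hg'] with ω h1 h2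
  rwa [← h2]

theorem mul_mem_L1F [IsFiniteMeasure P] (hF : mF ≤ mE) (x : LinfF mF P) {y : Ω →ₘ[P] ℝ}
    (hy : y ∈ L1F mF P) : (x : Ω →ₘ[P] ℝ) * y ∈ L1F mF P := by
  obtain ⟨ξ, hξm, hξ⟩ := exists_bound_of_LinfF x
  have hy' : ∀ᵐ ω ∂P, condLExp mF P (fun ω => ‖y ω‖ₑ) ω < ∞ := hy
  have key : ∀ n : ℕ, ∀ᵐ ω ∂P, ξ ω ≤ n →
      condLExp mF P (fun ω => ‖((x : Ω →ₘ[P] ℝ) * y) ω‖ₑ) ω < ∞ := by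
    intro n
    set A : Set Ω := {ω | ξ ω ≤ n} with hA
    have hAm : MeasurableSet[mF] A := hξm measurableSet_Iic
    have h1 := condLExp_congr_on (P := P) hF
      (X := fun ω => ‖((x : Ω →ₘ[P] ℝ) * y) ω‖ₑ)
      (Y := A.indicator fun ω => ‖((x : Ω →ₘ[P] ℝ) * y) ω‖ₑ) hAm
      (Eventually.of_forall fun ω h => by rw [Set.indicator_of_mem h])
    have h2 : condLExp mF P (A.indicator fun ω => ‖((x : Ω →ₘ[P] ℝ) * y) ω‖ₑ) ≤ᵐ[P]
        condLExp mF P ((n : ℝ≥0∞) • fun ω => ‖y ω‖ₑ) := by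
      refine condLExp_mono ?_
      filter_upwards [hξ, AEEqFun.coeFn_mul (x : Ω →ₘ[P] ℝ) y] with ω k1 k2
      by_cases hω : ω ∈ A
      · rw [Set.indicator_of_mem hω, k2, Pi.mul_apply, enorm_mul, Pi.smul_apply, smul_eq_mul]
        gcongr
        rw [← ofReal_norm, Real.norm_eq_abs, ← ENNReal.ofReal_natCast]
        exact ENNReal.ofReal_le_ofReal (k1.trans hω)
      · rw [Set.indicator_of_notMem hω]
        exact (by simp)
    have h3 := condLExp_smul' (P := P) (mΩ := mF) (fun ω => ‖y ω‖ₑ) (ENNReal.natCast_ne_top n)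
    filter_upwards [h1, h2, h3, hy'] with ω k1 k2 k3 k4 hω
    rw [k1 hω]
    refine k2.trans_lt ?_
    rw [k3]
    exact ENNReal.mul_lt_top (ENNReal.natCast_lt_top n) k4
  change ∀ᵐ ω ∂P, _ < _
  filter_upwards [ae_all_iff.2 key] with ω h
  obtain ⟨n, hn⟩ := exists_nat_ge (ξ ω)
  exact h n hn

/-- `E(uₙ y | 𝓕) → E(x y | 𝓕)` a.s. for `y ∈ L¹_𝓕(𝓔)`, when `uₙ ↘ x` in `L^∞_𝓕(𝓔)`. -/
theorem tendsto_condE_of_antitone [IsFiniteMeasure P] (hF : mF ≤ mE) {u : ℕ → LinfF mF P}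
    {x : LinfF mF P} (hanti : ∀ᵐ ω ∂P, Antitone fun n => (u n : Ω →ₘ[P] ℝ) ω)
    (hlim : ∀ᵐ ω ∂P, Tendsto (fun n => (u n : Ω →ₘ[P] ℝ) ω) atTop (𝓝 ((x : Ω →ₘ[P] ℝ) ω)))
    {y : Ω →ₘ[P] ℝ} (hy : y ∈ L1F mF P) :
    ∀ᵐ ω ∂P, Tendsto
      (fun n => (condE mF (((u n - x : LinfF mF P) : Ω →ₘ[P] ℝ) * y) : Ω →ₘ[P] ℝ) ω)
      atTop (𝓝 0) := by
  let X : ℕ → Ω → ℝ≥0∞ := fun n ω => ‖(((u n - x : LinfF mF P) : Ω →ₘ[P] ℝ) * y) ω‖ₑ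
  have hXω : ∀ᵐ ω ∂P, ∀ n, X n ω = ‖(u n : Ω →ₘ[P] ℝ) ω - (x : Ω →ₘ[P] ℝ) ω‖ₑ * ‖y ω‖ₑ := by
    refine ae_all_iff.2 fun n => ?_
    filter_upwards [AEEqFun.coeFn_mul ((u n - x : LinfF mF P) : Ω →ₘ[P] ℝ) y,
      AEEqFun.coeFn_sub (u n : Ω →ₘ[P] ℝ) (x : Ω →ₘ[P] ℝ)] with ω h1 h2
    simp only [X]
    rw [h1, Pi.mul_apply, enorm_mul, AddSubgroup.coe_sub, h2, Pi.sub_apply]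
  have hL1 : ∀ n, ((u n - x : LinfF mF P) : Ω →ₘ[P] ℝ) * y ∈ L1F mF P := fun n =>
    mul_mem_L1F hF _ hy
  have h1 := tendsto_condLExp_zero (P := P) hF (X := X)
    (fun n => (AEEqFun.aestronglyMeasurable _).enorm) (by
      filter_upwards [hXω, hanti, hlim] with ω k1 k2 k3 n m hnm
      simp only [k1]
      gcongr
      have h4 : (x : Ω →ₘ[P] ℝ) ω ≤ (u m : Ω →ₘ[P] ℝ) ω := k2.le_of_tendsto k3 m
      have h5 : (u m : Ω →ₘ[P] ℝ) ω ≤ (u n : Ω →ₘ[P] ℝ) ω := k2 hnm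
      rw [Real.enorm_eq_ofReal (by linarith), Real.enorm_eq_ofReal (by linarith)]
      exact ENNReal.ofReal_le_ofReal (by linarith)) (by
      filter_upwards [hXω, hlim] with ω k1 k3
      simp only [k1]
      have h4 : Tendsto (fun n => ‖(u n : Ω →ₘ[P] ℝ) ω - (x : Ω →ₘ[P] ℝ) ω‖ₑ) atTop (𝓝 0) := by
        have := (k3.sub_const ((x : Ω →ₘ[P] ℝ) ω)).enorm
        simpa using this
      simpa using ENNReal.Tendsto.mul_const h4 (Or.inr enorm_ne_top)) (hL1 0)
  filter_upwards [h1, ae_all_iff.2 fun n => abs_condE_le (hL1 n)] with ω k1 k2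
  refine squeeze_zero_norm k2 ?_
  rw [← ENNReal.toReal_zero]
  exact (ENNReal.tendsto_toReal ENNReal.zero_ne_top).comp k1

end CondE

/-! ### Locality of conditional risk measures -/

section Locality

variable {Ω : Type*} {mF mE : MeasurableSpace Ω} {P : Measure Ω}

theorem exists_L0F_ae_eq (hF : mF ≤ mE) {g : Ω → ℝ} (hg : Measurable[mF] g) :
    ∃ y : L0F mF P, ∀ᵐ ω ∂P, (y : Ω →ₘ[P] ℝ) ω = g ω := by
  have h := AEEqFun.coeFn_mk g ((hg.mono hF le_rfl).aestronglyMeasurable (μ := P))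
  exact ⟨⟨AEEqFun.mk g _, ⟨g, hg.stronglyMeasurable, h⟩⟩, h⟩

theorem exists_lpMeas_ae_eq (hF : mF ≤ mE) {g : Ω → ℝ} (hg : Measurable[mF] g) {C : ℝ}
    (hC : ∀ᵐ ω ∂P, |g ω| ≤ C) :
    ∃ y : lpMeas ℝ ℝ mF ∞ P, ∀ᵐ ω ∂P, (y : Lp ℝ ∞ P) ω = g ω := by
  obtain ⟨x, hx⟩ := exists_Linf_ae_eq (hg.mono hF le_rfl).aestronglyMeasurable hC
  exact ⟨⟨x, mem_lpMeas_iff_aestronglyMeasurable.2 ⟨g, hg.stronglyMeasurable, hx⟩⟩, hx⟩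

theorem exists_measurable_ae_eq_of_L0F (y : L0F mF P) :
    ∃ g : Ω → ℝ, Measurable[mF] g ∧ ∀ᵐ ω ∂P, (y : Ω →ₘ[P] ℝ) ω = g ω := by
  obtain ⟨g, hg, hg'⟩ := y.2
  exact ⟨g, hg.measurable, hg'⟩

theorem exists_measurable_ae_eq_of_lpMeas (y : lpMeas ℝ ℝ mF ∞ P) :
    ∃ g : Ω → ℝ, Measurable[mF] g ∧ ∀ᵐ ω ∂P, (y : Lp ℝ ∞ P) ω = g ω :=
  exists_measurable_ae_eq_of_L0F (inclLinfMeas y)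

theorem L0F_le_of_ae {x y : L0F mF P}
    (h : ∀ᵐ ω ∂P, (x : Ω →ₘ[P] ℝ) ω ≤ (y : Ω →ₘ[P] ℝ) ω) : (x : Ω →ₘ[P] ℝ) ≤ y :=
  AEEqFun.coeFn_le.1 h

namespace IsLinfRiskMeasure

variable {f : Lp ℝ ∞ P → lpMeas ℝ ℝ mF ∞ P}

theorem ae_antitone (hf : IsLinfRiskMeasure f) {x y : Lp ℝ ∞ P} (h : ∀ᵐ ω ∂P, y ω ≤ x ω) :
    ∀ᵐ ω ∂P, (f x : Lp ℝ ∞ P) ω ≤ (f y : Lp ℝ ∞ P) ω :=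
  (Lp.coeFn_le _ _).2 (hf.monotone x y ((Lp.coeFn_le _ _).1 h))

theorem ae_cash (hf : IsLinfRiskMeasure f) (x : Lp ℝ ∞ P) (y : lpMeas ℝ ℝ mF ∞ P) :
    ∀ᵐ ω ∂P, (f (x + y) : Lp ℝ ∞ P) ω = (f x : Lp ℝ ∞ P) ω - (y : Lp ℝ ∞ P) ω := by
  rw [hf.cash_invariant]
  exact Lp.coeFn_sub (f x : Lp ℝ ∞ P) (y : Lp ℝ ∞ P)

theorem le_add_of_le_add (hf : IsLinfRiskMeasure f) {x x' : Lp ℝ ∞ P} {ξ : lpMeas ℝ ℝ mF ∞ P}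
    (h : ∀ᵐ ω ∂P, x ω ≤ x' ω + (ξ : Lp ℝ ∞ P) ω) :
    ∀ᵐ ω ∂P, (f x' : Lp ℝ ∞ P) ω ≤ (f x : Lp ℝ ∞ P) ω + (ξ : Lp ℝ ∞ P) ω := by
  have h1 := hf.ae_antitone (x := x' + ξ) (y := x) (by
    filter_upwards [h, Lp.coeFn_add x' (ξ : Lp ℝ ∞ P)] with ω h1 h2
    rwa [h2, Pi.add_apply])
  filter_upwards [h1, hf.ae_cash x' ξ] with ω k1 k2
  linarith

theorem le_congr_on (hF : mF ≤ mE) (hf : IsLinfRiskMeasure f) {x x' : Lp ℝ ∞ P} {A : Set Ω}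
    (hA : MeasurableSet[mF] A) (h : ∀ᵐ ω ∂P, ω ∈ A → x ω = x' ω) :
    ∀ᵐ ω ∂P, ω ∈ A → (f x' : Lp ℝ ∞ P) ω ≤ (f x : Lp ℝ ∞ P) ω := by
  obtain ⟨ξ, hξ⟩ := exists_lpMeas_ae_eq (P := P) hF (C := ‖x‖ + ‖x'‖)
    (g := Aᶜ.indicator fun _ => ‖x‖ + ‖x'‖) (measurable_const.indicator hA.compl)
    (Eventually.of_forall fun ω => by
      rw [← Real.norm_eq_abs]
      refine (norm_indicator_le_norm_self _ _).trans (le_of_eq ?_)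
      rw [Real.norm_eq_abs, abs_of_nonneg (by positivity)])
  have h1 := hf.le_add_of_le_add (x := x) (x' := x') (ξ := ξ) (by
    filter_upwards [h, hξ, ae_abs_le_norm x, ae_abs_le_norm x'] with ω k1 k2 k3 k4
    rw [k2]
    by_cases hω : ω ∈ A
    · simp [hω, k1 hω]
    · rw [Set.indicator_of_mem hω]
      linarith [(abs_le.1 k3).2, (abs_le.1 k4).1])
  filter_upwards [h1, hξ] with ω k1 k2 hω
  rw [k2, Set.indicator_of_notMem (by simpa using hω), add_zero] at k1
  exact k1

/-- Conditional risk measures are local: on an `𝓕`-measurable event, the risk depends only on the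
position on that event. -/
theorem congr_on (hF : mF ≤ mE) (hf : IsLinfRiskMeasure f) {x x' : Lp ℝ ∞ P} {A : Set Ω}
    (hA : MeasurableSet[mF] A) (h : ∀ᵐ ω ∂P, ω ∈ A → x ω = x' ω) :
    ∀ᵐ ω ∂P, ω ∈ A → (f x : Lp ℝ ∞ P) ω = (f x' : Lp ℝ ∞ P) ω := by
  filter_upwards [hf.le_congr_on hF hA h,
    hf.le_congr_on hF hA (h.mono fun ω k hω => (k hω).symm)] with ω h1 h2 hω
  exact le_antisymm (h2 hω) (h1 hω)

end IsLinfRiskMeasure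

theorem coeFn_inclL0F [IsFiniteMeasure P] (x : LinfF mF P) (y : L0F mF P) :
    ∀ᵐ ω ∂P, ((x + inclL0F y : LinfF mF P) : Ω →ₘ[P] ℝ) ω =
      (x : Ω →ₘ[P] ℝ) ω + (y : Ω →ₘ[P] ℝ) ω :=
  AEEqFun.coeFn_add (x : Ω →ₘ[P] ℝ) (y : Ω →ₘ[P] ℝ)

namespace IsLinfFRiskMeasure

variable [IsFiniteMeasure P] {fbar : LinfF mF P → L0F mF P}

theorem ae_antitone (hf : IsLinfFRiskMeasure fbar) {x y : LinfF mF P}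
    (h : ∀ᵐ ω ∂P, (y : Ω →ₘ[P] ℝ) ω ≤ (x : Ω →ₘ[P] ℝ) ω) :
    ∀ᵐ ω ∂P, (fbar x : Ω →ₘ[P] ℝ) ω ≤ (fbar y : Ω →ₘ[P] ℝ) ω :=
  AEEqFun.coeFn_le.2 (hf.monotone x y (AEEqFun.coeFn_le.1 h))

theorem ae_cash (hf : IsLinfFRiskMeasure fbar) (x : LinfF mF P) (y : L0F mF P) :
    ∀ᵐ ω ∂P, (fbar (x + inclL0F y) : Ω →ₘ[P] ℝ) ω =
      (fbar x : Ω →ₘ[P] ℝ) ω - (y : Ω →ₘ[P] ℝ) ω := by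
  rw [hf.cash_invariant]
  exact AEEqFun.coeFn_sub (fbar x : Ω →ₘ[P] ℝ) (y : Ω →ₘ[P] ℝ)

theorem le_add_of_le_add (hf : IsLinfFRiskMeasure fbar) {x x' : LinfF mF P} {ξ : L0F mF P}
    (h : ∀ᵐ ω ∂P, (x : Ω →ₘ[P] ℝ) ω ≤ (x' : Ω →ₘ[P] ℝ) ω + (ξ : Ω →ₘ[P] ℝ) ω) :
    ∀ᵐ ω ∂P, (fbar x' : Ω →ₘ[P] ℝ) ω ≤ (fbar x : Ω →ₘ[P] ℝ) ω + (ξ : Ω →ₘ[P] ℝ) ω := by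
  have h1 := hf.ae_antitone (x := x' + inclL0F ξ) (y := x) (by
    filter_upwards [h, coeFn_inclL0F x' ξ] with ω h1 h2
    rwa [h2])
  filter_upwards [h1, hf.ae_cash x' ξ] with ω k1 k2
  linarith

theorem le_congr_on (hF : mF ≤ mE) (hf : IsLinfFRiskMeasure fbar) {x x' : LinfF mF P} {A : Set Ω}
    (hA : MeasurableSet[mF] A) (h : ∀ᵐ ω ∂P, ω ∈ A → (x : Ω →ₘ[P] ℝ) ω = (x' : Ω →ₘ[P] ℝ) ω) :
    ∀ᵐ ω ∂P, ω ∈ A → (fbar x' : Ω →ₘ[P] ℝ) ω ≤ (fbar x : Ω →ₘ[P] ℝ) ω := by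
  obtain ⟨η, hηm, hη⟩ := exists_bound_of_LinfF x
  obtain ⟨η', hηm', hη'⟩ := exists_bound_of_LinfF x'
  obtain ⟨ξ, hξ⟩ := exists_L0F_ae_eq (P := P) hF
    (g := Aᶜ.indicator fun ω => η ω + η' ω) ((hηm.add hηm').indicator hA.compl)
  have h1 := hf.le_add_of_le_add (x := x) (x' := x') (ξ := ξ) (by
    filter_upwards [h, hξ, hη, hη'] with ω k1 k2 k3 k4
    rw [k2]
    by_cases hω : ω ∈ A
    · simp [hω, k1 hω]
    · rw [Set.indicator_of_mem hω]
      linarith [(abs_le.1 k3).2, (abs_le.1 k4).1])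
  filter_upwards [h1, hξ] with ω k1 k2 hω
  rw [k2, Set.indicator_of_notMem (by simpa using hω), add_zero] at k1
  exact k1

theorem congr_on (hF : mF ≤ mE) (hf : IsLinfFRiskMeasure fbar) {x x' : LinfF mF P} {A : Set Ω}
    (hA : MeasurableSet[mF] A) (h : ∀ᵐ ω ∂P, ω ∈ A → (x : Ω →ₘ[P] ℝ) ω = (x' : Ω →ₘ[P] ℝ) ω) :
    ∀ᵐ ω ∂P, ω ∈ A → (fbar x : Ω →ₘ[P] ℝ) ω = (fbar x' : Ω →ₘ[P] ℝ) ω := by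
  filter_upwards [hf.le_congr_on hF hA h,
    hf.le_congr_on hF hA (h.mono fun ω k hω => (k hω).symm)] with ω h1 h2 hω
  exact le_antisymm (h2 hω) (h1 hω)

end IsLinfFRiskMeasure

theorem IsExtension.ae_eq [IsFiniteMeasure P] {f : Lp ℝ ∞ P → lpMeas ℝ ℝ mF ∞ P}
    {fbar : LinfF mF P → L0F mF P} (hfbar : IsExtension f fbar) (x : Lp ℝ ∞ P) :
    ∀ᵐ ω ∂P, (fbar (inclLinf x) : Ω →ₘ[P] ℝ) ω = (f x : Lp ℝ ∞ P) ω := by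
  rw [hfbar.extends_f]
  exact Eventually.of_forall fun _ => rfl

/-- An extension `fbar` is determined locally by `f`. -/
theorem IsExtension.congr_on [IsFiniteMeasure P] (hF : mF ≤ mE)
    {f : Lp ℝ ∞ P → lpMeas ℝ ℝ mF ∞ P} {fbar : LinfF mF P → L0F mF P} (hfbar : IsExtension f fbar)
    {x : LinfF mF P} {x' : Lp ℝ ∞ P} {A : Set Ω} (hA : MeasurableSet[mF] A)
    (h : ∀ᵐ ω ∂P, ω ∈ A → (x : Ω →ₘ[P] ℝ) ω = x' ω) :
    ∀ᵐ ω ∂P, ω ∈ A → (fbar x : Ω →ₘ[P] ℝ) ω = (f x' : Lp ℝ ∞ P) ω := by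
  filter_upwards [hfbar.riskMeasure.congr_on hF (x' := inclLinf x') hA h, hfbar.ae_eq x']
    with ω h1 h2 hω
  rw [h1 hω, h2]

end Locality

/-! ### The extension to `L^∞_𝓕(𝓔)` -/

section Extension

variable {Ω : Type*} {mF mE : MeasurableSpace Ω} {P : Measure Ω}

/-- Truncation of a random variable at the levels `-n` and `n`. -/
noncomputable def truncLinf (x : Ω →ₘ[P] ℝ) (n : ℕ) : Lp ℝ ∞ P :=
  (memLp_top_of_bound (f := fun ω => max (-(n : ℝ)) (min (x ω) n))
    (measurable_const.max (x.measurable.min measurable_const)).aestronglyMeasurable n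
    (Eventually.of_forall fun ω => by
      rw [Real.norm_eq_abs, abs_le]
      exact ⟨le_max_left _ _, max_le (by linarith [(Nat.cast_nonneg n : (0 : ℝ) ≤ n)])
        (min_le_right _ _)⟩)).toLp _

theorem coeFn_truncLinf (x : Ω →ₘ[P] ℝ) (n : ℕ) :
    ∀ᵐ ω ∂P, truncLinf x n ω = max (-(n : ℝ)) (min (x ω) n) :=
  MemLp.coeFn_toLp _

theorem truncLinf_eq_of_abs_le (x : Ω →ₘ[P] ℝ) (n : ℕ) :
    ∀ᵐ ω ∂P, |x ω| ≤ n → truncLinf x n ω = x ω := by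
  filter_upwards [coeFn_truncLinf x n] with ω h hω
  rw [h, min_eq_left (abs_le.1 hω).2, max_eq_right (abs_le.1 hω).1]

/-- By locality, the risk of the truncations of `x` is a.s. eventually constant: its value at level
`n` is final on `{ξ ≤ n}` for any `ξ ∈ L⁰(𝓕)` that dominates `|x|`. -/
theorem exists_eventually_trunc [IsFiniteMeasure P] (hF : mF ≤ mE)
    {f : Lp ℝ ∞ P → lpMeas ℝ ℝ mF ∞ P} (hf : IsLinfRiskMeasure f) (x : LinfF mF P) :
    ∃ g : L0F mF P, ∀ᵐ ω ∂P, ∀ᶠ n : ℕ in atTop,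
      (f (truncLinf (x : Ω →ₘ[P] ℝ) n) : Lp ℝ ∞ P) ω = (g : Ω →ₘ[P] ℝ) ω := by
  obtain ⟨ξ, hξm, hξ⟩ := exists_bound_of_LinfF x
  choose h hhm hh using fun n =>
    exists_measurable_ae_eq_of_lpMeas (f (truncLinf (x : Ω →ₘ[P] ℝ) n))
  have hloc : ∀ n m : ℕ, ∀ᵐ ω ∂P, n ≤ m → ξ ω ≤ n →
      (f (truncLinf (x : Ω →ₘ[P] ℝ) m) : Lp ℝ ∞ P) ω =
        (f (truncLinf (x : Ω →ₘ[P] ℝ) n) : Lp ℝ ∞ P) ω := by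
    intro n m
    by_cases hnm : n ≤ m
    · have := hf.congr_on hF (x := truncLinf (x : Ω →ₘ[P] ℝ) m)
        (x' := truncLinf (x : Ω →ₘ[P] ℝ) n) (A := {ω | ξ ω ≤ n}) (hξm measurableSet_Iic) (by
          filter_upwards [hξ, truncLinf_eq_of_abs_le (x : Ω →ₘ[P] ℝ) n,
            truncLinf_eq_of_abs_le (x : Ω →ₘ[P] ℝ) m] with ω h1 h2 h3 hω
          have h4 : |(x : Ω →ₘ[P] ℝ) ω| ≤ n := h1.trans hω
          rw [h2 h4, h3 (h4.trans (by exact_mod_cast hnm))])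
      exact this.mono fun ω h _ hω => h hω
    · exact Eventually.of_forall fun ω h => absurd h hnm
  obtain ⟨g, hg⟩ := exists_L0F_ae_eq (P := P) hF (g := fun ω => limsup (fun n => h n ω) atTop)
    (Measurable.limsup hhm)
  refine ⟨g, ?_⟩
  filter_upwards [hg, ae_all_iff.2 hh, ae_all_iff.2 fun n => ae_all_iff.2 fun m => hloc n m]
    with ω h1 h2 h3
  obtain ⟨N, hN⟩ := exists_nat_ge (ξ ω)
  have hev : ∀ n, N ≤ n → h n ω = h N ω := by
    intro n hn
    rw [← h2, ← h2]
    exact h3 N n hn hN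
  have hlim : Tendsto (fun n => h n ω) atTop (𝓝 (h N ω)) :=
    tendsto_const_nhds.congr' (by
      filter_upwards [eventually_ge_atTop N] with n hn using (hev n hn).symm)
  filter_upwards [eventually_ge_atTop N] with n hn
  rw [h1, hlim.limsup_eq, h2, hev n hn]

/-- The extension of `f` to `L^∞_𝓕(𝓔)`: the eventual value of `f` along the truncations. -/
noncomputable def extendRisk [IsFiniteMeasure P] (hF : mF ≤ mE)
    {f : Lp ℝ ∞ P → lpMeas ℝ ℝ mF ∞ P} (hf : IsLinfRiskMeasure f) (x : LinfF mF P) : L0F mF P :=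
  (exists_eventually_trunc hF hf x).choose

theorem eventually_extendRisk [IsFiniteMeasure P] (hF : mF ≤ mE)
    {f : Lp ℝ ∞ P → lpMeas ℝ ℝ mF ∞ P} (hf : IsLinfRiskMeasure f) (x : LinfF mF P) :
    ∀ᵐ ω ∂P, ∀ᶠ n : ℕ in atTop, (f (truncLinf (x : Ω →ₘ[P] ℝ) n) : Lp ℝ ∞ P) ω =
      (extendRisk hF hf x : Ω →ₘ[P] ℝ) ω :=
  (exists_eventually_trunc hF hf x).choose_spec

theorem isLinfFRiskMeasure_extendRisk [IsFiniteMeasure P] (hF : mF ≤ mE)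
    {f : Lp ℝ ∞ P → lpMeas ℝ ℝ mF ∞ P} (hf : IsLinfRiskMeasure f) :
    IsLinfFRiskMeasure (extendRisk hF hf) := by
  refine ⟨fun x y hxy => ?_, fun x y => ?_⟩
  · have h1 : ∀ n, ∀ᵐ ω ∂P, (f (truncLinf (x : Ω →ₘ[P] ℝ) n) : Lp ℝ ∞ P) ω ≤
        (f (truncLinf (y : Ω →ₘ[P] ℝ) n) : Lp ℝ ∞ P) ω := by
      intro n
      refine hf.ae_antitone ?_
      filter_upwards [AEEqFun.coeFn_le.2 hxy, coeFn_truncLinf (x : Ω →ₘ[P] ℝ) n,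
        coeFn_truncLinf (y : Ω →ₘ[P] ℝ) n] with ω k1 k2 k3
      rw [k2, k3]
      gcongr
    rw [← AEEqFun.coeFn_le]
    filter_upwards [ae_all_iff.2 h1, eventually_extendRisk hF hf x, eventually_extendRisk hF hf y]
      with ω k1 k2 k3
    obtain ⟨n, h2, h3⟩ := (k2.and k3).exists
    rw [← h2, ← h3]
    exact k1 n
  · obtain ⟨ξ, hξm, hξ⟩ := exists_bound_of_LinfF x
    obtain ⟨η, hηm, hη⟩ := exists_measurable_ae_eq_of_L0F y
    have h1 : ∀ n : ℕ, ∀ᵐ ω ∂P, ξ ω + |η ω| ≤ n →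
        (f (truncLinf ((x + inclL0F y : LinfF mF P) : Ω →ₘ[P] ℝ) n) : Lp ℝ ∞ P) ω =
          (f (truncLinf (x : Ω →ₘ[P] ℝ) n) : Lp ℝ ∞ P) ω - (y : Ω →ₘ[P] ℝ) ω := by
      intro n
      obtain ⟨t, ht⟩ := exists_lpMeas_ae_eq (P := P) hF (C := n)
        (g := fun ω => max (-(n : ℝ)) (min (η ω) n))
        (measurable_const.max (hηm.min measurable_const))
        (Eventually.of_forall fun ω => abs_le.2
          ⟨le_max_left _ _, max_le (by linarith [(Nat.cast_nonneg n : (0 : ℝ) ≤ n)])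
            (min_le_right _ _)⟩)
      have hA : MeasurableSet[mF] {ω | ξ ω + |η ω| ≤ n} :=
        (hξm.add (continuous_abs.measurable.comp hηm)) measurableSet_Iic
      have hloc := hf.congr_on hF
        (x := truncLinf ((x + inclL0F y : LinfF mF P) : Ω →ₘ[P] ℝ) n)
        (x' := truncLinf (x : Ω →ₘ[P] ℝ) n + (t : Lp ℝ ∞ P)) hA (by
          filter_upwards [hξ, hη, truncLinf_eq_of_abs_le (x : Ω →ₘ[P] ℝ) n, ht,
            truncLinf_eq_of_abs_le ((x + inclL0F y : LinfF mF P) : Ω →ₘ[P] ℝ) n,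
            coeFn_inclL0F x y, Lp.coeFn_add (truncLinf (x : Ω →ₘ[P] ℝ) n) (t : Lp ℝ ∞ P)]
            with ω k1 k2 k3 k4 k5 k6 k7 hω
          have hω' : ξ ω + |η ω| ≤ n := hω
          have h0 := abs_nonneg (η ω)
          have h0' := abs_nonneg ((x : Ω →ₘ[P] ℝ) ω)
          have h8 := abs_le.1 (show |η ω| ≤ n by linarith)
          rw [k7, Pi.add_apply, k3 (by linarith), k4, k5, k6, k2, min_eq_left h8.2,
            max_eq_right h8.1]
          rw [k6, k2]
          exact (abs_add_le _ _).trans (by linarith))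
      filter_upwards [hloc, hf.ae_cash (truncLinf (x : Ω →ₘ[P] ℝ) n) t, ht, hη, hξ]
        with ω k1 k2 k3 k4 k5 hω
      have h0' := abs_nonneg ((x : Ω →ₘ[P] ℝ) ω)
      have h8 := abs_le.1 (show |η ω| ≤ n by linarith)
      rw [k1 hω, k2, k3, min_eq_left h8.2, max_eq_right h8.1, k4]
    refine Subtype.ext (AEEqFun.ext ?_)
    filter_upwards [ae_all_iff.2 h1, eventually_extendRisk hF hf x,
      eventually_extendRisk hF hf (x + inclL0F y),
      AEEqFun.coeFn_sub (extendRisk hF hf x : Ω →ₘ[P] ℝ) (y : Ω →ₘ[P] ℝ)] with ω k1 k2 k3 k4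
    obtain ⟨N, hN⟩ := exists_nat_ge (ξ ω + |η ω|)
    obtain ⟨n, ⟨h2, h3⟩, h4⟩ := ((k2.and k3).and (eventually_ge_atTop N)).exists
    rw [AddSubgroup.coe_sub, k4, Pi.sub_apply, ← h2, ← h3]
    exact k1 n (hN.trans (by exact_mod_cast h4))

/-- A monotone and cash invariant function on `L^∞_𝓕(𝓔)` is `1`-Lipschitz for `|||·|||_∞`. -/
theorem IsLinfFRiskMeasure.lipschitz [IsFiniteMeasure P] {fbar : LinfF mF P → L0F mF P}
    (hf : IsLinfFRiskMeasure fbar) (x y : LinfF mF P) : ∀ᵐ ω ∂P,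
    ((|(fbar x : Ω →ₘ[P] ℝ) ω - (fbar y : Ω →ₘ[P] ℝ) ω| : ℝ) : EReal) ≤
      (normInf mF ((x - y : LinfF mF P) : Ω →ₘ[P] ℝ)).1 ω := by
  obtain ⟨ξ, hξ⟩ := (x - y).2
  have h1 := abs_le_normInf (mF := mF) ((x - y : LinfF mF P) : Ω →ₘ[P] ℝ)
  rw [← hξ] at h1 ⊢
  have h2 : ∀ᵐ ω ∂P, |(x : Ω →ₘ[P] ℝ) ω - (y : Ω →ₘ[P] ℝ) ω| ≤ (ξ : Ω →ₘ[P] ℝ) ω := by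
    filter_upwards [h1, coeFn_toExt ξ, AEEqFun.coeFn_sub (x : Ω →ₘ[P] ℝ) (y : Ω →ₘ[P] ℝ)]
      with ω k1 k2 k3
    rw [k2, EReal.coe_le_coe_iff] at k1
    rwa [← Pi.sub_apply, ← k3]
  have h3 := hf.le_add_of_le_add (x := x) (x' := y) (ξ := ξ)
    (h2.mono fun ω k => by linarith [(abs_le.1 k).2])
  have h4 := hf.le_add_of_le_add (x := y) (x' := x) (ξ := ξ)
    (h2.mono fun ω k => by linarith [(abs_le.1 k).1])
  filter_upwards [h3, h4, coeFn_toExt ξ] with ω k3 k4 k5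
  rw [k5, EReal.coe_le_coe_iff, abs_le]
  constructor <;> linarith

theorem isExtension_extendRisk [IsFiniteMeasure P] (hF : mF ≤ mE)
    {f : Lp ℝ ∞ P → lpMeas ℝ ℝ mF ∞ P} (hf : IsLinfRiskMeasure f) :
    IsExtension f (extendRisk hF hf) := by
  have hrisk := isLinfFRiskMeasure_extendRisk hF hf
  refine ⟨hrisk, hrisk.lipschitz, fun x => Subtype.ext (AEEqFun.ext ?_)⟩
  filter_upwards [eventually_extendRisk hF hf (inclLinf x)] with ω h1
  obtain ⟨N, hN⟩ := exists_nat_ge ‖x‖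
  obtain ⟨n, h2, h3⟩ := (h1.and (eventually_ge_atTop N)).exists
  have h4 : truncLinf ((inclLinf x : LinfF mF P) : Ω →ₘ[P] ℝ) n = x := by
    refine Lp.ext ?_
    filter_upwards [truncLinf_eq_of_abs_le ((inclLinf x : LinfF mF P) : Ω →ₘ[P] ℝ) n,
      ae_abs_le_norm x] with ω k1 k2
    exact k1 (k2.trans (hN.trans (by exact_mod_cast h3)))
  rw [← h2, h4]
  rfl

theorem IsExtension.unique [IsFiniteMeasure P] (hF : mF ≤ mE)
    {f : Lp ℝ ∞ P → lpMeas ℝ ℝ mF ∞ P} {g g' : LinfF mF P → L0F mF P} (hg : IsExtension f g)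
    (hg' : IsExtension f g') : g = g' := by
  funext x
  obtain ⟨ξ, hξm, hξ⟩ := exists_bound_of_LinfF x
  have key : ∀ n : ℕ, ∀ᵐ ω ∂P, ξ ω ≤ n → (x : Ω →ₘ[P] ℝ) ω = truncLinf (x : Ω →ₘ[P] ℝ) n ω := by
    intro n
    filter_upwards [hξ, truncLinf_eq_of_abs_le (x : Ω →ₘ[P] ℝ) n] with ω h1 h2 hω
    exact (h2 (h1.trans hω)).symm
  refine Subtype.ext (AEEqFun.ext ?_)
  filter_upwards [
    ae_all_iff.2 fun n : ℕ => hg.congr_on hF (A := {ω | ξ ω ≤ n}) (hξm measurableSet_Iic) (key n),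
    ae_all_iff.2 fun n : ℕ => hg'.congr_on hF (A := {ω | ξ ω ≤ n}) (hξm measurableSet_Iic) (key n)]
    with ω h1 h2
  obtain ⟨n, hn⟩ := exists_nat_ge (ξ ω)
  rw [h1 n hn, h2 n hn]

end Extension

/-! ### Essential suprema -/

section EssSup

variable {Ω : Type*} {mF mE : MeasurableSpace Ω} {P : Measure Ω}

theorem exists_neg_extL0 (ζ : ExtL0 mF P) : ∃ η : ExtL0 mF P, ∀ᵐ ω ∂P, η.1 ω = -ζ.1 ω := by
  have h := AEEqFun.coeFn_comp (Neg.neg : EReal → EReal) continuous_neg ζ.1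
  exact ⟨⟨AEEqFun.comp Neg.neg continuous_neg ζ.1,
    (continuous_neg.comp_aestronglyMeasurable ζ.2).congr h.symm⟩, h⟩

/-- The essential supremum of a nonempty family is the pointwise supremum of a sequence from the
family. -/
theorem exists_seq_ae_eq_iSup [IsFiniteMeasure P] {S : Set (ExtL0 mF P)} (hS : S.Nonempty)
    {g : ExtL0 mF P} (hg : IsLUB S g) :
    ∃ s : ℕ → ExtL0 mF P, (∀ n, s n ∈ S) ∧ ∀ᵐ ω ∂P, g.1 ω = ⨆ n, (s n).1 ω := by
  choose N hN using fun ζ : ExtL0 mF P => exists_neg_extL0 ζ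
  obtain ⟨t, ht, hglb⟩ := exists_seq_isGLB (N '' S) (hS.image N)
  choose s hsS hst using ht
  refine ⟨s, hsS, ?_⟩
  have h1 : g ≤ N (seqInf t) := by
    refine hg.2 fun a ha => (ExtL0.le_iff _ _).2 ?_
    filter_upwards [(ExtL0.le_iff _ _).1 (hglb.1 (Set.mem_image_of_mem N ha)), hN a,
      hN (seqInf t)] with ω k1 k2 k3
    rw [k3]
    rw [k2] at k1
    exact EReal.le_neg_of_le_neg k1
  filter_upwards [(ExtL0.le_iff _ _).1 h1, hN (seqInf t), coeFn_seqInf t,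
    ae_all_iff.2 fun n => hN (s n), ae_all_iff.2 fun n => (ExtL0.le_iff _ _).1 (hg.1 (hsS n))]
    with ω k1 k2 k3 k4 k5
  refine le_antisymm (k1.trans ?_) (iSup_le k5)
  rw [k2, k3]
  refine EReal.neg_le_of_neg_le (le_iInf fun n => ?_)
  rw [← hst n, k4]
  exact EReal.neg_le_neg_iff.2 (le_iSup (fun n => (s n).1 ω) n)

end EssSup

/-! ### The expected risk -/

section Expected

variable {Ω : Type*} {mF mE : MeasurableSpace Ω} {P : Measure Ω}
  {f : Lp ℝ ∞ P → lpMeas ℝ ℝ mF ∞ P}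

theorem integrable_Linf [IsFiniteMeasure P] (x : Lp ℝ ∞ P) : Integrable x P :=
  (Lp.memLp x).integrable le_top

theorem convexOn_integral_risk [IsFiniteMeasure P] (hconv : IsL0Convex f) :
    ConvexOn ℝ Set.univ fun x => ∫ ω, (f x : Lp ℝ ∞ P) ω ∂P := by
  refine ⟨convex_univ, fun x _ y _ a b ha hb hab => ?_⟩
  obtain rfl : b = 1 - a := by linarith
  have hc := coeFn_constL0 (mF := mF) (P := P) a
  have h1 := hconv x y (a • x + (1 - a) • y) (constL0 a) (by
      rw [← AEEqFun.coeFn_le]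
      filter_upwards [hc, AEEqFun.coeFn_zero (μ := P) (β := ℝ)] with ω k1 k2
      rw [k1, k2]
      exact ha) (by
      rw [← AEEqFun.coeFn_le]
      filter_upwards [hc, AEEqFun.coeFn_one (μ := P) (β := ℝ)] with ω k1 k2
      rw [k1, k2]
      simpa using hb) (by
      refine AEEqFun.ext ?_
      filter_upwards [hc, AEEqFun.coeFn_one (μ := P) (β := ℝ),
        AEEqFun.coeFn_add (((constL0 a : L0F mF P) : Ω →ₘ[P] ℝ) * (x : Ω →ₘ[P] ℝ))
          ((1 - ((constL0 a : L0F mF P) : Ω →ₘ[P] ℝ)) * (y : Ω →ₘ[P] ℝ)),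
        AEEqFun.coeFn_mul ((constL0 a : L0F mF P) : Ω →ₘ[P] ℝ) (x : Ω →ₘ[P] ℝ),
        AEEqFun.coeFn_mul (1 - ((constL0 a : L0F mF P) : Ω →ₘ[P] ℝ)) (y : Ω →ₘ[P] ℝ),
        AEEqFun.coeFn_sub 1 ((constL0 a : L0F mF P) : Ω →ₘ[P] ℝ),
        Lp.coeFn_add (a • x) ((1 - a) • y), Lp.coeFn_smul a x, Lp.coeFn_smul (1 - a) y]
        with ω k1 k2 k3 k4 k5 k6 k7 k8 k9
      rw [k3, k7, Pi.add_apply, Pi.add_apply, k4, k5, k8, k9, Pi.mul_apply, Pi.mul_apply, k6,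
        Pi.sub_apply, k1, k2, Pi.smul_apply, Pi.smul_apply, smul_eq_mul, smul_eq_mul,
        Pi.one_apply])
  simp only [smul_eq_mul]
  rw [← integral_const_mul, ← integral_const_mul, ← integral_add
    ((integrable_Linf _).const_mul _) ((integrable_Linf _).const_mul _)]
  refine integral_mono_ae (integrable_Linf _) (((integrable_Linf _).const_mul _).add
    ((integrable_Linf _).const_mul _)) ?_
  rw [← AEEqFun.coeFn_le] at h1
  filter_upwards [h1, hc, AEEqFun.coeFn_one (μ := P) (β := ℝ),
    AEEqFun.coeFn_add (((constL0 a : L0F mF P) : Ω →ₘ[P] ℝ) * ((f x : Lp ℝ ∞ P) : Ω →ₘ[P] ℝ))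
      ((1 - ((constL0 a : L0F mF P) : Ω →ₘ[P] ℝ)) * ((f y : Lp ℝ ∞ P) : Ω →ₘ[P] ℝ)),
    AEEqFun.coeFn_mul ((constL0 a : L0F mF P) : Ω →ₘ[P] ℝ) ((f x : Lp ℝ ∞ P) : Ω →ₘ[P] ℝ),
    AEEqFun.coeFn_mul (1 - ((constL0 a : L0F mF P) : Ω →ₘ[P] ℝ))
      ((f y : Lp ℝ ∞ P) : Ω →ₘ[P] ℝ),
    AEEqFun.coeFn_sub 1 ((constL0 a : L0F mF P) : Ω →ₘ[P] ℝ)]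
    with ω k1 k2 k3 k4 k5 k6 k7
  rwa [k4, Pi.add_apply, k5, k6, Pi.mul_apply, Pi.mul_apply, k7, Pi.sub_apply, k2, k3,
    Pi.one_apply] at k1

theorem ae_abs_risk_le [IsFiniteMeasure P] (hF : mF ≤ mE) (hf : IsLinfRiskMeasure f)
    {x : Lp ℝ ∞ P} {C : ℝ} (hx : ‖x‖ ≤ C) :
    ∀ᵐ ω ∂P, |(f x : Lp ℝ ∞ P) ω| ≤ ‖(f 0 : Lp ℝ ∞ P)‖ + C := by
  obtain ⟨ξ, hξ⟩ := exists_lpMeas_ae_eq (P := P) hF (C := |C|) (g := fun _ => C)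
    measurable_const (Eventually.of_forall fun ω => le_rfl)
  have h0 := Lp.coeFn_zero ℝ ∞ P
  have h1 := hf.le_add_of_le_add (x := x) (x' := 0) (ξ := ξ) (by
    filter_upwards [hξ, ae_abs_le_norm x, h0] with ω k1 k2 k3
    rw [k1, k3, Pi.zero_apply]
    linarith [(abs_le.1 k2).2])
  have h2 := hf.le_add_of_le_add (x := 0) (x' := x) (ξ := ξ) (by
    filter_upwards [hξ, ae_abs_le_norm x, h0] with ω k1 k2 k3
    rw [k1, k3, Pi.zero_apply]
    linarith [(abs_le.1 k2).1])
  filter_upwards [h1, h2, hξ, ae_abs_le_norm (f 0 : Lp ℝ ∞ P)] with ω k1 k2 k3 k4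
  rw [k3] at k1 k2
  rw [abs_le]
  constructor <;> linarith [(abs_le.1 k4).1, (abs_le.1 k4).2]

/-- The Fatou property passes to the expected risk. -/
theorem integral_risk_le_of_tendsto [IsProbabilityMeasure P] (hF : mF ≤ mE)
    (hf : IsLinfRiskMeasure f) (hfatou : FatouProperty f) {s : ℕ → Lp ℝ ∞ P} {x : Lp ℝ ∞ P} {c : ℝ}
    (hs : ∃ C : ℝ, ∀ n, ‖s n‖ ≤ C)
    (hlim : ∀ᵐ ω ∂P, Tendsto (fun n => s n ω) atTop (𝓝 (x ω)))
    (hc : ∀ n, ∫ ω, (f (s n) : Lp ℝ ∞ P) ω ∂P ≤ c) : ∫ ω, (f x : Lp ℝ ∞ P) ω ∂P ≤ c := by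
  have hfat := hfatou s x hs hlim
  obtain ⟨C, hC⟩ := hs
  -- adding a constant makes all the risks nonnegative
  set M : ℝ := ‖(f 0 : Lp ℝ ∞ P)‖ + max C ‖x‖ with hM
  have hsM : ∀ n, ∀ᵐ ω ∂P, |(f (s n) : Lp ℝ ∞ P) ω| ≤ M := fun n =>
    ae_abs_risk_le hF hf ((hC n).trans (le_max_left _ _))
  have hxM : ∀ᵐ ω ∂P, |(f x : Lp ℝ ∞ P) ω| ≤ M := ae_abs_risk_le hF hf (le_max_right _ _)
  have hval : ∀ z : Lp ℝ ∞ P, (∀ᵐ ω ∂P, |(f z : Lp ℝ ∞ P) ω| ≤ M) →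
      ∫⁻ ω, ENNReal.ofReal ((f z : Lp ℝ ∞ P) ω + M) ∂P =
        ENNReal.ofReal (∫ ω, (f z : Lp ℝ ∞ P) ω ∂P + M) := by
    intro z hz
    rw [← ofReal_integral_eq_lintegral_ofReal (f := fun ω => (f z : Lp ℝ ∞ P) ω + M)
      ((integrable_Linf _).add (integrable_const M))
      (hz.mono fun ω h => by linarith [(abs_le.1 h).1, Pi.zero_apply (M := fun _ : Ω => ℝ) ω]),
      integral_add (integrable_Linf _) (integrable_const M)]
    simp
  have h1 : ∫⁻ ω, ENNReal.ofReal ((f x : Lp ℝ ∞ P) ω + M) ∂P ≤ ENNReal.ofReal (c + M) := by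
    calc ∫⁻ ω, ENNReal.ofReal ((f x : Lp ℝ ∞ P) ω + M) ∂P
        ≤ ∫⁻ ω, liminf (fun n => ENNReal.ofReal ((f (s n) : Lp ℝ ∞ P) ω + M)) atTop ∂P := by
          refine lintegral_mono_ae ?_
          filter_upwards [hfat] with ω hω
          refine le_of_forall_lt fun b hb => ?_
          obtain ⟨b', hb', hb''⟩ := exists_between hb
          refine hb'.trans_le (le_liminf_of_le (by isBoundedDefault) ?_)
          have hb1 : b'.toReal < (f x : Lp ℝ ∞ P) ω + M :=
            (ENNReal.lt_ofReal_iff_toReal_lt hb''.ne_top).1 hb''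
          have hb2 : ((b'.toReal - M : ℝ) : EReal) <
              liminf (fun n => (((f (s n) : Lp ℝ ∞ P) ω : ℝ) : EReal)) atTop :=
            lt_of_lt_of_le (EReal.coe_lt_coe_iff.2 (by linarith)) hω
          filter_upwards [eventually_lt_of_lt_liminf hb2] with n hn
          rw [EReal.coe_lt_coe_iff] at hn
          exact ((ENNReal.lt_ofReal_iff_toReal_lt hb''.ne_top).2 (by linarith)).le
      _ ≤ liminf (fun n => ∫⁻ ω, ENNReal.ofReal ((f (s n) : Lp ℝ ∞ P) ω + M) ∂P) atTop :=
          lintegral_liminf_le' fun n =>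
            ((Lp.aestronglyMeasurable _).aemeasurable.add_const M).ennreal_ofReal
      _ ≤ ENNReal.ofReal (c + M) := by
          refine liminf_le_of_le (by isBoundedDefault) fun b hb => ?_
          obtain ⟨n, hn⟩ := hb.exists
          refine hn.trans ?_
          rw [hval _ (hsM n)]
          exact ENNReal.ofReal_le_ofReal (by linarith [hc n])
  rw [hval x hxM, ENNReal.ofReal_le_ofReal_iff] at h1
  · linarith
  · have h2 : ∫ _, -M ∂P ≤ ∫ ω, (f (s 0) : Lp ℝ ∞ P) ω ∂P :=
      integral_mono_ae (integrable_const _) (integrable_Linf _)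
        ((hsM 0).mono fun ω h => (abs_le.1 h).1)
    simp only [integral_const, probReal_univ, one_smul] at h2
    linarith [hc 0]

end Expected

/-! ### The conditional dual representation -/

section Dual

variable {Ω : Type*} {mF mE : MeasurableSpace Ω} {P : Measure Ω}
  {f : Lp ℝ ∞ P → lpMeas ℝ ℝ mF ∞ P}

/-- The gain `E(x y | 𝓕) - f(x)` whose supremum over `x` is the random conjugate of `f` at `y`. -/
noncomputable def gain (f : Lp ℝ ∞ P → lpMeas ℝ ℝ mF ∞ P) (y : Ω →ₘ[P] ℝ) (x : Lp ℝ ∞ P) :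
    L0F mF P :=
  condE mF ((x : Ω →ₘ[P] ℝ) * y) - inclLinfMeas (f x)

theorem coeFn_gain (y : Ω →ₘ[P] ℝ) (x : Lp ℝ ∞ P) : ∀ᵐ ω ∂P, (gain f y x : Ω →ₘ[P] ℝ) ω =
    (condE mF ((x : Ω →ₘ[P] ℝ) * y) : Ω →ₘ[P] ℝ) ω - (f x : Lp ℝ ∞ P) ω :=
  AEEqFun.coeFn_sub _ _

theorem isLUB_randomConj [IsFiniteMeasure P] (f : Lp ℝ ∞ P → lpMeas ℝ ℝ mF ∞ P)
    (y : Ω →ₘ[P] ℝ) : IsLUB (Set.range fun x => toExt (gain f y x)) (randomConj f y) :=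
  isLUB_iSup

theorem gain_le_randomConj [IsFiniteMeasure P] (y : Ω →ₘ[P] ℝ) (x : Lp ℝ ∞ P) : ∀ᵐ ω ∂P,
    (((gain f y x : Ω →ₘ[P] ℝ) ω : ℝ) : EReal) ≤ (randomConj f y).1 ω := by
  filter_upwards [(ExtL0.le_iff _ _).1 ((isLUB_randomConj f y).1 (Set.mem_range_self x)),
    coeFn_toExt (gain f y x)] with ω h1 h2
  rwa [← h2]

/-- By locality, the gains form an upward directed family. -/
theorem exists_gain_max [IsFiniteMeasure P] (hF : mF ≤ mE) (hf : IsLinfRiskMeasure f)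
    (y : Ω →ₘ[P] ℝ) (t s : Lp ℝ ∞ P) : ∃ r : Lp ℝ ∞ P, ∀ᵐ ω ∂P,
      (gain f y t : Ω →ₘ[P] ℝ) ω ≤ (gain f y r : Ω →ₘ[P] ℝ) ω ∧
      (gain f y s : Ω →ₘ[P] ℝ) ω ≤ (gain f y r : Ω →ₘ[P] ℝ) ω := by
  classical
  obtain ⟨a, ham, ha⟩ := exists_measurable_ae_eq_of_L0F (gain f y t)
  obtain ⟨b, hbm, hb⟩ := exists_measurable_ae_eq_of_L0F (gain f y s)
  set A : Set Ω := {ω | b ω ≤ a ω} with hA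
  have hAm : MeasurableSet[mF] A := measurableSet_le hbm ham
  have hm : AEStronglyMeasurable (A.piecewise (t : Ω → ℝ) s) P :=
    ((AEEqFun.stronglyMeasurable _).piecewise (hF _ hAm)
      (AEEqFun.stronglyMeasurable _)).aestronglyMeasurable
  obtain ⟨r, hr⟩ := exists_Linf_ae_eq hm (C := max ‖t‖ ‖s‖) (by
    filter_upwards [ae_abs_le_norm t, ae_abs_le_norm s] with ω h1 h2
    by_cases hω : ω ∈ A
    · rw [Set.piecewise_eq_of_mem _ _ _ hω]
      exact h1.trans (le_max_left _ _)
    · rw [Set.piecewise_eq_of_notMem _ _ _ hω]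
      exact h2.trans (le_max_right _ _))
  have key : ∀ (B : Set Ω) (z : Lp ℝ ∞ P), MeasurableSet[mF] B →
      (∀ᵐ ω ∂P, ω ∈ B → r ω = z ω) →
      ∀ᵐ ω ∂P, ω ∈ B → (gain f y r : Ω →ₘ[P] ℝ) ω = (gain f y z : Ω →ₘ[P] ℝ) ω := by
    intro B z hB h
    have h1 := condE_congr_on hF (z := (r : Ω →ₘ[P] ℝ) * y) (z' := (z : Ω →ₘ[P] ℝ) * y) hB (by
      filter_upwards [h, AEEqFun.coeFn_mul (r : Ω →ₘ[P] ℝ) y,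
        AEEqFun.coeFn_mul (z : Ω →ₘ[P] ℝ) y] with ω k1 k2 k3 hω
      rw [k2, k3, Pi.mul_apply, Pi.mul_apply, k1 hω])
    filter_upwards [h1, hf.congr_on hF hB h, coeFn_gain (f := f) y r, coeFn_gain (f := f) y z]
      with ω k1 k2 k3 k4 hω
    rw [k3, k4, k1 hω, k2 hω]
  refine ⟨r, ?_⟩
  filter_upwards [ha, hb,
    key A t hAm (hr.mono fun ω h hω => by rw [h, Set.piecewise_eq_of_mem _ _ _ hω]),
    key Aᶜ s hAm.compl (hr.mono fun ω h hω => by rw [h, Set.piecewise_eq_of_notMem _ _ _ hω])]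
    with ω k1 k2 k3 k4
  by_cases hω : ω ∈ A
  · rw [k3 hω]
    refine ⟨le_rfl, ?_⟩
    rw [k1, k2]
    exact hω
  · rw [k4 hω]
    refine ⟨?_, le_rfl⟩
    rw [k1, k2]
    exact (not_le.1 hω).le

theorem integrable_mul_of_integrable {y : Ω →ₘ[P] ℝ} (hy : Integrable y P) (x : Lp ℝ ∞ P) :
    Integrable ((x : Ω →ₘ[P] ℝ) * y : Ω →ₘ[P] ℝ) P := by
  refine (integrable_mul_Linf hy x).congr ?_
  filter_upwards [AEEqFun.coeFn_mul (x : Ω →ₘ[P] ℝ) y] with ω h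
  rw [h, Pi.mul_apply, mul_comm]

theorem integrable_gain [IsFiniteMeasure P] {y : Ω →ₘ[P] ℝ} (hy : Integrable y P)
    (x : Lp ℝ ∞ P) : Integrable (gain f y x : Ω →ₘ[P] ℝ) P := by
  refine ((integrable_condExp (μ := P) (m := mF) (f := ((x : Ω →ₘ[P] ℝ) * y : Ω →ₘ[P] ℝ))).sub
    (integrable_Linf (f x : Lp ℝ ∞ P))).congr ?_
  filter_upwards [coeFn_gain (f := f) y x,
    condE_ae_eq_condExp (mF := mF) (integrable_mul_of_integrable hy x)] with ω h1 h2
  rw [h1, h2, Pi.sub_apply]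

theorem integral_gain [IsFiniteMeasure P] (hF : mF ≤ mE) {y : Ω →ₘ[P] ℝ} (hy : Integrable y P)
    (x : Lp ℝ ∞ P) : ∫ ω, (gain f y x : Ω →ₘ[P] ℝ) ω ∂P =
      ∫ ω, y ω * x ω ∂P - ∫ ω, (f x : Lp ℝ ∞ P) ω ∂P := by
  have h1 : ∫ ω, y ω * x ω ∂P = ∫ ω, (P[((x : Ω →ₘ[P] ℝ) * y : Ω →ₘ[P] ℝ) | mF]) ω ∂P := by
    rw [integral_condExp hF]
    refine integral_congr_ae ?_
    filter_upwards [AEEqFun.coeFn_mul (x : Ω →ₘ[P] ℝ) y] with ω h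
    rw [h, Pi.mul_apply, mul_comm]
  rw [h1, ← integral_sub integrable_condExp (integrable_Linf _)]
  refine integral_congr_ae ?_
  filter_upwards [coeFn_gain (f := f) y x,
    condE_ae_eq_condExp (mF := mF) (integrable_mul_of_integrable hy x)] with ω h1 h2
  rw [h1, h2]

/-- If `y` is almost a subgradient at `x₀` of the expected risk, then `x₀` almost attains the
supremum defining the random conjugate of `f` at `y`, in the mean. -/
theorem lintegral_randomConj_sub_gain_le [IsFiniteMeasure P] (hF : mF ≤ mE)
    (hf : IsLinfRiskMeasure f) {y : Ω →ₘ[P] ℝ} (hy : Integrable y P) {x₀ : Lp ℝ ∞ P} {δ : ℝ}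
    (hsub : ∀ x : Lp ℝ ∞ P, ∫ ω, (f x₀ : Lp ℝ ∞ P) ω ∂P - δ + ∫ ω, y ω * (x ω - x₀ ω) ∂P ≤
      ∫ ω, (f x : Lp ℝ ∞ P) ω ∂P) :
    ∫⁻ ω, ((randomConj f y).1 ω - (((gain f y x₀ : Ω →ₘ[P] ℝ) ω : ℝ) : EReal)).toENNReal ∂P ≤
      ENNReal.ofReal δ := by
  obtain ⟨s, hsS, hs⟩ := exists_seq_ae_eq_iSup (Set.range_nonempty _) (isLUB_randomConj f y)
  choose r hr using hsS
  choose m hm using fun t s => exists_gain_max hF hf y t s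
  -- starting at `x₀`, pass to positions whose gains increase a.s. and dominate those of `rₙ`
  obtain ⟨t, ht0, htsucc⟩ : ∃ t : ℕ → Lp ℝ ∞ P, t 0 = x₀ ∧ ∀ n, t (n + 1) = m (t n) (r n) :=
    ⟨fun n => Nat.rec x₀ (fun n t => m t (r n)) n, rfl, fun _ => rfl⟩
  have ht : ∀ n, ∀ᵐ ω ∂P,
      (gain f y (t n) : Ω →ₘ[P] ℝ) ω ≤ (gain f y (t (n + 1)) : Ω →ₘ[P] ℝ) ω ∧
      (gain f y (r n) : Ω →ₘ[P] ℝ) ω ≤ (gain f y (t (n + 1)) : Ω →ₘ[P] ℝ) ω :=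
    fun n => htsucc n ▸ hm (t n) (r n)
  let F : ℕ → Ω → ℝ≥0∞ := fun n ω => ENNReal.ofReal
    ((gain f y (t n) : Ω →ₘ[P] ℝ) ω - (gain f y x₀ : Ω →ₘ[P] ℝ) ω)
  have hmono : ∀ᵐ ω ∂P, Monotone fun n => (gain f y (t n) : Ω →ₘ[P] ℝ) ω := by
    filter_upwards [ae_all_iff.2 ht] with ω h using monotone_nat_of_le_succ fun n => (h n).1
  have hFint : ∀ n, ∫⁻ ω, F n ω ∂P ≤ ENNReal.ofReal δ := by
    intro n
    rw [← ofReal_integral_eq_lintegral_ofReal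
      (f := fun ω => (gain f y (t n) : Ω →ₘ[P] ℝ) ω - (gain f y x₀ : Ω →ₘ[P] ℝ) ω)
      ((integrable_gain hy _).sub (integrable_gain hy _))
      (hmono.mono fun ω h => sub_nonneg.2 (ht0 ▸ h (Nat.zero_le n))),
      integral_sub (integrable_gain hy _) (integrable_gain hy _), integral_gain hF hy,
      integral_gain hF hy]
    refine ENNReal.ofReal_le_ofReal ?_
    have h1 := hsub (t n)
    simp_rw [mul_sub] at h1
    rw [integral_sub (integrable_mul_Linf hy _) (integrable_mul_Linf hy _)] at h1
    linarith
  have hFsup : ∫⁻ ω, ⨆ n, F n ω ∂P ≤ ENNReal.ofReal δ := by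
    rw [lintegral_iSup' (f := F) (fun n => ((AEEqFun.measurable _).sub
      (AEEqFun.measurable _)).ennreal_ofReal.aemeasurable)
      (hmono.mono fun ω h n k hnk => ENNReal.ofReal_le_ofReal (sub_le_sub_right (h hnk) _))]
    exact iSup_le hFint
  refine (lintegral_mono_ae ?_).trans hFsup
  filter_upwards [hs, ae_all_iff.2 ht, ae_all_iff.2 fun n => coeFn_toExt (gain f y (r n))]
    with ω h1 h2 h3
  rw [← EReal.toENNReal_coe (x := ⨆ n, F n ω)]
  refine EReal.toENNReal_le_toENNReal ?_
  refine EReal.sub_le_of_le_add ?_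
  rw [h1]
  refine iSup_le fun n => ?_
  rw [← hr n, h3]
  have h4 : ((ENNReal.ofReal ((gain f y (r n) : Ω →ₘ[P] ℝ) ω -
      (gain f y x₀ : Ω →ₘ[P] ℝ) ω) : ℝ≥0∞) : EReal) ≤ ((⨆ n, F n ω : ℝ≥0∞) : EReal) := by
    rw [EReal.coe_ennreal_le_coe_ennreal_iff]
    exact (ENNReal.ofReal_le_ofReal (by linarith [(h2 n).2])).trans
      (le_iSup (fun n => F n ω) (n + 1))
  refine le_trans ?_ (add_le_add_left h4 _)
  rw [EReal.coe_ennreal_ofReal, ← EReal.coe_add, EReal.coe_le_coe_iff]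
  linarith [le_max_left ((gain f y (r n) : Ω →ₘ[P] ℝ) ω - (gain f y x₀ : Ω →ₘ[P] ℝ) ω) 0]

/-- Almost subgradients of the expected risk are negatives of conditional densities. -/
theorem condE_eq_neg_one_of_subgradient [IsFiniteMeasure P] (hF : mF ≤ mE)
    (hf : IsLinfRiskMeasure f) {y : Ω →ₘ[P] ℝ} (hy : Integrable y P) {x₀ : Lp ℝ ∞ P} {δ : ℝ}
    (hδ : 0 < δ)
    (hsub : ∀ x : Lp ℝ ∞ P, ∫ ω, (f x₀ : Lp ℝ ∞ P) ω ∂P - δ + ∫ ω, y ω * (x ω - x₀ ω) ∂P ≤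
      ∫ ω, (f x : Lp ℝ ∞ P) ω ∂P) :
    (condE mF y : Ω →ₘ[P] ℝ) = -1 := by
  have key : ∀ A, MeasurableSet[mF] A → ∫ ω in A, y ω ∂P = ∫ ω in A, (-1 : ℝ) ∂P := by
    intro A hA
    -- test the subgradient inequality on `x₀ + m 1_A`; cash invariance makes it linear in `m`
    have hbound : ∀ m : ℝ, m * (∫ ω in A, y ω ∂P - ∫ ω in A, (-1 : ℝ) ∂P) ≤ δ := by
      intro m
      obtain ⟨ξ, hξ⟩ := exists_lpMeas_ae_eq (P := P) hF (C := |m|) (g := A.indicator fun _ => m)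
        (measurable_const.indicator hA) (Eventually.of_forall fun ω =>
          norm_indicator_le_norm_self (fun _ => m) ω)
      have h1 := hsub (x₀ + ξ)
      have h2 : ∫ ω, y ω * ((x₀ + (ξ : Lp ℝ ∞ P) : Lp ℝ ∞ P) ω - x₀ ω) ∂P =
          m * ∫ ω in A, y ω ∂P := by
        rw [← integral_indicator (hF _ hA), ← integral_const_mul]
        refine integral_congr_ae ?_
        filter_upwards [hξ, Lp.coeFn_add x₀ (ξ : Lp ℝ ∞ P)] with ω k1 k2
        rw [k2, Pi.add_apply, k1]
        by_cases hω : ω ∈ A <;> simp [hω, mul_comm]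
      have h3 : ∫ ω, (f (x₀ + ξ) : Lp ℝ ∞ P) ω ∂P =
          ∫ ω, (f x₀ : Lp ℝ ∞ P) ω ∂P + m * ∫ ω in A, (-1 : ℝ) ∂P := by
        rw [← integral_indicator (hF _ hA), ← integral_const_mul, ← integral_add
          (integrable_Linf _) (((integrable_const _).indicator (hF _ hA)).const_mul _)]
        refine integral_congr_ae ?_
        filter_upwards [hξ, hf.ae_cash x₀ ξ] with ω k1 k2
        rw [k2, k1]
        by_cases hω : ω ∈ A <;> simp [hω, sub_eq_add_neg]
      rw [h2, h3] at h1
      linarith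
    by_contra hne
    have h0 : ∫ ω in A, y ω ∂P - ∫ ω in A, (-1 : ℝ) ∂P ≠ 0 := sub_ne_zero.2 hne
    have h1 := hbound (2 * δ / (∫ ω in A, y ω ∂P - ∫ ω in A, (-1 : ℝ) ∂P))
    rw [div_mul_cancel₀ _ h0] at h1
    linarith
  have h1 : (fun _ => (-1 : ℝ)) =ᵐ[P] P[y | mF] :=
    ae_eq_condExp_of_forall_setIntegral_eq hF hy (fun s _ _ => integrable_const _)
      (fun s hs _ => (key s hs).symm) aestronglyMeasurable_const
  refine AEEqFun.ext ?_
  filter_upwards [h1, condE_ae_eq_condExp (mF := mF) hy,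
    AEEqFun.coeFn_neg (1 : Ω →ₘ[P] ℝ), AEEqFun.coeFn_one (μ := P) (β := ℝ)] with ω k1 k2 k3 k4
  rw [k2, ← k1, k3, Pi.neg_apply, k4, Pi.one_apply]

theorem EReal_sub_le_sub_of_sub_le {a b : ℝ} {u v : EReal} (h : (a : EReal) - u ≤ v) :
    (b : EReal) - v ≤ u - ((a - b : ℝ) : EReal) := by
  induction u with
  | top =>
    rw [EReal.top_sub_coe]
    exact le_top
  | bot =>
    rw [EReal.coe_sub_bot, top_le_iff] at h
    simp [h]
  | coe u =>
    induction v with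
    | top => simp
    | bot =>
      rw [← EReal.coe_sub] at h
      exact absurd (le_bot_iff.1 h) (EReal.coe_ne_bot _)
    | coe v =>
      rw [← EReal.coe_sub, EReal.coe_le_coe_iff] at h
      rw [← EReal.coe_sub, ← EReal.coe_sub, EReal.coe_le_coe_iff]
      linarith

theorem EReal_coe_le_of_coe_sub_nonpos {a : ℝ} {u : EReal} (h : (a : EReal) - u ≤ 0) :
    (a : EReal) ≤ u := by
  induction u with
  | top => exact le_top
  | bot =>
    rw [EReal.coe_sub_bot] at h
    exact absurd (top_le_iff.1 h) EReal.zero_ne_top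
  | coe u =>
    rw [← EReal.coe_sub, ← EReal.coe_zero, EReal.coe_le_coe_iff] at h
    rw [EReal.coe_le_coe_iff]
    linarith

theorem EReal_coe_sub_le_of_coe_sub_le {a b : ℝ} {u : EReal} (h : ((a - b : ℝ) : EReal) ≤ u) :
    (a : EReal) - u ≤ b := by
  induction u with
  | top => simp
  | bot => exact absurd (le_bot_iff.1 h) (EReal.coe_ne_bot _)
  | coe u =>
    rw [EReal.coe_le_coe_iff] at h
    rw [← EReal.coe_sub, EReal.coe_le_coe_iff]
    linarith

/-- The Fatou property implies the dual representation by conditional densities in `L¹(𝓔)`. -/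
theorem dual_representation_of_fatou [IsProbabilityMeasure P] (hF : mF ≤ mE)
    (hf : IsLinfRiskMeasure f) (hconv : IsL0Convex f) (hfatou : FatouProperty f) (x₀ : Lp ℝ ∞ P) :
    toExt (inclLinfMeas (f x₀)) = ⨆ y ∈ {y : Ω →ₘ[P] ℝ | y ∈ Lp ℝ 1 P ∧ y ≤ 0 ∧
      (condE mF y : Ω →ₘ[P] ℝ) = -1},
        (toExt (condE mF ((x₀ : Ω →ₘ[P] ℝ) * y)) - randomConj f y) := by
  refine le_antisymm ?_ (iSup₂_le fun y _ => ?_)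
  · set U : ExtL0 mF P := ⨆ y ∈ {y : Ω →ₘ[P] ℝ | y ∈ Lp ℝ 1 P ∧ y ≤ 0 ∧
      (condE mF y : Ω →ₘ[P] ℝ) = -1},
        (toExt (condE mF ((x₀ : Ω →ₘ[P] ℝ) * y)) - randomConj f y) with hU
    have hint : ∀ δ : ℝ, 0 < δ → ∫⁻ ω, ((((f x₀ : Lp ℝ ∞ P) ω : ℝ) : EReal) - U.1 ω).toENNReal ∂P ≤
        ENNReal.ofReal δ := by
      intro δ hδ
      obtain ⟨y', hy', hneg, hsub'⟩ := exists_integrable_subgradient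
        (φ := fun x => ∫ ω, (f x : Lp ℝ ∞ P) ω ∂P)
        (fun x y hxy => integral_mono_ae (integrable_Linf _) (integrable_Linf _)
          (hf.ae_antitone ((Lp.coeFn_le _ _).2 hxy)))
        (fun x c => by
          obtain ⟨ξ, hξ⟩ := exists_lpMeas_ae_eq (P := P) hF (C := |c|) (g := fun _ => c)
            measurable_const (Eventually.of_forall fun ω => le_rfl)
          have h1 : (ξ : Lp ℝ ∞ P) = Lp.const ∞ P c := by
            refine Lp.ext ?_
            filter_upwards [hξ, Lp.coeFn_const (p := ∞) (μ := P) c] with ω k1 k2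
            rw [k1, k2, Function.const_apply]
          have h2 : ∫ ω, ((f x : Lp ℝ ∞ P) ω - c) ∂P = ∫ ω, (f x : Lp ℝ ∞ P) ω ∂P - c := by
            rw [integral_sub (integrable_Linf _) (integrable_const c)]
            simp
          rw [← h1, ← h2]
          refine integral_congr_ae ?_
          filter_upwards [hf.ae_cash x ξ, hξ] with ω k1 k2
          rw [k1, k2])
        (convexOn_integral_risk hconv)
        (fun s x c hs hlim hc => integral_risk_le_of_tendsto hF hf hfatou hs hlim hc) x₀ hδ
      set y : Ω →ₘ[P] ℝ := (hy'.toL1 y').1 with hydef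
      have hyy : ∀ᵐ ω ∂P, y ω = y' ω := hy'.coeFn_toL1
      have hy : Integrable y P := hy'.congr (hyy.mono fun ω h => h.symm)
      have hsub : ∀ x : Lp ℝ ∞ P, ∫ ω, (f x₀ : Lp ℝ ∞ P) ω ∂P - δ +
          ∫ ω, y ω * (x ω - x₀ ω) ∂P ≤ ∫ ω, (f x : Lp ℝ ∞ P) ω ∂P := by
        intro x
        have h1 : ∫ ω, y ω * (x ω - x₀ ω) ∂P = ∫ ω, y' ω * (x ω - x₀ ω) ∂P :=
          integral_congr_ae (hyy.mono fun ω h => by simp only [h])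
        rw [h1]
        exact hsub' x
      have hmem : y ∈ Lp ℝ 1 P ∧ y ≤ 0 ∧ (condE mF y : Ω →ₘ[P] ℝ) = -1 := by
        refine ⟨(hy'.toL1 y').2, ?_, condE_eq_neg_one_of_subgradient hF hf hy hδ hsub⟩
        rw [← AEEqFun.coeFn_le]
        filter_upwards [hyy, hneg, AEEqFun.coeFn_zero (μ := P) (β := ℝ)] with ω k1 k2 k3
        rw [k1, k3]
        exact k2
      have hle : toExt (condE mF ((x₀ : Ω →ₘ[P] ℝ) * y)) - randomConj f y ≤ U :=
        le_iSup₂_of_le y hmem le_rfl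
      refine le_trans (lintegral_mono_ae ?_) (lintegral_randomConj_sub_gain_le hF hf hy hsub)
      filter_upwards [(ExtL0.le_iff _ _).1 hle,
        ExtL0.coeFn_sub (toExt (condE mF ((x₀ : Ω →ₘ[P] ℝ) * y))) (randomConj f y),
        coeFn_toExt (condE mF ((x₀ : Ω →ₘ[P] ℝ) * y)), coeFn_gain (f := f) y x₀]
        with ω k1 k2 k3 k4
      rw [k2, k3] at k1
      rw [k4]
      exact EReal.toENNReal_le_toENNReal (EReal_sub_le_sub_of_sub_le k1)
    have hzero : ∫⁻ ω, ((((f x₀ : Lp ℝ ∞ P) ω : ℝ) : EReal) - U.1 ω).toENNReal ∂P = 0 := by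
      refine le_antisymm (ENNReal.le_of_forall_pos_le_add fun ε hε _ => ?_) (by simp)
      have := hint ε hε
      rwa [ENNReal.ofReal_coe_nnreal, ← zero_add (ε : ℝ≥0∞)] at this
    have hm : AEMeasurable
        (fun ω => ((((f x₀ : Lp ℝ ∞ P) ω : ℝ) : EReal) - U.1 ω).toENNReal) P :=
      (measurable_ereal_sub.comp ((AEEqFun.measurable _).coe_real_ereal.prodMk
        U.1.measurable)).ereal_toENNReal.aemeasurable
    rw [lintegral_eq_zero_iff' hm] at hzero
    rw [ExtL0.le_iff]
    filter_upwards [hzero, coeFn_toExt (inclLinfMeas (f x₀))] with ω k1 k2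
    rw [k2]
    have k3 : (((f x₀ : Lp ℝ ∞ P) ω : ℝ) : EReal) - U.1 ω ≤ 0 := EReal.toENNReal_eq_zero_iff.1 k1
    exact EReal_coe_le_of_coe_sub_nonpos k3
  · rw [ExtL0.le_iff]
    filter_upwards [gain_le_randomConj (f := f) y x₀, coeFn_gain (f := f) y x₀,
      ExtL0.coeFn_sub (toExt (condE mF ((x₀ : Ω →ₘ[P] ℝ) * y))) (randomConj f y),
      coeFn_toExt (condE mF ((x₀ : Ω →ₘ[P] ℝ) * y)), coeFn_toExt (inclLinfMeas (f x₀))]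
      with ω k1 k2 k3 k4 k5
    rw [k3, k4, k5]
    rw [k2] at k1
    exact EReal_coe_sub_le_of_coe_sub_le k1

end Dual

/-! ### Continuity from above and the Fatou property -/

section Fatou

variable {Ω : Type*} {mF mE : MeasurableSpace Ω} {P : Measure Ω}
  {f : Lp ℝ ∞ P → lpMeas ℝ ℝ mF ∞ P}

/-- The tail suprema of a bounded convergent sequence decrease to its limit. -/
theorem tendsto_iSup_tail {a : ℕ → ℝ} {l C : ℝ} (hC : ∀ n, |a n| ≤ C)
    (h : Tendsto a atTop (𝓝 l)) :
    (Antitone fun n => ⨆ m, a (n + m)) ∧ Tendsto (fun n => ⨆ m, a (n + m)) atTop (𝓝 l) := by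
  have hb : ∀ n, BddAbove (Set.range fun m => a (n + m)) := fun n =>
    ⟨C, Set.forall_mem_range.2 fun m => (abs_le.1 (hC _)).2⟩
  refine ⟨antitone_nat_of_succ_le fun n => ciSup_le fun m => ?_, tendsto_order.2 ⟨?_, ?_⟩⟩
  · have := le_ciSup (hb n) (m + 1)
    rwa [← add_assoc, add_right_comm] at this
  · intro b hb'
    filter_upwards [h.eventually_const_lt hb'] with n hn
    exact hn.trans_le (le_ciSup (hb n) 0)
  · intro b hb'
    obtain ⟨c, hc, hcb⟩ := exists_between hb'
    obtain ⟨N, hN⟩ := eventually_atTop.1 (h.eventually_lt_const hc)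
    filter_upwards [eventually_ge_atTop N] with n hn
    exact (ciSup_le fun m => (hN (n + m) (hn.trans (Nat.le_add_right _ _))).le).trans_lt hcb

/-- The tail suprema `vₙ = ⨆ₘ u (n + m)` decrease to the limit of a bounded sequence `u` and have
smaller risk than `uₙ`. -/
theorem fatou_of_continuousFromAbove (hf : IsLinfRiskMeasure f) (hc : ContinuousFromAbove f) :
    FatouProperty f := by
  rintro u x ⟨C, hC⟩ hlim
  have hb : ∀ᵐ ω ∂P, ∀ n, |u n ω| ≤ C :=
    ae_all_iff.2 fun n => (ae_abs_le_norm (u n)).mono fun ω h => h.trans (hC n)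
  have hv : ∀ n, ∃ v : Lp ℝ ∞ P, ∀ᵐ ω ∂P, v ω = ⨆ m, u (n + m) ω := fun n =>
    exists_Linf_ae_eq (C := C)
      (Measurable.iSup fun m => (AEEqFun.measurable _)).aestronglyMeasurable (by
        filter_upwards [hb] with ω h
        have hbd : BddAbove (Set.range fun m => u (n + m) ω) :=
          ⟨C, Set.forall_mem_range.2 fun m => (abs_le.1 (h _)).2⟩
        exact abs_le.2 ⟨(abs_le.1 (h (n + 0))).1.trans (le_ciSup hbd 0),
          ciSup_le fun m => (abs_le.1 (h _)).2⟩)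
  choose v hv using hv
  have h1 := hc v x (by
    filter_upwards [ae_all_iff.2 hv, hb, hlim] with ω k1 k2 k3
    simp only [k1]
    exact tendsto_iSup_tail k2 k3)
  have h2 : ∀ n, ∀ᵐ ω ∂P, (f (v n) : Lp ℝ ∞ P) ω ≤ (f (u n) : Lp ℝ ∞ P) ω := by
    refine fun n => hf.ae_antitone ?_
    filter_upwards [hv n, hb] with ω k1 k2
    have hbd : BddAbove (Set.range fun m => u (n + m) ω) :=
      ⟨C, Set.forall_mem_range.2 fun m => (abs_le.1 (k2 _)).2⟩
    rw [k1]
    exact le_ciSup hbd 0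
  filter_upwards [h1, ae_all_iff.2 h2] with ω k1 k2
  have h3 : Tendsto (fun n => (((f (v n) : Lp ℝ ∞ P) ω : ℝ) : EReal)) atTop
      (𝓝 (((f x : Lp ℝ ∞ P) ω : ℝ) : EReal)) :=
    (continuous_coe_real_ereal.tendsto _).comp k1.2
  rw [← h3.liminf_eq]
  exact liminf_le_liminf (Eventually.of_forall fun n => EReal.coe_le_coe_iff.2 (k2 n))

/-- Continuity from above follows if every `s ∈ L⁰(𝓕)` that dominates all `f(uₙ)`, `uₙ ↘ x`,
dominates `f(x)`. -/
theorem continuousFromAbove_of_forall [IsFiniteMeasure P] (hF : mF ≤ mE)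
    (hf : IsLinfRiskMeasure f)
    (h : ∀ (u : ℕ → Lp ℝ ∞ P) (x : Lp ℝ ∞ P), (∀ᵐ ω ∂P, Antitone fun n => u n ω) →
      (∀ᵐ ω ∂P, Tendsto (fun n => u n ω) atTop (𝓝 (x ω))) → ∀ s : L0F mF P,
      (∀ n, ∀ᵐ ω ∂P, (f (u n) : Lp ℝ ∞ P) ω ≤ (s : Ω →ₘ[P] ℝ) ω) →
      ∀ᵐ ω ∂P, (f x : Lp ℝ ∞ P) ω ≤ (s : Ω →ₘ[P] ℝ) ω) : ContinuousFromAbove f := by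
  intro u x hu
  have hanti : ∀ᵐ ω ∂P, Antitone fun n => u n ω := hu.mono fun ω h => h.1
  have hlim := hu.mono fun ω h => h.2
  have hmono : ∀ᵐ ω ∂P, Monotone fun n => (f (u n) : Lp ℝ ∞ P) ω := by
    have h1 : ∀ n, ∀ᵐ ω ∂P, (f (u n) : Lp ℝ ∞ P) ω ≤ (f (u (n + 1)) : Lp ℝ ∞ P) ω := fun n =>
      hf.ae_antitone (hanti.mono fun ω h => h (Nat.le_succ n))
    filter_upwards [ae_all_iff.2 h1] with ω h1 using monotone_nat_of_le_succ h1
  have hle : ∀ᵐ ω ∂P, ∀ n, (f (u n) : Lp ℝ ∞ P) ω ≤ (f x : Lp ℝ ∞ P) ω :=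
    ae_all_iff.2 fun n => hf.ae_antitone (hu.mono fun ω h => h.1.le_of_tendsto h.2 n)
  choose g hgm hg using fun n => exists_measurable_ae_eq_of_lpMeas (f (u n))
  obtain ⟨s, hs⟩ := exists_L0F_ae_eq (P := P) hF (g := fun ω => ⨆ n, g n ω) (Measurable.iSup hgm)
  have hs' : ∀ᵐ ω ∂P, Tendsto (fun n => (f (u n) : Lp ℝ ∞ P) ω) atTop
      (𝓝 ((s : Ω →ₘ[P] ℝ) ω)) := by
    filter_upwards [hs, ae_all_iff.2 hg, hmono, hle] with ω k1 k2 k3 k4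
    rw [k1]
    simp only [← k2]
    exact tendsto_atTop_ciSup k3 ⟨_, Set.forall_mem_range.2 k4⟩
  have h1 := h u x hanti hlim s fun n => by
    filter_upwards [hmono, hs'] with ω k1 k2 using k1.ge_of_tendsto k2 n
  filter_upwards [h1, hmono, hs', hle] with ω k1 k2 k3 k4
  refine ⟨k2, ?_⟩
  rwa [le_antisymm k1 (le_of_tendsto' k3 k4)]

end Fatou

/-! ### The dual representation of the extension -/

section DualExt

variable {Ω : Type*} {mF mE : MeasurableSpace Ω} {P : Measure Ω}
  {f : Lp ℝ ∞ P → lpMeas ℝ ℝ mF ∞ P}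

/-- A conditional density that belongs to `L¹_𝓕(𝓔)` belongs to `L¹(𝓔)`. -/
theorem mem_Lp_iff_mem_L1F [IsProbabilityMeasure P] (hF : mF ≤ mE) {y : Ω →ₘ[P] ℝ} (hy : y ≤ 0)
    (hE : (condE mF y : Ω →ₘ[P] ℝ) = -1) : y ∈ Lp ℝ 1 P ↔ y ∈ L1F mF P := by
  rw [Lp.mem_Lp_iff_memLp, memLp_one_iff_integrable]
  refine ⟨L1F_of_integrable, fun h => ⟨y.aestronglyMeasurable, ?_⟩⟩
  have h0 : ∀ᵐ ω ∂P, condLExp mF P (fun ω => ‖y ω‖ₑ) ω < ∞ := h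
  have hy0 : ∀ᵐ ω ∂P, y ω ≤ 0 := by
    filter_upwards [AEEqFun.coeFn_le.2 hy, AEEqFun.coeFn_zero (μ := P) (β := ℝ)] with ω k1 k2
    rwa [k2] at k1
  have h1 : condLExp mF P (fun ω => ENNReal.ofReal (y ω)) =ᵐ[P] condLExp mF P 0 :=
    condLExp_congr_ae (hy0.mono fun ω h => by simp [h])
  have h2 : condLExp mF P (fun ω => ENNReal.ofReal (-y ω)) =ᵐ[P]
      condLExp mF P (fun ω => ‖y ω‖ₑ) :=
    condLExp_congr_ae (hy0.mono fun ω h => by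
      simp only
      rw [← Real.enorm_eq_ofReal (by linarith), enorm_neg])
  have h3 : ∀ᵐ ω ∂P, condLExp mF P (fun ω => ‖y ω‖ₑ) ω = 1 := by
    have h4 := coeFn_condE (mF := mF) y
    rw [hE] at h4
    filter_upwards [h0, h1, h2, h4, AEEqFun.coeFn_neg (1 : Ω →ₘ[P] ℝ),
      AEEqFun.coeFn_one (μ := P) (β := ℝ)] with ω k0 k1 k2 k3 k4 k5
    rw [k4, Pi.neg_apply, k5, Pi.one_apply, k1, k2, condLExp_zero, Pi.zero_apply,
      ENNReal.toReal_zero, zero_sub, neg_inj] at k3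
    rw [← ENNReal.toReal_eq_toReal_iff' k0.ne ENNReal.one_ne_top, ← k3, ENNReal.toReal_one]
  change ∫⁻ ω, ‖y ω‖ₑ ∂P < ∞
  rw [← lintegral_condLExp hF, lintegral_congr_ae h3]
  simp

/-- The random conjugates of `f` and of its extension coincide: on `{ξ ≤ n}`, where `ξ ∈ L⁰(𝓕)`
dominates `|x|`, an element `x ∈ L^∞_𝓕(𝓔)` agrees with its truncation at level `n`. -/
theorem randomConjExt_eq_randomConj [IsFiniteMeasure P] (hF : mF ≤ mE)
    {fbar : LinfF mF P → L0F mF P} (hfbar : IsExtension f fbar) (y : Ω →ₘ[P] ℝ) :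
    randomConjExt fbar y = randomConj f y := by
  refine le_antisymm (iSup_le fun x => ?_) (iSup_le fun x => ?_)
  · obtain ⟨ξ, hξm, hξ⟩ := exists_bound_of_LinfF x
    have key : ∀ n : ℕ, ∀ᵐ ω ∂P, ξ ω ≤ n →
        (((condE mF ((x : Ω →ₘ[P] ℝ) * y) : Ω →ₘ[P] ℝ) ω - (fbar x : Ω →ₘ[P] ℝ) ω : ℝ) : EReal) ≤
          (randomConj f y).1 ω := by
      intro n
      have hA : MeasurableSet[mF] {ω | ξ ω ≤ n} := hξm measurableSet_Iic
      have htr : ∀ᵐ ω ∂P, ω ∈ {ω | ξ ω ≤ n} →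
          (x : Ω →ₘ[P] ℝ) ω = truncLinf (x : Ω →ₘ[P] ℝ) n ω := by
        filter_upwards [hξ, truncLinf_eq_of_abs_le (x : Ω →ₘ[P] ℝ) n] with ω h1 h2 hω
        exact (h2 (h1.trans hω)).symm
      have h1 := condE_congr_on hF (z := (x : Ω →ₘ[P] ℝ) * y)
        (z' := (truncLinf (x : Ω →ₘ[P] ℝ) n : Ω →ₘ[P] ℝ) * y) hA (by
          filter_upwards [htr, AEEqFun.coeFn_mul (x : Ω →ₘ[P] ℝ) y,
            AEEqFun.coeFn_mul (truncLinf (x : Ω →ₘ[P] ℝ) n : Ω →ₘ[P] ℝ) y] with ω k1 k2 k3 hω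
          rw [k2, k3, Pi.mul_apply, Pi.mul_apply, k1 hω])
      filter_upwards [h1, hfbar.congr_on hF hA htr,
        gain_le_randomConj (f := f) y (truncLinf (x : Ω →ₘ[P] ℝ) n),
        coeFn_gain (f := f) y (truncLinf (x : Ω →ₘ[P] ℝ) n)] with ω k1 k2 k3 k4 hω
      rw [k1 hω, k2 hω, ← k4]
      exact k3
    rw [ExtL0.le_iff]
    filter_upwards [ae_all_iff.2 key, coeFn_toExt (condE mF ((x : Ω →ₘ[P] ℝ) * y) - fbar x),
      AEEqFun.coeFn_sub (condE mF ((x : Ω →ₘ[P] ℝ) * y) : Ω →ₘ[P] ℝ) (fbar x : Ω →ₘ[P] ℝ)]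
      with ω k1 k2 k3
    obtain ⟨n, hn⟩ := exists_nat_ge (ξ ω)
    rw [k2, AddSubgroup.coe_sub, k3]
    exact k1 n hn
  · refine le_iSup_of_le (inclLinf x) ?_
    rw [hfbar.extends_f]
    exact le_rfl

theorem sub_le_randomConjExt [IsFiniteMeasure P] (fbar : LinfF mF P → L0F mF P)
    (y : Ω →ₘ[P] ℝ) (x : LinfF mF P) : ∀ᵐ ω ∂P,
    (((condE mF ((x : Ω →ₘ[P] ℝ) * y) : Ω →ₘ[P] ℝ) ω - (fbar x : Ω →ₘ[P] ℝ) ω : ℝ) : EReal) ≤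
      (randomConjExt fbar y).1 ω := by
  have h : toExt (condE mF ((x : Ω →ₘ[P] ℝ) * y) - fbar x) ≤ randomConjExt fbar y :=
    le_iSup (fun x : LinfF mF P => toExt (condE mF ((x : Ω →ₘ[P] ℝ) * y) - fbar x)) x
  filter_upwards [(ExtL0.le_iff _ _).1 h, coeFn_toExt (condE mF ((x : Ω →ₘ[P] ℝ) * y) - fbar x),
      AEEqFun.coeFn_sub (condE mF ((x : Ω →ₘ[P] ℝ) * y) : Ω →ₘ[P] ℝ) (fbar x : Ω →ₘ[P] ℝ)]
      with ω k1 k2 k3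
  rwa [k2, AddSubgroup.coe_sub, k3] at k1

theorem exists_extL0_piecewise_top (hF : mF ≤ mE) (U : ExtL0 mF P) {A : Set Ω}
    (hA : MeasurableSet[mF] A) : ∃ V : ExtL0 mF P, ∀ᵐ ω ∂P,
      (ω ∈ A → V.1 ω = U.1 ω) ∧ (ω ∉ A → V.1 ω = ⊤) := by
  classical
  obtain ⟨u, hu, hu'⟩ := U.2
  have hm : StronglyMeasurable[mF] (A.piecewise u fun _ => ⊤) :=
    hu.piecewise hA stronglyMeasurable_const
  have h := AEEqFun.coeFn_mk _ ((hm.mono hF).aestronglyMeasurable (μ := P))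
  refine ⟨⟨AEEqFun.mk _ _, ⟨_, hm, h⟩⟩, ?_⟩
  filter_upwards [h, hu'] with ω k1 k2
  refine ⟨fun hω => ?_, fun hω => ?_⟩
  · rw [k1, k2, Set.piecewise_eq_of_mem _ _ _ hω]
  · rw [k1, Set.piecewise_eq_of_notMem _ _ _ hω]

/-- A dual representation of `f` passes to the extension.  On `{ξ ≤ n}` it is that of the truncation
at level `n`; setting the upper bound to `⊤` off that event makes the comparison local. -/
theorem dual_representation_ext [IsFiniteMeasure P] (hF : mF ≤ mE)
    {fbar : LinfF mF P → L0F mF P} (hfbar : IsExtension f fbar) {Y : Set (Ω →ₘ[P] ℝ)}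
    (hdual : ∀ x : Lp ℝ ∞ P, toExt (inclLinfMeas (f x)) =
      ⨆ y ∈ Y, (toExt (condE mF ((x : Ω →ₘ[P] ℝ) * y)) - randomConj f y)) (x : LinfF mF P) :
    toExt (fbar x) =
      ⨆ y ∈ Y, (toExt (condE mF ((x : Ω →ₘ[P] ℝ) * y)) - randomConjExt fbar y) := by
  refine le_antisymm ?_ (iSup₂_le fun y _ => ?_)
  · set U : ExtL0 mF P :=
      ⨆ y ∈ Y, (toExt (condE mF ((x : Ω →ₘ[P] ℝ) * y)) - randomConjExt fbar y) with hU
    obtain ⟨ξ, hξm, hξ⟩ := exists_bound_of_LinfF x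
    have key : ∀ n : ℕ, ∀ᵐ ω ∂P, ξ ω ≤ n → (((fbar x : Ω →ₘ[P] ℝ) ω : ℝ) : EReal) ≤ U.1 ω := by
      intro n
      set A : Set Ω := {ω | ξ ω ≤ n} with hAdef
      have hA : MeasurableSet[mF] A := hξm measurableSet_Iic
      have htr : ∀ᵐ ω ∂P, ω ∈ A → (x : Ω →ₘ[P] ℝ) ω = truncLinf (x : Ω →ₘ[P] ℝ) n ω := by
        filter_upwards [hξ, truncLinf_eq_of_abs_le (x : Ω →ₘ[P] ℝ) n] with ω h1 h2 hω
        exact (h2 (h1.trans hω)).symm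
      obtain ⟨V, hV⟩ := exists_extL0_piecewise_top hF U hA
      have h1 : toExt (inclLinfMeas (f (truncLinf (x : Ω →ₘ[P] ℝ) n))) ≤ V := by
        rw [hdual]
        refine iSup₂_le fun y hy => ?_
        have h2 : toExt (condE mF ((x : Ω →ₘ[P] ℝ) * y)) - randomConjExt fbar y ≤ U :=
          le_iSup₂_of_le y hy le_rfl
        rw [randomConjExt_eq_randomConj hF hfbar] at h2
        have h3 := condE_congr_on hF (z := (x : Ω →ₘ[P] ℝ) * y)
          (z' := (truncLinf (x : Ω →ₘ[P] ℝ) n : Ω →ₘ[P] ℝ) * y) hA (by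
            filter_upwards [htr, AEEqFun.coeFn_mul (x : Ω →ₘ[P] ℝ) y,
              AEEqFun.coeFn_mul (truncLinf (x : Ω →ₘ[P] ℝ) n : Ω →ₘ[P] ℝ) y] with ω k1 k2 k3 hω
            rw [k2, k3, Pi.mul_apply, Pi.mul_apply, k1 hω])
        rw [ExtL0.le_iff] at h2 ⊢
        filter_upwards [h2, h3, hV, coeFn_toExt (condE mF ((x : Ω →ₘ[P] ℝ) * y)),
          coeFn_toExt (condE mF ((truncLinf (x : Ω →ₘ[P] ℝ) n : Ω →ₘ[P] ℝ) * y)),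
          ExtL0.coeFn_sub (toExt (condE mF ((x : Ω →ₘ[P] ℝ) * y))) (randomConj f y),
          ExtL0.coeFn_sub (toExt (condE mF ((truncLinf (x : Ω →ₘ[P] ℝ) n : Ω →ₘ[P] ℝ) * y)))
            (randomConj f y)] with ω k2 k3 k4 k5 k6 k7 k8
        by_cases hω : ω ∈ A
        · rw [k4.1 hω, k8, k6, ← k3 hω, ← k5, ← k7]
          exact k2
        · rw [k4.2 hω]
          exact le_top
      filter_upwards [(ExtL0.le_iff _ _).1 h1, hV, hfbar.congr_on hF hA htr,
        coeFn_toExt (inclLinfMeas (f (truncLinf (x : Ω →ₘ[P] ℝ) n)))] with ω k1 k2 k3 k4 hω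
      rw [k3 hω, ← k2.1 hω]
      rw [k4] at k1
      exact k1
    rw [ExtL0.le_iff]
    filter_upwards [ae_all_iff.2 key, coeFn_toExt (fbar x)] with ω k1 k2
    obtain ⟨n, hn⟩ := exists_nat_ge (ξ ω)
    rw [k2]
    exact k1 n hn
  · rw [ExtL0.le_iff]
    filter_upwards [sub_le_randomConjExt fbar y x,
      ExtL0.coeFn_sub (toExt (condE mF ((x : Ω →ₘ[P] ℝ) * y))) (randomConjExt fbar y),
      coeFn_toExt (condE mF ((x : Ω →ₘ[P] ℝ) * y)), coeFn_toExt (fbar x)] with ω k1 k2 k3 k4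
    rw [k2, k3, k4]
    exact EReal_coe_sub_le_of_coe_sub_le k1

end DualExt

/-! ### Lower semicontinuity -/

section LSC

variable {Ω : Type*} {mF mE : MeasurableSpace Ω} {P : Measure Ω}
  {f : Lp ℝ ∞ P → lpMeas ℝ ℝ mF ∞ P}

theorem condE_sub_mul [IsFiniteMeasure P] (hF : mF ≤ mE) (x z : LinfF mF P) {y : Ω →ₘ[P] ℝ}
    (hy : y ∈ L1F mF P) : ∀ᵐ ω ∂P,
    (condE mF (((x - z : LinfF mF P) : Ω →ₘ[P] ℝ) * y) : Ω →ₘ[P] ℝ) ω =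
      (condE mF ((x : Ω →ₘ[P] ℝ) * y) : Ω →ₘ[P] ℝ) ω -
        (condE mF ((z : Ω →ₘ[P] ℝ) * y) : Ω →ₘ[P] ℝ) ω := by
  have h : ((x - z : LinfF mF P) : Ω →ₘ[P] ℝ) * y =
      (x : Ω →ₘ[P] ℝ) * y - (z : Ω →ₘ[P] ℝ) * y := by
    refine AEEqFun.ext ?_
    filter_upwards [AEEqFun.coeFn_mul ((x - z : LinfF mF P) : Ω →ₘ[P] ℝ) y,
      AEEqFun.coeFn_mul (x : Ω →ₘ[P] ℝ) y, AEEqFun.coeFn_mul (z : Ω →ₘ[P] ℝ) y,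
      AEEqFun.coeFn_sub (x : Ω →ₘ[P] ℝ) (z : Ω →ₘ[P] ℝ),
      AEEqFun.coeFn_sub ((x : Ω →ₘ[P] ℝ) * y) ((z : Ω →ₘ[P] ℝ) * y)] with ω k1 k2 k3 k4 k5
    rw [k1, k5, Pi.mul_apply, Pi.sub_apply, k2, k3, Pi.mul_apply, Pi.mul_apply,
      AddSubgroup.coe_sub, k4, Pi.sub_apply, sub_mul]
  rw [h]
  exact condE_sub (mul_mem_L1F hF x hy) (mul_mem_L1F hF z hy)

theorem coeFn_weakSeminorm [IsFiniteMeasure P] (y : L1F mF P) (x : LinfF mF P) : ∀ᵐ ω ∂P,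
    weakSeminorm y x ω =
      |(condE mF ((x : Ω →ₘ[P] ℝ) * (y : Ω →ₘ[P] ℝ)) : Ω →ₘ[P] ℝ) ω| :=
  AEEqFun.coeFn_abs _

theorem weakSeminorm_triangle [IsFiniteMeasure P] (hF : mF ≤ mE) (y : L1F mF P)
    (x z w : LinfF mF P) : ∀ᵐ ω ∂P,
    weakSeminorm y (x - w) ω ≤ weakSeminorm y (x - z) ω + weakSeminorm y (z - w) ω := by
  filter_upwards [coeFn_weakSeminorm y (x - w), coeFn_weakSeminorm y (x - z),
    coeFn_weakSeminorm y (z - w), condE_sub_mul hF x w y.2, condE_sub_mul hF x z y.2,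
    condE_sub_mul hF z w y.2] with ω k1 k2 k3 k4 k5 k6
  rw [k1, k2, k3, k4, k5, k6]
  exact abs_sub_le _ _ _

theorem coeFn_absNorm (r s : L0F mF P) : ∀ᵐ ω ∂P,
    absNorm () (r - s) ω = |(r : Ω →ₘ[P] ℝ) ω - (s : Ω →ₘ[P] ℝ) ω| := by
  filter_upwards [AEEqFun.coeFn_abs ((r - s : L0F mF P) : Ω →ₘ[P] ℝ),
    AEEqFun.coeFn_sub (r : Ω →ₘ[P] ℝ) (s : Ω →ₘ[P] ℝ)] with ω k1 k2
  have k3 : absNorm () (r - s) ω = |((r - s : L0F mF P) : Ω →ₘ[P] ℝ) ω| := k1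
  rw [k3, AddSubgroup.coe_sub, k2, Pi.sub_apply]

theorem absNorm_triangle (u : Unit) (r s t : L0F mF P) : ∀ᵐ ω ∂P,
    absNorm u (r - t) ω ≤ absNorm u (r - s) ω + absNorm u (s - t) ω := by
  filter_upwards [coeFn_absNorm r t, coeFn_absNorm r s, coeFn_absNorm s t] with ω k1 k2 k3
  rw [k1, k2, k3]
  exact abs_sub_le _ _ _

theorem measureReal_add_sub_one_le_inter [IsProbabilityMeasure P] {A B : Set Ω}
    (hB : NullMeasurableSet B P) : P.real A + P.real B - 1 ≤ P.real (A ∩ B) := by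
  have h1 : P.real (A ∩ B) + P.real (A \ B) = P.real A := measureReal_inter_add_sdiff₀ hB
  have h2 : P.real (A \ B) ≤ P.real Bᶜ := measureReal_mono (fun ω h => h.2)
  have h3 : P.real Bᶜ = 1 - P.real B := by
    rw [measureReal_compl₀ hB, probReal_univ]
  linarith

/-- The balls of the `(ε, λ)`-topology are open. -/
theorem isOpen_epsLam_ball [IsProbabilityMeasure P] {E ι : Type*} [AddCommGroup E]
    {p : ι → E → Ω →ₘ[P] ℝ} (i : ι)
    (hp : ∀ x z w : E, ∀ᵐ ω ∂P, p i (x - w) ω ≤ p i (x - z) ω + p i (z - w) ω) (x : E)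
    (ε lam : ℝ) : IsOpen[epsLamTopology P p] {z | 1 - lam < P.real {ω | p i (z - x) ω < ε}} := by
  intro z hz
  have hz : 1 - lam < P.real {ω | p i (z - x) ω < ε} := hz
  let B : ℕ → Set Ω := fun n => {ω | p i (z - x) ω < ε - 1 / (n + 1 : ℝ)}
  have hBU : ⋃ n, B n = {ω | p i (z - x) ω < ε} := by
    ext ω
    simp only [Set.mem_iUnion]
    constructor
    · rintro ⟨n, hn⟩
      have hn : p i (z - x) ω < ε - 1 / (n + 1 : ℝ) := hn
      have : (0 : ℝ) < 1 / (n + 1 : ℝ) := by positivity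
      exact hn.trans (by linarith)
    · intro h
      have h : p i (z - x) ω < ε := h
      obtain ⟨n, hn⟩ := exists_nat_one_div_lt (sub_pos.2 h)
      exact ⟨n, show p i (z - x) ω < ε - 1 / (n + 1 : ℝ) by linarith⟩
  have hBmono : Monotone B := by
    intro n m hnm ω hω
    have hω : p i (z - x) ω < ε - 1 / (n + 1 : ℝ) := hω
    have h1 : (1 : ℝ) / (m + 1 : ℝ) ≤ 1 / (n + 1 : ℝ) :=
      one_div_le_one_div_of_le (by positivity) (by exact_mod_cast Nat.succ_le_succ hnm)
    exact hω.trans_le (by linarith)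
  have hlim : Tendsto (fun n => P.real (B n)) atTop (𝓝 (P.real {ω | p i (z - x) ω < ε})) := by
    rw [← hBU]
    exact (ENNReal.tendsto_toReal (measure_ne_top _ _)).comp (tendsto_measure_iUnion_atTop hBmono)
  obtain ⟨n, hn⟩ := (hlim.eventually_const_lt hz).exists
  refine ⟨{i}, 1 / (n + 1 : ℝ), min (P.real (B n) - (1 - lam)) (1 / 2), by positivity,
    lt_min (by linarith) (by norm_num), (min_le_right _ _).trans_lt (by norm_num), fun w hw => ?_⟩
  have hw' : 1 - (P.real (B n) - (1 - lam)) < P.real {ω | p i (w - z) ω < 1 / (n + 1 : ℝ)} := by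
    refine lt_of_le_of_lt (by linarith [min_le_left (P.real (B n) - (1 - lam)) (1 / 2)])
      (hw.trans_le (measureReal_mono fun ω hω => hω i (Finset.mem_singleton_self i)))
  change 1 - lam < P.real {ω | p i (w - x) ω < ε}
  have hm : MeasurableSet {ω | p i (w - z) ω < 1 / (n + 1 : ℝ)} :=
    (p i (w - z)).measurable measurableSet_Iio
  have h1 : P.real (B n ∩ {ω | p i (w - z) ω < 1 / (n + 1 : ℝ)}) ≤
      P.real {ω | p i (w - x) ω < ε} := by
    refine ENNReal.toReal_mono (measure_ne_top _ _) (measure_mono_ae ?_)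
    filter_upwards [hp w z x] with ω h ⟨h2, h3⟩
    have h2 : p i (z - x) ω < ε - 1 / (n + 1 : ℝ) := h2
    have h3 : p i (w - z) ω < 1 / (n + 1 : ℝ) := h3
    exact h.trans_lt (by linarith)
  have h2 := measureReal_add_sub_one_le_inter (P := P) (A := B n) hm.nullMeasurableSet
  linarith

/-- The dual representation separates points from the epigraph: an element `y` of the dual module
and a gap `η` that persists on an event of positive probability. -/
theorem exists_gap [IsFiniteMeasure P] {fbar : LinfF mF P → L0F mF P}
    {Y : Set (Ω →ₘ[P] ℝ)} {x : LinfF mF P} {r : L0F mF P}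
    (hdual : toExt (fbar x) =
      ⨆ y ∈ Y, (toExt (condE mF ((x : Ω →ₘ[P] ℝ) * y)) - randomConjExt fbar y))
    (hxr : ¬(fbar x : Ω →ₘ[P] ℝ) ≤ r) :
    ∃ y ∈ Y, ∃ (η : ℝ) (B : Set Ω), 0 < η ∧ 0 < P B ∧ ∀ (z : LinfF mF P) (s : L0F mF P),
      (fbar z : Ω →ₘ[P] ℝ) ≤ s → ∀ᵐ ω ∂P, ω ∈ B →
        (condE mF ((z : Ω →ₘ[P] ℝ) * y) : Ω →ₘ[P] ℝ) ω - (s : Ω →ₘ[P] ℝ) ω + η <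
          (condE mF ((x : Ω →ₘ[P] ℝ) * y) : Ω →ₘ[P] ℝ) ω - (r : Ω →ₘ[P] ℝ) ω := by
  have h1 : ¬ toExt (fbar x) ≤ toExt r := by
    intro h
    refine hxr (L0F_le_of_ae ?_)
    filter_upwards [(ExtL0.le_iff _ _).1 h, coeFn_toExt (fbar x), coeFn_toExt r] with ω k1 k2 k3
    rwa [k2, k3, EReal.coe_le_coe_iff] at k1
  rw [hdual] at h1
  simp only [iSup_le_iff, not_forall] at h1
  obtain ⟨y, hy, h2⟩ := h1
  refine ⟨y, hy, ?_⟩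
  set a : Ω → ℝ := fun ω =>
    (condE mF ((x : Ω →ₘ[P] ℝ) * y) : Ω →ₘ[P] ℝ) ω - (r : Ω →ₘ[P] ℝ) ω with ha
  obtain ⟨n, hn⟩ : ∃ n : ℕ,
      0 < P {ω | (randomConjExt fbar y).1 ω < ((a ω - 1 / (n + 1 : ℝ) : ℝ) : EReal)} := by
    by_contra! hcon
    refine h2 ((ExtL0.le_iff _ _).2 ?_)
    have h3 : ∀ n : ℕ, ∀ᵐ ω ∂P,
        ((a ω - 1 / (n + 1 : ℝ) : ℝ) : EReal) ≤ (randomConjExt fbar y).1 ω := by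
      intro n
      have := nonpos_iff_eq_zero.1 (hcon n)
      rw [measure_eq_zero_iff_ae_notMem] at this
      filter_upwards [this] with ω hω
      exact not_lt.1 hω
    filter_upwards [ae_all_iff.2 h3,
      ExtL0.coeFn_sub (toExt (condE mF ((x : Ω →ₘ[P] ℝ) * y))) (randomConjExt fbar y),
      coeFn_toExt (condE mF ((x : Ω →ₘ[P] ℝ) * y)), coeFn_toExt r] with ω k1 k2 k3 k4
    rw [k2, k3, k4]
    refine EReal_coe_sub_le_of_coe_sub_le (EReal.ge_of_forall_gt_iff_ge.1 fun c hc => ?_)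
    have hc' : c < a ω := EReal.coe_lt_coe_iff.1 hc
    obtain ⟨m, hm⟩ := exists_nat_one_div_lt (sub_pos.2 hc')
    exact le_trans (EReal.coe_le_coe_iff.2 (by linarith)) (k1 m)
  refine ⟨1 / (n + 1 : ℝ), _, by positivity, hn, fun z s hzs => ?_⟩
  filter_upwards [sub_le_randomConjExt fbar y z, AEEqFun.coeFn_le.2 hzs] with ω k1 k2 hω
  have h3 := lt_of_le_of_lt k1 hω
  rw [EReal.coe_lt_coe_iff] at h3
  simp only [ha] at h3
  linarith

theorem isLscLocConv_of_dual [IsFiniteMeasure P] (hF : mF ≤ mE)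
    {fbar : LinfF mF P → L0F mF P} {Y : Set (Ω →ₘ[P] ℝ)}
    (hY : Y ⊆ L1F mF P)
    (hdual : ∀ x, toExt (fbar x) =
      ⨆ y ∈ Y, (toExt (condE mF ((x : Ω →ₘ[P] ℝ) * y)) - randomConjExt fbar y)) :
    IsLscLocConv fbar := by
  intro r
  refine (@isOpen_compl_iff _ _ (locConvTopology mF P _)).1 fun x hx => ?_
  obtain ⟨y, hy, η, B, hη, hB, hgap⟩ := exists_gap (hdual x) hx
  refine ⟨{⟨y, hY hy⟩}, constL0 η, ?_, fun z hz hzr => ?_⟩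
  · filter_upwards [coeFn_constL0 (mF := mF) (P := P) η] with ω h
    rwa [h]
  · have h1 := AEEqFun.coeFn_le.2 (hz ⟨y, hY hy⟩ (Finset.mem_singleton_self _))
    have h2 : ∀ᵐ ω ∂P, ω ∉ B := by
      filter_upwards [h1, coeFn_constL0 (mF := mF) (P := P) η, hgap z r hzr,
        coeFn_weakSeminorm ⟨y, hY hy⟩ (z - x), condE_sub_mul hF z x (hY hy)]
        with ω k1 k2 k3 k4 k5 hω
      rw [k4, k2, k5] at k1
      linarith [k3 hω, (abs_le.1 k1).1]
    exact hB.ne' (measure_eq_zero_iff_ae_notMem.2 h2)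

theorem isLscEpsLam_of_dual [IsProbabilityMeasure P] (hF : mF ≤ mE)
    {fbar : LinfF mF P → L0F mF P} {Y : Set (Ω →ₘ[P] ℝ)}
    (hY : Y ⊆ L1F mF P)
    (hdual : ∀ x, toExt (fbar x) =
      ⨆ y ∈ Y, (toExt (condE mF ((x : Ω →ₘ[P] ℝ) * y)) - randomConjExt fbar y)) :
    IsLscEpsLam fbar := by
  let t1 : TopologicalSpace (LinfF mF P) := epsLamTopology P (weakSeminorm (mF := mF) (P := P))
  let t2 : TopologicalSpace (L0F mF P) := epsLamTopology P (absNorm (mF := mF) (P := P))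
  change IsClosed {q : LinfF mF P × L0F mF P | (fbar q.1 : Ω →ₘ[P] ℝ) ≤ q.2}
  rw [← isOpen_compl_iff, isOpen_prod_iff]
  intro x r hxr
  obtain ⟨y, hy, η, B, hη, hB, hgap⟩ := exists_gap (hdual x) hxr
  have hB' : 0 < P.real B := ENNReal.toReal_pos hB.ne' (measure_ne_top _ _)
  refine ⟨{z | 1 - P.real B / 2 < P.real {ω | weakSeminorm ⟨y, hY hy⟩ (z - x) ω < η / 2}},
    {s | 1 - P.real B / 2 < P.real {ω | absNorm () (s - r) ω < η / 2}},
    isOpen_epsLam_ball _ (weakSeminorm_triangle hF _) x _ _,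
    isOpen_epsLam_ball _ (absNorm_triangle _) r _ _, ?_, ?_, ?_⟩
  · change 1 - P.real B / 2 < P.real {ω | weakSeminorm ⟨y, hY hy⟩ (x - x) ω < η / 2}
    have h1 : ∀ᵐ ω ∂P, weakSeminorm ⟨y, hY hy⟩ (x - x) ω < η / 2 := by
      filter_upwards [coeFn_weakSeminorm ⟨y, hY hy⟩ (x - x), condE_sub_mul hF x x (hY hy)]
        with ω k1 k2
      rw [k1, k2, sub_self, abs_zero]
      linarith
    have h2 : P.real {ω | weakSeminorm ⟨y, hY hy⟩ (x - x) ω < η / 2} = 1 := by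
      rw [measureReal_congr (eventuallyEq_univ.2 h1), probReal_univ]
    linarith
  · change 1 - P.real B / 2 < P.real {ω | absNorm () (r - r) ω < η / 2}
    have h1 : ∀ᵐ ω ∂P, absNorm () (r - r) ω < η / 2 := by
      filter_upwards [coeFn_absNorm r r] with ω k1
      rw [k1, sub_self, abs_zero]
      linarith
    have h2 : P.real {ω | absNorm () (r - r) ω < η / 2} = 1 := by
      rw [measureReal_congr (eventuallyEq_univ.2 h1), probReal_univ]
    linarith
  · rintro ⟨z, s⟩ ⟨hz, hs⟩ hzs
    set C : Set Ω := {ω | weakSeminorm ⟨y, hY hy⟩ (z - x) ω < η / 2} with hC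
    set D : Set Ω := {ω | absNorm () (s - r) ω < η / 2} with hD
    have hz : 1 - P.real B / 2 < P.real C := hz
    have hs : 1 - P.real B / 2 < P.real D := hs
    have hCm : MeasurableSet C :=
      (weakSeminorm ⟨y, hY hy⟩ (z - x)).measurable measurableSet_Iio
    have hDm : MeasurableSet D := (absNorm () (s - r)).measurable measurableSet_Iio
    have h1 := measureReal_add_sub_one_le_inter (P := P) (A := B) hCm.nullMeasurableSet
    have h2 := measureReal_add_sub_one_le_inter (P := P) (A := B ∩ C) hDm.nullMeasurableSet
    have h3 : ∀ᵐ ω ∂P, ω ∉ B ∩ C ∩ D := by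
      filter_upwards [hgap z s hzs, coeFn_weakSeminorm ⟨y, hY hy⟩ (z - x),
        condE_sub_mul hF z x (hY hy), coeFn_absNorm s r]
      rintro ω k1 k2 k3 k4 ⟨⟨hωB, hωC⟩, hωD⟩
      have hωC : weakSeminorm ⟨y, hY hy⟩ (z - x) ω < η / 2 := hωC
      have hωD : absNorm () (s - r) ω < η / 2 := hωD
      rw [k2, k3, abs_lt] at hωC
      rw [k4, abs_lt] at hωD
      linarith [k1 hωB]
    have h4 : P.real (B ∩ C ∩ D) = 0 := by
      rw [Measure.real, measure_eq_zero_iff_ae_notMem.2 h3, ENNReal.toReal_zero]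
    linarith

end LSC

/-! ### Lower semicontinuity implies continuity from above -/

section LscImpContinuous

variable {Ω : Type*} {mF mE : MeasurableSpace Ω} {P : Measure Ω}
  {f : Lp ℝ ∞ P → lpMeas ℝ ℝ mF ∞ P}

theorem tendsto_weakSeminorm_of_antitone [IsFiniteMeasure P] (hF : mF ≤ mE)
    {u : ℕ → Lp ℝ ∞ P} {x : Lp ℝ ∞ P} (hanti : ∀ᵐ ω ∂P, Antitone fun n => u n ω)
    (hlim : ∀ᵐ ω ∂P, Tendsto (fun n => u n ω) atTop (𝓝 (x ω))) (y : L1F mF P) :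
    ∀ᵐ ω ∂P, Tendsto (fun n => weakSeminorm y (inclLinf (u n) - inclLinf x) ω) atTop (𝓝 0) := by
  filter_upwards [tendsto_condE_of_antitone hF (u := fun n => inclLinf (u n)) (x := inclLinf x)
    hanti hlim y.2, ae_all_iff.2 fun n => coeFn_weakSeminorm y (inclLinf (u n) - inclLinf x)]
    with ω k1 k2
  simp only [k2]
  simpa using k1.abs

theorem continuousFromAbove_of_isLscEpsLam [IsProbabilityMeasure P] (hF : mF ≤ mE)
    {fbar : LinfF mF P → L0F mF P} (hf : IsLinfRiskMeasure f) (hfbar : IsExtension f fbar)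
    (h : IsLscEpsLam fbar) : ContinuousFromAbove f := by
  refine continuousFromAbove_of_forall hF hf fun u x hanti hlim s hs => ?_
  let t1 : TopologicalSpace (LinfF mF P) := epsLamTopology P (weakSeminorm (mF := mF) (P := P))
  let t2 : TopologicalSpace (L0F mF P) := epsLamTopology P (absNorm (mF := mF) (P := P))
  have hcl : IsClosed {q : LinfF mF P × L0F mF P | (fbar q.1 : Ω →ₘ[P] ℝ) ≤ q.2} := h
  by_contra hcon
  have hmem : (inclLinf x, s) ∈ {q : LinfF mF P × L0F mF P | (fbar q.1 : Ω →ₘ[P] ℝ) ≤ q.2}ᶜ := by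
    intro hle
    refine hcon ?_
    filter_upwards [AEEqFun.coeFn_le.2 hle, hfbar.ae_eq x] with ω k1 k2
    rwa [k2] at k1
  obtain ⟨U, V, hU, -, hxU, hsV, hUV⟩ := isOpen_prod_iff.1 hcl.isOpen_compl _ _ hmem
  obtain ⟨Q, ε, l, hε, hl, -, hQ⟩ := hU _ hxU
  let T : ℕ → Set Ω := fun n =>
    {ω | ∀ m, n ≤ m → ∀ i ∈ Q, weakSeminorm i (inclLinf (u m) - inclLinf x) ω < ε}
  have hT : Monotone T := fun n m hnm ω hω k hk => hω k (hnm.trans hk)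
  have hTU : P.real (⋃ n, T n) = 1 := by
    have h1 : ∀ᵐ ω ∂P, ω ∈ ⋃ n, T n := by
      filter_upwards [(eventually_all_finset Q).2 fun i _ =>
        tendsto_weakSeminorm_of_antitone hF hanti hlim i] with ω k1
      have h2 := (eventually_all_finset Q).2 fun i hi => (k1 i hi).eventually_lt_const hε
      obtain ⟨n, hn⟩ := eventually_atTop.1 h2
      exact Set.mem_iUnion.2 ⟨n, hn⟩
    have h2 : ⋃ n, T n =ᵐ[P] Set.univ := eventuallyEq_univ.2 h1
    rw [measureReal_congr h2, probReal_univ]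
  have hlimT : Tendsto (fun n => P.real (T n)) atTop (𝓝 1) := by
    rw [← hTU]
    exact (ENNReal.tendsto_toReal (measure_ne_top _ _)).comp (tendsto_measure_iUnion_atTop hT)
  obtain ⟨n, hn⟩ := (hlimT.eventually_const_lt (show 1 - l < 1 by linarith)).exists
  have hun : inclLinf (u n) ∈ U := hQ _ (hn.trans_le (measureReal_mono fun ω hω => hω n le_rfl))
  refine hUV (Set.mk_mem_prod hun hsV) (L0F_le_of_ae ?_)
  filter_upwards [hs n, hfbar.ae_eq (u n)] with ω k1 k2
  rwa [k2]

/-- The elements `uₙ` are glued along the `𝓕`-measurable first time at which they enter a given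
`σ_c`-neighbourhood of `x`. -/
theorem continuousFromAbove_of_isLscLocConv [IsFiniteMeasure P] (hF : mF ≤ mE)
    {fbar : LinfF mF P → L0F mF P} (hf : IsLinfRiskMeasure f) (hfbar : IsExtension f fbar)
    (h : IsLscLocConv fbar) : ContinuousFromAbove f := by
  classical
  refine continuousFromAbove_of_forall hF hf fun u x hanti hlim s hs => ?_
  by_contra hcon
  obtain ⟨Q, ε, hε, hQ⟩ := (@isOpen_compl_iff _ _ (locConvTopology mF P _)).2 (h s) (inclLinf x) (by
    intro hle
    refine hcon ?_
    filter_upwards [AEEqFun.coeFn_le.2 hle, hfbar.ae_eq x] with ω k1 k2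
    rwa [k2] at k1)
  choose c hcm hc using fun (n : ℕ) (i : L1F mF P) => exists_measurable_ae_eq_of_L0F
    (condE mF (((inclLinf (u n) - inclLinf x : LinfF mF P) : Ω →ₘ[P] ℝ) * (i : Ω →ₘ[P] ℝ)))
  obtain ⟨e, hem, he⟩ := exists_measurable_ae_eq_of_L0F ε
  let G : ℕ → Set Ω := fun n => ⋂ i ∈ Q, {ω | |c n i ω| ≤ e ω}
  have hG : ∀ n, MeasurableSet[mF] (G n) := fun n => Finset.measurableSet_biInter Q fun i _ =>
    @measurableSet_le _ _ _ _ _ mF _ _ _ _ _ (continuous_abs.measurable.comp (hcm n i)) hem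
  have hGU : ∀ᵐ ω ∂P, ω ∈ ⋃ n, G n := by
    filter_upwards [(eventually_all_finset Q).2 fun i _ =>
        tendsto_weakSeminorm_of_antitone hF hanti hlim i,
      (eventually_all_finset Q).2 fun i _ => ae_all_iff.2 fun n =>
        coeFn_weakSeminorm i (inclLinf (u n) - inclLinf x),
      (eventually_all_finset Q).2 fun i _ => ae_all_iff.2 fun n => hc n i, hε, he]
      with ω k1 k2 k3 k4 k5
    obtain ⟨n, hn⟩ := ((eventually_all_finset Q).2 fun i hi =>
      (k1 i hi).eventually_lt_const k4).exists
    refine Set.mem_iUnion.2 ⟨n, Set.mem_iInter₂.2 fun i hi => ?_⟩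
    have := hn i hi
    rw [k2 i hi n, k3 i hi n, k5] at this
    exact this.le
  -- Outside `⋃ n, G n`, which is a null set, the first time is `0`.
  let G' : ℕ → Set Ω := fun n => G n ∪ (⋃ m, G m)ᶜ
  have hG' : ∀ n, MeasurableSet[mF] (G' n) := fun n =>
    (hG n).union (MeasurableSet.iUnion hG).compl
  have hex : ∀ ω, ∃ n, ω ∈ G' n := by
    intro ω
    by_cases hω : ω ∈ ⋃ n, G n
    · obtain ⟨n, hn⟩ := Set.mem_iUnion.1 hω
      exact ⟨n, Or.inl hn⟩
    · exact ⟨0, Or.inr hω⟩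
  let N : Ω → ℕ := fun ω => Nat.find (hex ω)
  have hN : Measurable[mF] N := @measurable_find _ mF _ _ hex hG'
  have hA : ∀ n, MeasurableSet[mF] {ω | N ω = n} := fun n => hN (measurableSet_singleton n)
  have hzm : Measurable fun ω => u (N ω) ω :=
    Measurable.find (f := fun n => u n) (p := fun n ω => ω ∈ G' n) (fun n => AEEqFun.measurable _)
      (fun n => hF _ (hG' n)) hex
  obtain ⟨z, hz⟩ := exists_Linf_ae_eq (P := P) (C := max ‖x‖ ‖u 0‖) hzm.aestronglyMeasurable (by
    filter_upwards [hanti, hlim, ae_abs_le_norm x, ae_abs_le_norm (u 0)] with ω k1 k2 k3 k4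
    have h1 : x ω ≤ u (N ω) ω := k1.le_of_tendsto k2 _
    have h2 : u (N ω) ω ≤ u 0 ω := k1 (Nat.zero_le _)
    exact abs_le.2 ⟨by linarith [(abs_le.1 k3).1, le_max_left ‖x‖ ‖u 0‖],
      by linarith [(abs_le.1 k4).2, le_max_right ‖x‖ ‖u 0‖]⟩)
  have hzn : ∀ n, ∀ᵐ ω ∂P, ω ∈ {ω | N ω = n} → z ω = u n ω := fun n => by
    filter_upwards [hz] with ω k1 hω
    have hω : N ω = n := hω
    rw [k1, hω]
  refine hQ (inclLinf z) (fun i hi => AEEqFun.coeFn_le.1 ?_) (L0F_le_of_ae ?_)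
  · have h1 : ∀ n, ∀ᵐ ω ∂P, ω ∈ {ω | N ω = n} →
        (condE mF (((inclLinf z - inclLinf x : LinfF mF P) : Ω →ₘ[P] ℝ) * (i : Ω →ₘ[P] ℝ)) :
          Ω →ₘ[P] ℝ) ω = c n i ω := by
      intro n
      have h2 := condE_congr_on hF (hA n)
        (z := ((inclLinf z - inclLinf x : LinfF mF P) : Ω →ₘ[P] ℝ) * (i : Ω →ₘ[P] ℝ))
        (z' := ((inclLinf (u n) - inclLinf x : LinfF mF P) : Ω →ₘ[P] ℝ) * (i : Ω →ₘ[P] ℝ)) (by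
          filter_upwards [hzn n,
            AEEqFun.coeFn_mul ((inclLinf z - inclLinf x : LinfF mF P) : Ω →ₘ[P] ℝ) i,
            AEEqFun.coeFn_mul ((inclLinf (u n) - inclLinf x : LinfF mF P) : Ω →ₘ[P] ℝ) i,
            AEEqFun.coeFn_sub (z : Ω →ₘ[P] ℝ) (x : Ω →ₘ[P] ℝ),
            AEEqFun.coeFn_sub (u n : Ω →ₘ[P] ℝ) (x : Ω →ₘ[P] ℝ)] with ω k1 k2 k3 k4 k5 hω
          have h4 : ((inclLinf z - inclLinf x : LinfF mF P) : Ω →ₘ[P] ℝ) ω = z ω - x ω := k4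
          have h5 : ((inclLinf (u n) - inclLinf x : LinfF mF P) : Ω →ₘ[P] ℝ) ω = u n ω - x ω := k5
          rw [k2, k3, Pi.mul_apply, Pi.mul_apply, h4, h5, k1 hω])
      filter_upwards [h2, hc n i] with ω k1 k2 hω
      rw [k1 hω, k2]
    filter_upwards [ae_all_iff.2 h1, hGU, coeFn_weakSeminorm i (inclLinf z - inclLinf x), he]
      with ω k1 k2 k3 k4
    have h3 : ω ∈ G (N ω) := (Nat.find_spec (hex ω)).resolve_right fun hω => hω k2
    rw [k3, k1 (N ω) rfl, k4]
    exact Set.mem_iInter₂.1 h3 i hi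
  · filter_upwards [ae_all_iff.2 fun n => hfbar.congr_on hF (x := inclLinf z) (hA n) (hzn n),
      ae_all_iff.2 hs] with ω k1 k2
    rw [k1 (N ω) rfl]
    exact k2 _

end LscImpContinuous

end CondRisk

theorem theorem4p25 {Ω : Type*} (mF : MeasurableSpace Ω) {mE : MeasurableSpace Ω} (hF : mF ≤ mE)
    (P : Measure Ω) [IsProbabilityMeasure P]
    (f : Lp ℝ ∞ P → lpMeas ℝ ℝ mF ∞ P)
    (hf : CondRisk.IsLinfRiskMeasure f) (hconv : CondRisk.IsL0Convex f) :
    (∃! fbar : CondRisk.LinfF mF P → CondRisk.L0F mF P, CondRisk.IsExtension f fbar) ∧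
    ∀ fbar : CondRisk.LinfF mF P → CondRisk.L0F mF P, CondRisk.IsExtension f fbar →
      List.TFAE [
        CondRisk.ContinuousFromAbove f,
        CondRisk.FatouProperty f,
        ∀ x : Lp ℝ ∞ P, CondRisk.toExt (CondRisk.inclLinfMeas (f x)) =
          ⨆ y ∈ {y : Ω →ₘ[P] ℝ | y ∈ Lp ℝ 1 P ∧ y ≤ 0 ∧
              (CondRisk.condE mF y : Ω →ₘ[P] ℝ) = -1},
            (CondRisk.toExt (CondRisk.condE mF ((x : Ω →ₘ[P] ℝ) * y)) - CondRisk.randomConj f y),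
        ∀ x : Lp ℝ ∞ P, CondRisk.toExt (CondRisk.inclLinfMeas (f x)) =
          ⨆ y ∈ {y : Ω →ₘ[P] ℝ | y ∈ CondRisk.L1F mF P ∧ y ≤ 0 ∧
              (CondRisk.condE mF y : Ω →ₘ[P] ℝ) = -1},
            (CondRisk.toExt (CondRisk.condE mF ((x : Ω →ₘ[P] ℝ) * y)) - CondRisk.randomConj f y),
        ∀ x : CondRisk.LinfF mF P, CondRisk.toExt (fbar x) =
          ⨆ y ∈ {y : Ω →ₘ[P] ℝ | y ∈ CondRisk.L1F mF P ∧ y ≤ 0 ∧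
              (CondRisk.condE mF y : Ω →ₘ[P] ℝ) = -1},
            (CondRisk.toExt (CondRisk.condE mF ((x : Ω →ₘ[P] ℝ) * y)) -
              CondRisk.randomConjExt fbar y),
        CondRisk.IsLscEpsLam fbar,
        CondRisk.IsLscLocConv fbar] := by
  refine ⟨⟨CondRisk.extendRisk hF hf, CondRisk.isExtension_extendRisk hF hf, fun g hg =>
    hg.unique hF (CondRisk.isExtension_extendRisk hF hf)⟩, fun fbar hfbar => ?_⟩
  have hset : {y : Ω →ₘ[P] ℝ | y ∈ Lp ℝ 1 P ∧ y ≤ 0 ∧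
      (CondRisk.condE mF y : Ω →ₘ[P] ℝ) = -1} = {y : Ω →ₘ[P] ℝ | y ∈ CondRisk.L1F mF P ∧ y ≤ 0 ∧
      (CondRisk.condE mF y : Ω →ₘ[P] ℝ) = -1} :=
    Set.ext fun y => and_congr_left fun hy => CondRisk.mem_Lp_iff_mem_L1F hF hy.1 hy.2
  tfae_have 1 → 2 := CondRisk.fatou_of_continuousFromAbove hf
  tfae_have 2 → 3 := CondRisk.dual_representation_of_fatou hF hf hconv
  tfae_have 3 → 4 := fun h => by rwa [hset] at h
  tfae_have 4 → 5 := CondRisk.dual_representation_ext hF hfbar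
  tfae_have 5 → 6 := CondRisk.isLscEpsLam_of_dual hF fun y hy => hy.1
  tfae_have 5 → 7 := CondRisk.isLscLocConv_of_dual hF fun y hy => hy.1
  tfae_have 6 → 1 := CondRisk.continuousFromAbove_of_isLscEpsLam hF hf hfbar
  tfae_have 7 → 1 := CondRisk.continuousFromAbove_of_isLscLocConv hF hf hfbar
  tfae_finish
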